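/- Let $s\in\{0,1\}$. Let $z=p^{-1}$ if $\nu=\infty$ and $z=p-\nu$ if $\nu\in\mathbb C$, and let $\mathcal A^\nu=\mathbb C((z))$ be the field of formal Laurent series at $\nu$, with $f_p=\partial f/\partial p$ and trace $\operatorname{Tr}_\infty f=-\operatorname{res}_{p=\infty}(p^{-s}f)$, $\operatorname{Tr}_\nu f=\operatorname{res}_{p=\nu}(p^{-s}f)$ for finite $\nu$. Let $[f]_{\ge 0}$ be the part of $f$ with nonnegative powers of $p$ (if $\nu=\infty$), respectively of $p-\nu$. Consider the following manifolds of series $\lambda$. * $\mathcal A^\infty_M$: $\lambda=p^n+u_{n-1}p^{n-1}+u_{n-2}p^{n-2}+\dots$, with $n$ fixed and $u_{n-1}=0$ if $s=0$; coordinates $u_i\in\mathbb C$. * $\mathcal A^0_M$: $\lambda=u_{-m}p^{-m}+u_{1-m}p^{1-m}+\dots$, with $m\in\mathbb Z$ fixed, $u_{-m}\ne0$; coordinates $u_i\in\mathbb C$. * $\mathcal A^v_M$: $\lambda=u_{-m}(p-v)^{-m}+u_{1-m}(p-v)^{1-m}+\dots$, with $m\in\mathbb Z$ fixed, $u_{-m}\neq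 0$, and $v\in\mathbb C$ ($v\ne0$ if $s=1$). For $m\neq0$ the coordinates are the $u_i$ and $v$. For $m=0$ the derivative $\partial\lambda/\partial v=-\lambda_p$ already lies in the span of the $\partial\lambda/\partial u_i$, and for each $v$ the $u_i$ are the coordinates of a chart. The tangent space $T_\lambda\subset\mathcal A^\nu$ consists of the derivatives of $\lambda$ (at fixed $p$) along all, possibly infinite, families of coordinate increments. The cotangent space is $T^*_\lambda=\mathcal A^\nu/T_\lambda^\perp$ for the pairing $\langle\alpha,X\rangle=\operatorname{Tr}_\nu(X\alpha)$; it consists of the finite linear combinations of the coordinate differentials. Put $$\alpha\circ\beta=p^s[\lambda_p\alpha]_{\ge0}\,\beta+p^s\alpha\,[\lambda_p\beta]_{\ge0}-p^s\lambda_p\alpha\beta,\qquad \eta^*(\alpha,\beta)=\operatorname{Tr}_\nu(\alpha\circ\beta),\qquad \alpha^\sharp=p^s[\lambda_p\alpha]_{\ge0}-p^s\lambda_p[\alpha]_{\ge0}.$$ Let $\lambda$ be called generic if $\alpha^\sharp=0$ implies $\alpha\in T_\lambda^\perp$. A *Frobenius manifold structure* on such a space means the following, with all tensors smooth (components analytic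 in finitely many coordinates) and written on the cotangent bundle. The generic points are dense in the product topology and form an open subset of each finite-dimensional affine subspace of the coordinate space. In each $T^*_\lambda$, $\circ$ induces a commutative associative multiplication, and $\eta^*$ a symmetric form with canonical map $\sharp:T_\lambda^*\to T_\lambda$, $\eta^*(\alpha,\beta)=\langle\beta,\alpha^\sharp\rangle$. At generic points $\sharp$ is injective and $\eta^*(\alpha\circ\beta,\gamma)=\eta^*(\alpha,\beta\circ\gamma)$. There is a unit vector field $e$, that is $\langle\alpha\circ\beta,e\rangle=\langle\alpha,\beta^\sharp\rangle$ (so $e*\beta^\sharp=\beta^\sharp$, where $\alpha^\sharp*\beta^\sharp=(\alpha\circ\beta)^\sharp$ and, for any vector field $X$, $\langle\alpha,X*\beta^\sharp\rangle=\langle\alpha\circ\beta,X\rangle$). On the set of generic points $\eta^*$ has a Levi-Civita connection $\nabla_{\alpha^\sharp}$ (torsionless, metric), which is flat. The tensor $\nabla c$ with $c(\alpha^\sharp,\beta^\sharp,\gamma^\sharp)=\eta^*(\alpha\circ\beta,\gamma)$ is symmetric in its four arguments, and $\nabla e=0$. There is a vector field $E$ with $\nabla\nabla E=0$, $\mathcal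 L_E\circ=(d-1)\circ$, $\mathcal L_E\eta^*=(d-2)\eta^*$ for a number $d$. Then $\circ$, $\eta^*$ define a Frobenius manifold structure in the following cases. 1. On $\mathcal A^\infty_M$ for $s=0,1$ and $n\ge1$, with $e=1-\lambda_p$ if $s=0$, $n=1$ and $e=1$ otherwise, $E=\lambda-\frac1n p\lambda_p$, $d=1+(s-1)\frac2n$. 2. On $\mathcal A^0_M$ for $s=0$, $m=0$, and for $s=1$, $m\ge1$, with $e=1$, $E=\lambda$, $d=1$. 3. On $\mathcal A^0_M$ for $s=1$, $m=-1$, with $e=1-\frac1{u_1}\lambda_p$, $E=\lambda$, $d=1$, except that the unit vector field is not flat: $\nabla e\ne0$. 4. On $\mathcal A^v_M$ for $s=0,1$ and $m\ge-1$, with $e=1$, $E=\lambda$, $d=1$. Moreover, in case 1 with $s=0$, in case 2 with $s=1$ and in case 3 there is a smooth one-form $\varepsilon$ on the set of generic points with $\varepsilon^\sharp=e$ which is the unit of $\circ$. -/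

import Mathlib

open scoped Topology

noncomputable section

namespace FrobLaurent

/-! ## Frobenius manifolds in contravariant form, modelled on `ℂ^ι`

`ι` is a finite or infinite set of coordinates. A point and a tangent vector are families
`ι → ℂ`; a covector is a finite combination of the coordinate differentials, `ι →₀ ℂ`.
For infinite `ι` the tangent space is the full dual of the cotangent space, so metric,
multiplication and connection are carried by the cotangent bundle. For finite `ι` and an open
set of `ℂ^ι` this is the usual notion of a (holomorphic) Frobenius manifold. -/

section General

variable {ι : Type}

/-- The duality pairing `⟨a, X⟩`. -/
def pair (a : ι →₀ ℂ) (X : ι → ℂ) : ℂ := a.sum fun i c => c * X i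

/-- The covector with components `f`, for `f` of finite support (and `0` otherwise). -/
def toCovec (f : ι → ℂ) : ι →₀ ℂ := by
  classical
  exact if h : (Function.support f).Finite then Finsupp.ofSupportFinite f h else 0

/-- Smooth (holomorphic) functions on `M`: functions of finitely many coordinates,
analytic in these. -/
def RegFun (M : Set (ι → ℂ)) (f : (ι → ℂ) → ℂ) : Prop :=
  ∃ (S : Finset ι) (g : (S → ℂ) → ℂ),
    ∀ u ∈ M, AnalyticAt ℂ g (fun i => u i) ∧ f u = g (fun i => u i)

/-- Smooth vector fields on `M`. -/
def RegVec (M : Set (ι → ℂ)) (Y : (ι → ℂ) → (ι → ℂ)) : Prop :=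
  ∀ k, RegFun M fun u => Y u k

/-- Smooth one-forms on `M`. -/
def RegForm (M : Set (ι → ℂ)) (β : (ι → ℂ) → (ι →₀ ℂ)) : Prop :=
  (∃ S : Finset ι, ∀ u ∈ M, (β u).support ⊆ S) ∧ ∀ k, RegFun M fun u => β u k

/-- `M` meets every finite-dimensional affine subspace in an open set. -/
def FinitelyOpen (M : Set (ι → ℂ)) : Prop :=
  ∀ (u : ι → ℂ) (k : ℕ) (X : Fin k → (ι → ℂ)),
    IsOpen {t : Fin k → ℂ | u + ∑ i, t i • X i ∈ M}

/-- The directional derivative of a function along the vector `X` at the point `u`. -/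
def dirFun (X : ι → ℂ) (f : (ι → ℂ) → ℂ) (u : ι → ℂ) : ℂ := lineDeriv ℂ f u X

/-- The directional derivative of a one-form, taken on the components. -/
def dirForm (X : ι → ℂ) (β : (ι → ℂ) → (ι →₀ ℂ)) (u : ι → ℂ) : ι →₀ ℂ :=
  toCovec fun k => dirFun X (fun w => β w k) u

/-- The tensors of a Frobenius manifold: the isomorphism `♯` of the contravariant metric, the
multiplication `∘` of covectors, the unit vector field `e`, the Euler vector field `E` and the
weight `d`. -/
structure FrobeniusData (ι : Type) where
  sharp : (ι → ℂ) → (ι →₀ ℂ) →ₗ[ℂ] (ι → ℂ)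
  mul : (ι → ℂ) → (ι →₀ ℂ) →ₗ[ℂ] (ι →₀ ℂ) →ₗ[ℂ] (ι →₀ ℂ)
  e : (ι → ℂ) → (ι → ℂ)
  E : (ι → ℂ) → (ι → ℂ)
  d : ℂ

variable (F : FrobeniusData ι)

/-- The contravariant metric `η*(a, b) = ⟨b, a♯⟩`. -/
def eta (u : ι → ℂ) (a b : ι →₀ ℂ) : ℂ := pair b (F.sharp u a)

/-- The Lie bracket of the vector fields `α♯` and `β♯`. -/
def bracketSharp (α β : (ι → ℂ) → (ι →₀ ℂ)) (u : ι → ℂ) : ι → ℂ := fun k =>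
  dirFun (F.sharp u (α u)) (fun w => F.sharp w (β w) k) u
    - dirFun (F.sharp u (β u)) (fun w => F.sharp w (α w) k) u

/-- A covariant derivative along the vector fields `α♯` is given by its contravariant
Christoffel symbols `G u (dxⁱ) (dxʲ) = ∇_{(dxⁱ)♯} dxʲ`. -/
abbrev Conn (ι : Type) := (ι → ℂ) → (ι →₀ ℂ) →ₗ[ℂ] (ι →₀ ℂ) →ₗ[ℂ] (ι →₀ ℂ)

variable (G : Conn ι)

/-- The covariant derivative `∇_{α♯} β` of the one-form `β`. -/
def nabla (α β : (ι → ℂ) → (ι →₀ ℂ)) : (ι → ℂ) → (ι →₀ ℂ) := fun u =>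
  dirForm (F.sharp u (α u)) β u + G u (α u) (β u)

/-- The covariant derivative `∇_{a♯} Y` of the vector field `Y`, where `a` has constant
components; it is determined by `⟨c, ∇_{a♯} Y⟩ = a♯⟨c, Y⟩ - ⟨∇_{a♯} c, Y⟩`. -/
def nablaVec (a : ι →₀ ℂ) (Y : (ι → ℂ) → (ι → ℂ)) : (ι → ℂ) → (ι → ℂ) := fun u k =>
  dirFun (F.sharp u a) (fun w => Y w k) u - pair (G u a (Finsupp.single k 1)) (Y u)

/-- The curvature `R(a♯, b♯) c = ∇_{a♯} ∇_{b♯} c - ∇_{b♯} ∇_{a♯} c - ∇_{[a, b]} c`, where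
`[a, b] = ∇_{a♯} b - ∇_{b♯} a`, so that `[a, b]♯ = [a♯, b♯]` for a torsionless connection. -/
def curvature (a b c : ι →₀ ℂ) (u : ι → ℂ) : ι →₀ ℂ :=
  nabla F G (fun _ => a) (nabla F G (fun _ => b) fun _ => c) u
    - nabla F G (fun _ => b) (nabla F G (fun _ => a) fun _ => c) u
    - nabla F G (fun w => nabla F G (fun _ => a) (fun _ => b) w
        - nabla F G (fun _ => b) (fun _ => a) w) (fun _ => c) u

/-- The tensor `c(a♯, b♯, c♯) = η(a♯ * b♯, c♯) = η*(a ∘ b, c)`. -/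
def cTensor (u : ι → ℂ) (a b c : ι →₀ ℂ) : ℂ := eta F u (F.mul u a b) c

/-- The tensor `∇c`, evaluated at `a♯; b♯, c♯, d♯`. -/
def nablaC (u : ι → ℂ) (a b c d : ι →₀ ℂ) : ℂ :=
  dirFun (F.sharp u a) (fun w => cTensor F w b c d) u
    - cTensor F u (G u a b) c d - cTensor F u b (G u a c) d - cTensor F u b c (G u a d)

/-- The Lie derivative `L_E a = d⟨a, E⟩` of the one-form `a` with constant components. -/
def lieCovec (a : ι →₀ ℂ) (u : ι → ℂ) : ι →₀ ℂ :=
  toCovec fun k => dirFun (⇑(Finsupp.single k (1 : ℂ))) (fun w => pair a (F.E w)) u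

/-- All requirements on a Frobenius manifold `M` except the flatness of the unit, for the
connection `G`. Each is the vanishing of a tensor, written on one-forms with constant
components. -/
structure IsFrobeniusWith (M : Set (ι → ℂ)) : Prop where
  finitelyOpen : FinitelyOpen M
  reg_sharp : ∀ a, RegVec M fun u => F.sharp u a
  reg_mul : ∀ a b, RegForm M fun u => F.mul u a b
  reg_conn : ∀ a b, RegForm M fun u => G u a b
  reg_e : RegVec M F.e
  reg_E : RegVec M F.E
  /-- The metric is symmetric and nondegenerate. -/
  eta_symm : ∀ u ∈ M, ∀ a b, eta F u a b = eta F u b a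
  eta_nondeg : ∀ u ∈ M, Function.Injective (F.sharp u)
  /-- Frobenius algebra. -/
  mul_comm : ∀ u ∈ M, ∀ a b, F.mul u a b = F.mul u b a
  mul_assoc : ∀ u ∈ M, ∀ a b c, F.mul u (F.mul u a b) c = F.mul u a (F.mul u b c)
  invariant : ∀ u ∈ M, ∀ a b c, eta F u (F.mul u a b) c = eta F u a (F.mul u b c)
  /-- `e` is the unit, `e * b♯ = b♯`: the product of a vector field `X` with `b♯` is the vector
  field with `⟨a, X * b♯⟩ = ⟨a ∘ b, X⟩`, which for `X = c♯` is `(c ∘ b)♯`. -/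
  unit : ∀ u ∈ M, ∀ a b, pair (F.mul u a b) (F.e u) = pair a (F.sharp u b)
  /-- `G` is the Levi-Civita connection of the metric. -/
  torsionless : ∀ u ∈ M, ∀ a b, bracketSharp F (fun _ => a) (fun _ => b) u =
    F.sharp u (nabla F G (fun _ => a) (fun _ => b) u - nabla F G (fun _ => b) (fun _ => a) u)
  metric : ∀ u ∈ M, ∀ a b c, dirFun (F.sharp u a) (fun w => eta F w b c) u =
    eta F u (nabla F G (fun _ => a) (fun _ => b) u) c
      + eta F u b (nabla F G (fun _ => a) (fun _ => c) u)
  /-- The metric is flat. -/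
  flat : ∀ u ∈ M, ∀ a b c, curvature F G a b c u = 0
  /-- `∇c` is symmetric in all its four arguments. -/
  nablaC_symm : ∀ u ∈ M, ∀ a b c d,
    nablaC F G u a b c d = nablaC F G u b a c d ∧
    nablaC F G u a b c d = nablaC F G u a c b d ∧
    nablaC F G u a b c d = nablaC F G u a b d c
  /-- `∇∇E = 0`. -/
  euler_affine : ∀ u ∈ M, ∀ a b,
    nablaVec F G a (nablaVec F G b F.E) u
      = nablaVec F G (nabla F G (fun _ => a) (fun _ => b) u) F.E u
  /-- `L_E ∘ = (d - 1) ∘`, equivalently `L_E * = *`. -/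
  lie_mul : ∀ u ∈ M, ∀ a b,
    dirForm (F.E u) (fun w => F.mul w a b) u + lieCovec F (F.mul u a b) u
      - F.mul u (lieCovec F a u) b - F.mul u a (lieCovec F b u) = (F.d - 1) • F.mul u a b
  /-- `L_E η* = (d - 2) η*`, equivalently `L_E η = (2 - d) η`. -/
  lie_eta : ∀ u ∈ M, ∀ a b,
    dirFun (F.E u) (fun w => eta F w a b) u
      - eta F u (lieCovec F a u) b - eta F u a (lieCovec F b u) = (F.d - 2) * eta F u a b

/-- `∇e = 0`. -/
def UnitFlat (M : Set (ι → ℂ)) : Prop := ∀ u ∈ M, ∀ a, nablaVec F G a F.e u = 0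

/-- `F` makes `M` a Frobenius manifold. -/
def IsFrobeniusManifold (M : Set (ι → ℂ)) : Prop :=
  ∃ G : Conn ι, IsFrobeniusWith F G M ∧ UnitFlat F G M

/-- `F` makes `M` a Frobenius manifold, except that the unit vector field is not flat. -/
def IsFrobeniusManifoldNonflatUnit (M : Set (ι → ℂ)) : Prop :=
  ∃ G : Conn ι, IsFrobeniusWith F G M ∧ ¬ UnitFlat F G M

/-- The unit vector field comes from a one-form `ε`, `e = ε♯`, which is the unit of `∘`. -/
def HasUnitForm (M : Set (ι → ℂ)) : Prop :=
  ∃ ε : (ι → ℂ) → (ι →₀ ℂ), RegForm M ε ∧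
    ∀ u ∈ M, F.sharp u (ε u) = F.e u ∧ ∀ b, F.mul u (ε u) b = b

end General

/-! ## Laurent series at a marked point of the Riemann sphere -/

/-- Formal Laurent series in the local parameter `z`: `z = p⁻¹` at `∞`, `z = p - v` at `v`. -/
abbrev Laurent := LaurentSeries ℂ

/-- Marked points of the Riemann sphere. -/
inductive MarkedPoint where
  | infinity : MarkedPoint
  | finite (v : ℂ) : MarkedPoint

namespace MarkedPoint

/-- The coordinate function `p`. -/
def p : MarkedPoint → Laurent
  | infinity => HahnSeries.single (-1) 1
  | finite v => HahnSeries.C v + HahnSeries.single 1 1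

/-- The derivative `f_p = ∂f/∂p`; at infinity `∂/∂p = - z² ∂/∂z`. -/
def dp : MarkedPoint → Laurent → Laurent
  | infinity, f => -(HahnSeries.single 2 1 * LaurentSeries.derivative ℂ f)
  | finite _, f => LaurentSeries.derivative ℂ f

/-- `f ↦ ∑ aᵢ zⁱ` over those `i` which satisfy `P`, for `f = ∑ aᵢ zⁱ`. -/
def cut (P : ℤ → Prop) [DecidablePred P] (f : Laurent) : Laurent where
  coeff i := if P i then f.coeff i else 0
  isPWO_support' := f.isPWO_support.mono fun i hi => by
    by_contra h
    have h' : f.coeff i = 0 := by simpa using h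
    simp [h'] at hi

/-- The projection `[f]_{≥ 0}` on the nonnegative powers of `p` (at infinity), respectively
of `p - v`. -/
def nonneg : MarkedPoint → Laurent → Laurent
  | infinity, f => cut (fun i => i ≤ 0) f
  | finite _, f => cut (fun i => 0 ≤ i) f

/-- The trace `Tr f = - res_{p = ∞} (p⁻ˢ f)`, respectively `Tr f = res_{p = v} (p⁻ˢ f)`: the
coefficient of `p⁻¹`, respectively of `(p - v)⁻¹`, in `p⁻ˢ f`. -/
def tr (ν : MarkedPoint) (s : ℕ) (f : Laurent) : ℂ :=
  match ν with
  | infinity => ((infinity.p ^ s)⁻¹ * f).coeff 1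
  | finite v => (((finite v).p ^ s)⁻¹ * f).coeff (-1)

/-- `α♯ = pˢ [λ_p α]_{≥ 0} - pˢ λ_p [α]_{≥ 0}`. -/
def sharp (ν : MarkedPoint) (s : ℕ) (lam α : Laurent) : Laurent :=
  ν.p ^ s * ν.nonneg (ν.dp lam * α) - ν.p ^ s * ν.dp lam * ν.nonneg α

/-- `α ∘ β = pˢ [λ_p α]_{≥ 0} β + pˢ α [λ_p β]_{≥ 0} - pˢ λ_p α β`. -/
def circ (ν : MarkedPoint) (s : ℕ) (lam α β : Laurent) : Laurent :=
  ν.p ^ s * ν.nonneg (ν.dp lam * α) * β + ν.p ^ s * α * ν.nonneg (ν.dp lam * β)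
    - ν.p ^ s * ν.dp lam * α * β

end MarkedPoint

/-- The Laurent series `∑_{k ≥ 0} u_k z^{k + N}`. -/
def series (N : ℤ) (u : ℕ → ℂ) : Laurent :=
  HahnSeries.single N 1 * HahnSeries.ofPowerSeries ℤ ℂ (PowerSeries.mk u)

/-- A space of Laurent series with coordinates: the exponent `s` of the derivation `pˢ ∂/∂p`,
the range of the coordinates, the marked point, the series `λ`, and the differential of `λ` at
fixed `p`, which embeds the tangent space into the Laurent series. -/
structure LaurentSpace (ι : Type) where
  s : ℕ
  dom : Set (ι → ℂ)
  point : (ι → ℂ) → MarkedPoint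
  lam : (ι → ℂ) → Laurent
  dlam : (ι → ℂ) → (ι → ℂ) → Laurent

/-- `λ = pⁿ + u_{n-1} pⁿ⁻¹ + u_{n-2} pⁿ⁻² + …` at infinity, where `u_{n-1} = 0` for `s = 0`.
The `k`-th coordinate is the coefficient of `p^{n + s - 2 - k}`. -/
def spaceInfinity (s n : ℕ) : LaurentSpace ℕ where
  s := s
  dom := Set.univ
  point _ := .infinity
  lam u := HahnSeries.single (-(n : ℤ)) 1 + series (2 - n - s) u
  dlam _ X := series (2 - n - s) X

/-- `λ = u_{-m} (p - v)⁻ᵐ + u_{1-m} (p - v)¹⁻ᵐ + …` at the fixed finite point `v`, of degree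
exactly `m`. The `k`-th coordinate is the coefficient of `(p - v)^{k - m}`. -/
def spaceFixed (s : ℕ) (m : ℤ) (v : ℂ) : LaurentSpace ℕ where
  s := s
  dom := {u | u 0 ≠ 0}
  point _ := .finite v
  lam u := series (-m) u
  dlam _ X := series (-m) X

/-- `λ = u_{-m} (p - v)⁻ᵐ + u_{1-m} (p - v)¹⁻ᵐ + …` at a moving point `v`, of degree exactly
`m`. The coordinate `none` is `v` (which is nonzero for `s = 1`), the coordinate `some k` is the
coefficient of `(p - v)^{k - m}`. The derivative of `λ` with respect to `v` is `- λ_p`. -/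
def spaceMoving (s : ℕ) (m : ℤ) : LaurentSpace (Option ℕ) where
  s := s
  dom := {u | u (some 0) ≠ 0 ∧ (s = 1 → u none ≠ 0)}
  point u := .finite (u none)
  lam u := series (-m) fun k => u (some k)
  dlam u X := (series (-m) fun k => X (some k))
    - X none • LaurentSeries.derivative ℂ (series (-m) fun k => u (some k))

namespace LaurentSpace

variable {ι : Type} (L : LaurentSpace ι)

/-- The trace form at the marked point of `λ(u)`. -/
def tr (u : ι → ℂ) (f : Laurent) : ℂ := (L.point u).tr L.s f

/-- `λ_p`. -/
def lamp (u : ι → ℂ) : Laurent := (L.point u).dp (L.lam u)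

/-- `α♯` at the point `λ(u)`. -/
def sharp (u : ι → ℂ) (α : Laurent) : Laurent := (L.point u).sharp L.s (L.lam u) α

/-- `α ∘ β` at the point `λ(u)`. -/
def circ (u : ι → ℂ) (α β : Laurent) : Laurent := (L.point u).circ L.s (L.lam u) α β

/-- The Laurent series `α` represents the covector `a` at `λ(u)`: `⟨a, X⟩ = Tr (X α)` for every
tangent vector `X`. So `α` is determined by `a` up to the orthogonal complement of the tangent
space. -/
def Represents (u : ι → ℂ) (a : ι →₀ ℂ) (α : Laurent) : Prop :=
  ∀ X : ι → ℂ, pair a X = L.tr u (L.dlam u X * α)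

/-- The generic points: those where the kernel of `♯` on the cotangent space is trivial, that is
`α♯ = 0` only for `α` in the orthogonal complement of the tangent space. -/
def generic : Set (ι → ℂ) :=
  {u | u ∈ L.dom ∧ ∀ α, L.sharp u α = 0 → ∀ X : ι → ℂ, L.tr u (L.dlam u X * α) = 0}

/-- `F` is the structure constructed on the space `L`: the cotangent space at `λ` is the quotient
of the space of Laurent series by the orthogonal complement of the tangent space, the metric is
`η*(α, β) = Tr (α ∘ β)`, its canonical isomorphism is `♯`, the multiplication is `∘` on the
quotient, the unit and Euler vector fields are `e` and `E`, and the weight is `d`. -/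
structure Realizes (e E : (ι → ℂ) → Laurent) (d : ℂ) (F : FrobeniusData ι) : Prop where
  exists_rep : ∀ u ∈ L.dom, ∀ a, ∃ α, L.Represents u a α
  exists_covec : ∀ u ∈ L.dom, ∀ α, ∃ a, L.Represents u a α
  metric : ∀ u ∈ L.dom, ∀ a b α β, L.Represents u a α → L.Represents u b β →
    eta F u a b = L.tr u (L.circ u α β)
  sharp : ∀ u ∈ L.dom, ∀ a α, L.Represents u a α → L.dlam u (F.sharp u a) = L.sharp u α
  mul : ∀ u ∈ L.dom, ∀ a b α β, L.Represents u a α → L.Represents u b β →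
    L.Represents u (F.mul u a b) (L.circ u α β)
  unit : ∀ u ∈ L.dom, L.dlam u (F.e u) = e u
  euler : ∀ u ∈ L.dom, L.dlam u (F.E u) = E u
  weight : F.d = d

end LaurentSpace

end FrobLaurent

end

open scoped Topology

noncomputable section

namespace FrobLaurent

/-! ## Commutative rings split into two subrings -/

/-! Write P and Q for the projections on nonnegative and negative powers, D for the derivation p^s
∂/∂p, and a ★ b = P(a)P(b) - Q(a)Q(b), the product of the difference of the two subalgebras. This
product is commutative and associative. For s = 0, 1 the derivation D preserves both subalgebras, so
it is a derivation of ★. Both subalgebras are isotropic for the residue pairing, and this turns the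
metric into η*(α, β) = -res(λ_p · (α ★ β)), which is linear in λ (`tr_mul_sharpW`, `tr_circW`).

The Levi-Civita connection is therefore explicit: ∇ along α♯ of β is ∂_{α♯}β + α ★ Dβ, with the
derivative taken at fixed p. Integration by parts and the Leibniz rule for D give compatibility with
the metric; closedness of constant one-forms gives vanishing torsion; associativity of ★ gives
vanishing curvature (`LaurentChart.metric`, `LaurentChart.torsionless`, `LaurentChart.flat`).

The multiplication ∘ is associative because λ_p(α ∘ β) = p^s((λ_p α) ★ (λ_p β)), so that P(λ_p ·) is
multiplicative up to p^s (`mul_circW`, `circW_assoc`). Symmetry of ∇c in its last three arguments is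
Frobenius algebra. The exchange of the first two is the one hard identity. It is proved in an
abstract ring split into two subrings (`Splitting.tau_symm`) and carried to Laurent series by
`nabla_circW_symm`.

The unit property follows from Tr(α ∘ β) = η*(α, β) and Tr(λ_p(α ∘ β)) = 0: every field 1 - f λ_p
acts as a unit, and f is chosen to make it tangent. For the Euler field λ - c p λ_p the Lie
derivative of covectors is ∂_E + κ, where κ (`kappa`) is the trace adjoint of y ↦ y - c p y_p; the
requirements on E become identities among κ, D, ★ and ∘.

Covectors are classes of series modulo the annihilator I of the tangent space, so all of this must
descend to the quotient. `LaurentChart` lists what this needs: I is the same at all points of a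
chart and is stable under the operations. `LinearSpace` (fixed point) and `movingChart` (moving
point) verify it by counting orders of series.

Finally, λ is generic exactly when λ_p is not a quotient of Laurent polynomials
(`LaurentChart.mem_generic_iff`). The excluded points form an affine subspace of every
finite-dimensional affine slice of the domain, hence the generic points are open there; adding a
tail with lacunary coefficients to λ shows that they are dense. -/

/-- A commutative ring split by complementary projections `P`, `Q` onto two subrings (without unit
in general), with a derivation `δ` preserving both and a scalar `σ`. -/
structure Splitting (R : Type*) [CommRing R] where
  P : R →+ R
  Q : R →+ R
  δ : R →+ R
  σ : R
  add : ∀ f, P f + Q f = f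
  PQ : ∀ f, P (Q f) = 0
  QP : ∀ f, Q (P f) = 0
  QPP : ∀ f g, Q (P f * P g) = 0
  PQQ : ∀ f g, P (Q f * Q g) = 0
  leibniz : ∀ f g, δ (f * g) = δ f * g + f * δ g
  Pδ : ∀ f, P (δ f) = δ (P f)
  Qδ : ∀ f, Q (δ f) = δ (Q f)
  Pσ : ∀ f, P (σ * f) = σ * P f
  Qσ : ∀ f, Q (σ * f) = σ * Q f

namespace Splitting

variable {R : Type*} [CommRing R] (S : Splitting R)

/-- The splitting with the two subrings interchanged. -/
def swap : Splitting R where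
  P := S.Q
  Q := S.P
  δ := S.δ
  σ := S.σ
  add f := by rw [add_comm, S.add]
  PQ := S.QP
  QP := S.PQ
  QPP := S.PQQ
  PQQ := S.QPP
  leibniz := S.leibniz
  Pδ := S.Qδ
  Qδ := S.Pδ
  Pσ := S.Qσ
  Qσ := S.Pσ

/-- The first order operator `σ + δ`. -/
def θ (f : R) : R := S.σ * f + S.δ f

/-- The product of the difference of the two subrings. -/
def star (a b : R) : R := S.P a * S.P b - S.Q a * S.Q b

/-- The product `P(wb) c + b P(wc) - w b c`. -/
def diamond (w b c : R) : R := S.P (w * b) * c + b * S.P (w * c) - w * b * c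

/-- The covariant derivative of the product `diamond`. -/
def tau (w a b c : R) : R :=
  S.diamond (S.θ (S.P (w * a) - w * S.P a)) b c + S.star a (S.θ (S.diamond w b c))
    - S.diamond w (S.star a (S.δ b)) c - S.diamond w b (S.star a (S.δ c))

lemma θ_add (f g : R) : S.θ (f + g) = S.θ f + S.θ g := by simp only [θ, map_add]; ring
lemma θ_neg (f : R) : S.θ (-f) = -S.θ f := by simp only [θ, map_neg]; ring
lemma θ_sub (f g : R) : S.θ (f - g) = S.θ f - S.θ g := by simp only [θ, map_sub]; ring
lemma θ_mul (f g : R) : S.θ (f * g) = S.θ f * g + f * S.δ g := by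
  simp only [θ, S.leibniz]; ring
lemma P_θ (f : R) : S.P (S.θ f) = S.θ (S.P f) := by simp only [θ, map_add, S.Pσ, S.Pδ]
lemma Q_θ (f : R) : S.Q (S.θ f) = S.θ (S.Q f) := by simp only [θ, map_add, S.Qσ, S.Qδ]

lemma P_eq (f : R) : S.P f = f - S.Q f := by linear_combination S.add f
lemma Q_eq (f : R) : S.Q f = f - S.P f := by rw [S.P_eq]; ring

/-- Interchanging the subrings changes the sign of `star`, of `diamond` and of P(wa) - wP(a). Each
term of `tau` contains exactly two of these, so the signs cancel. This halves the case distinction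
in `tau_symm`. -/
lemma tau_swap (w a b c : R) : S.swap.tau w a b c = S.tau w a b c := by
  have h1 : ∀ w b c, S.swap.diamond w b c = -S.diamond w b c := by
    intro w b c
    simp only [diamond, swap, S.Q_eq]; ring
  have h2 : ∀ a b, S.swap.star a b = -S.star a b := by
    intro a b
    simp only [star, swap]; ring
  have h3 : S.swap.P (w * a) - w * S.swap.P a = -(S.P (w * a) - w * S.P a) := by
    simp only [swap, S.Q_eq]; ring
  have h4 : ∀ f, S.swap.θ f = S.θ f := fun f => rfl
  have h5 : S.swap.δ = S.δ := rfl
  have h6 : ∀ f b c, S.diamond (-f) b c = -S.diamond f b c := by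
    intro f b c
    simp only [diamond, neg_mul, map_neg]; ring
  have h7 : ∀ f b c, S.diamond f (-b) c = -S.diamond f b c := by
    intro f b c
    simp only [diamond, mul_neg, map_neg]; ring
  have h8 : ∀ f b c, S.diamond f b (-c) = -S.diamond f b c := by
    intro f b c
    simp only [diamond, mul_neg, map_neg]; ring
  have h9 : ∀ a f, S.star a (-f) = -S.star a f := by
    intro a f
    simp only [star, mul_neg, map_neg]; ring
  simp only [tau, h1, h2, h3, h4, h5, S.θ_neg, h6, h7, h8, h9]
  ring

lemma diamond_add_left (w w' b c : R) :
    S.diamond (w + w') b c = S.diamond w b c + S.diamond w' b c := by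
  simp only [diamond, add_mul, map_add]; ring
lemma diamond_add_mid (w b b' c : R) :
    S.diamond w (b + b') c = S.diamond w b c + S.diamond w b' c := by
  simp only [diamond, mul_add, map_add]; ring
lemma diamond_add_right (w b c c' : R) :
    S.diamond w b (c + c') = S.diamond w b c + S.diamond w b c' := by
  simp only [diamond, mul_add, map_add]; ring
lemma star_add_left (a a' b : R) : S.star (a + a') b = S.star a b + S.star a' b := by
  simp only [star, map_add]; ring
lemma star_add_right (a b b' : R) : S.star a (b + b') = S.star a b + S.star a b' := by
  simp only [star, map_add]; ring

lemma tau_add_left (w a a' b c : R) : S.tau w (a + a') b c = S.tau w a b c + S.tau w a' b c := by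
  have : S.P (w * (a + a')) - w * S.P (a + a')
      = (S.P (w * a) - w * S.P a) + (S.P (w * a') - w * S.P a') := by
    simp only [mul_add, map_add]; ring
  simp only [tau, this, θ_add, diamond_add_left, star_add_left, diamond_add_mid,
    diamond_add_right]
  ring
lemma tau_add_mid (w a b b' c : R) : S.tau w a (b + b') c = S.tau w a b c + S.tau w a b' c := by
  simp only [tau, θ_add, diamond_add_mid, star_add_right, map_add]
  ring
lemma tau_add_right (w a b c c' : R) : S.tau w a b (c + c') = S.tau w a b c + S.tau w a b c' := by
  simp only [tau, θ_add, diamond_add_right, star_add_right, map_add]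
  ring

lemma P_mul_of {f g : R} (hf : S.Q f = 0) (hg : S.Q g = 0) : S.P (f * g) = f * g := by
  have h1 : S.P f = f := by rw [S.P_eq, hf, sub_zero]
  have h2 : S.P g = g := by rw [S.P_eq, hg, sub_zero]
  have := S.QPP f g
  rw [h1, h2] at this
  rw [S.P_eq, this, sub_zero]

lemma P_mul_zero {f g : R} (hf : S.P f = 0) (hg : S.P g = 0) : S.P (f * g) = 0 := by
  have h1 : S.Q f = f := by rw [S.Q_eq, hf, sub_zero]
  have h2 : S.Q g = g := by rw [S.Q_eq, hg, sub_zero]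
  have := S.PQQ f g
  rwa [h1, h2] at this

lemma Pθ_zero {f : R} (hf : S.P f = 0) : S.P (S.θ f) = 0 := by
  rw [S.P_θ, hf]; simp [θ]
lemma Qθ_zero {f : R} (hf : S.Q f = 0) : S.Q (S.θ f) = 0 := by
  rw [S.Q_θ, hf]; simp [θ]

/-- Expanding with wa = A1 + A2 and wb = B1 + B2 leaves an asymmetric remainder that depends only on
A2 b - B2 a. Since A1 + A2 and B1 + B2 are multiples of w, this difference equals B1 a - A1 b and
lies in the first subring, where P acts as the identity. -/
lemma tau_symm_ppp (w : R) {a b c : R} (ha : S.Q a = 0) (hb : S.Q b = 0) (hc : S.Q c = 0) :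
    S.tau w a b c = S.tau w b a c := by
  have key : ∀ {a b : R}, S.Q a = 0 → S.Q b = 0 → S.tau w a b c =
      a * b * S.θ (S.P (w * c)) - a * S.δ c * S.P (w * b) - a * S.θ (S.P (S.Q (w * b) * c))
       + S.θ (S.Q (w * a) * b * c) - S.θ (S.P (S.Q (w * a) * b)) * c
       - S.θ (S.P (S.Q (w * a) * c)) * b := by
    intro a b ha hb
    have a1 : S.P a = a := by rw [S.P_eq, ha, sub_zero]
    have b1 : S.P b = b := by rw [S.P_eq, hb, sub_zero]
    have c1 : S.P c = c := by rw [S.P_eq, hc, sub_zero]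
    set A1 := S.P (w * a) with hA1
    set A2 := S.Q (w * a) with hA2
    set B1 := S.P (w * b) with hB1
    set B2 := S.Q (w * b) with hB2
    set C1 := S.P (w * c) with hC1
    have eA : A1 + A2 = w * a := S.add _
    have eB : B1 + B2 = w * b := S.add _
    have QA1 : S.Q A1 = 0 := S.QP _
    have QB1 : S.Q B1 = 0 := S.QP _
    have QC1 : S.Q C1 = 0 := S.QP _
    have x : S.P (w * a) - w * S.P a = -A2 := by rw [a1]; linear_combination eA
    have δb1 : S.Q (S.δ b) = 0 := by rw [S.Qδ, hb, map_zero]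
    have δc1 : S.Q (S.δ c) = 0 := by rw [S.Qδ, hc, map_zero]
    have Pδb : S.P (S.δ b) = S.δ b := by rw [S.P_eq, δb1, sub_zero]
    have Pδc : S.P (S.δ c) = S.δ c := by rw [S.P_eq, δc1, sub_zero]
    have s1 : S.star a (S.δ b) = a * S.δ b := by simp only [star, a1, ha, Pδb]; ring
    have s2 : S.star a (S.δ c) = a * S.δ c := by simp only [star, a1, ha, Pδc]; ring
    have d1 : S.diamond w b c = b * C1 - B2 * c := by
      simp only [diamond]; linear_combination c * eB
    have s3 : S.star a (S.θ (S.diamond w b c)) = a * (S.θ (b * C1) - S.θ (S.P (B2 * c))) := by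
      simp only [star, a1, ha, d1, S.P_θ, map_sub, S.P_mul_of hb QC1, S.θ_sub]; ring
    have e1 : S.P (w * (a * S.δ b)) = A1 * S.δ b + S.P (A2 * S.δ b) := by
      rw [show w * (a * S.δ b) = A1 * S.δ b + A2 * S.δ b by
        linear_combination -S.δ b * eA, map_add, S.P_mul_of QA1 δb1]
    have e2 : S.P (w * (a * S.δ c)) = A1 * S.δ c + S.P (A2 * S.δ c) := by
      rw [show w * (a * S.δ c) = A1 * S.δ c + A2 * S.δ c by
        linear_combination -S.δ c * eA, map_add, S.P_mul_of QA1 δc1]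
    have e3 : S.θ (S.P (A2 * b)) = S.P (S.θ A2 * b) + S.P (A2 * S.δ b) := by
      rw [← S.P_θ, S.θ_mul, map_add]
    have e4 : S.θ (S.P (A2 * c)) = S.P (S.θ A2 * c) + S.P (A2 * S.δ c) := by
      rw [← S.P_θ, S.θ_mul, map_add]
    simp only [tau, x, s1, s2, s3, S.θ_neg]
    simp only [diamond, e1, e2, neg_mul, map_neg, ← hB1, ← hC1]
    rw [e3, e4, mul_comm b C1, S.θ_mul C1, S.θ_mul (A2 * b), S.θ_mul A2]
    linear_combination (-(S.δ b * c) - b * S.δ c) * eA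
  rw [key ha hb, key hb ha]
  have eA : S.P (w * a) + S.Q (w * a) = w * a := S.add _
  have eB : S.P (w * b) + S.Q (w * b) = w * b := S.add _
  set A1 := S.P (w * a) with hA1
  set A2 := S.Q (w * a) with hA2
  set B1 := S.P (w * b) with hB1
  set B2 := S.Q (w * b) with hB2
  have QA1 : S.Q A1 = 0 := S.QP _
  have QB1 : S.Q B1 = 0 := S.QP _
  -- Both sides differ by abw - abw. The right side is in the first subring although the two terms
  -- on the left separately are not.
  have h : A2 * b - B2 * a = B1 * a - A1 * b := by linear_combination b * eA - a * eB
  have hP : S.P (A2 * b) - S.P (B2 * a) = B1 * a - A1 * b := by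
    rw [← map_sub, h, map_sub, S.P_mul_of QB1 ha, S.P_mul_of QA1 hb]
  have h2 : S.θ (A2 * b * c) - S.θ (B2 * a * c)
      = S.θ (B1 * a - A1 * b) * c + (B1 * a - A1 * b) * S.δ c := by
    rw [← S.θ_sub, ← S.θ_mul]; congr 1; linear_combination c * h
  have h3 : S.θ (S.P (A2 * b)) - S.θ (S.P (B2 * a)) = S.θ (B1 * a - A1 * b) := by
    rw [← S.θ_sub, hP]
  linear_combination h2 - c * h3

/-- Here everything collapses to an expression in the product ab alone, which is visibly symmetric.
-/
lemma tau_symm_ppm (w : R) {a b c : R} (ha : S.Q a = 0) (hb : S.Q b = 0) (hc : S.P c = 0) :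
    S.tau w a b c = S.tau w b a c := by
  have key : ∀ {a b : R}, S.Q a = 0 → S.Q b = 0 → S.tau w a b c =
      a * b * S.θ (S.P (w * c)) + S.θ (S.Q (w * (a * b))) * c := by
    intro a b ha hb
    have a1 : S.P a = a := by rw [S.P_eq, ha, sub_zero]
    have b1 : S.P b = b := by rw [S.P_eq, hb, sub_zero]
    set A1 := S.P (w * a) with hA1
    set A2 := S.Q (w * a) with hA2
    set B1 := S.P (w * b) with hB1
    set B2 := S.Q (w * b) with hB2
    set C1 := S.P (w * c) with hC1
    have eA : A1 + A2 = w * a := S.add _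
    have eB : B1 + B2 = w * b := S.add _
    have QA1 : S.Q A1 = 0 := S.QP _
    have PA2 : S.P A2 = 0 := S.PQ _
    have PB2 : S.P B2 = 0 := S.PQ _
    have QB1 : S.Q B1 = 0 := S.QP _
    have QC1 : S.Q C1 = 0 := S.QP _
    have x : S.P (w * a) - w * S.P a = -A2 := by rw [a1]; linear_combination eA
    have δb1 : S.Q (S.δ b) = 0 := by rw [S.Qδ, hb, map_zero]
    have Pδb : S.P (S.δ b) = S.δ b := by rw [S.P_eq, δb1, sub_zero]
    have s1 : S.star a (S.δ b) = a * S.δ b := by simp only [star, a1, ha, Pδb]; ring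
    have s2 : S.star a (S.δ c) = 0 := by simp only [star, ha, S.Pδ, hc, map_zero]; ring
    have d1 : S.diamond w b c = b * C1 - B2 * c := by
      simp only [diamond]; linear_combination c * eB
    have s3 : S.star a (S.θ (S.diamond w b c)) = a * S.θ (C1 * b) := by
      simp only [star, a1, ha, d1, S.P_θ, map_sub, S.P_mul_of hb QC1, S.P_mul_zero PB2 hc]
      rw [mul_comm C1 b]; ring_nf
    have e1 : S.P (w * (a * S.δ b)) = A1 * S.δ b + S.P (A2 * S.δ b) := by
      rw [show w * (a * S.δ b) = A1 * S.δ b + A2 * S.δ b by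
        linear_combination -S.δ b * eA, map_add, S.P_mul_of QA1 δb1]
    have e3 : S.θ (S.P (A2 * b)) = S.P (S.θ A2 * b) + S.P (A2 * S.δ b) := by
      rw [← S.P_θ, S.θ_mul, map_add]
    have e5 : S.P (S.θ A2 * c) = 0 := S.P_mul_zero (S.Pθ_zero PA2) hc
    have e6 : S.Q (w * (a * b)) = A2 * b - S.P (A2 * b) := by
      rw [← S.Q_eq, show w * (a * b) = A1 * b + A2 * b by linear_combination -b * eA, map_add,
        S.Q_eq (A1 * b), S.P_mul_of QA1 hb]; ring
    simp only [tau, x, s1, s2, s3, S.θ_neg]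
    simp only [diamond, e1, neg_mul, map_neg, ← hC1, mul_zero, map_zero, e5, e6]
    rw [S.θ_sub, e3, S.θ_mul A2, S.θ_mul C1]
    linear_combination (-(S.δ b * c)) * eA
  rw [key ha hb, key hb ha, mul_comm b a]

/-- The two sides are matched through the products of halves: A2 c and a C2 differ by an element of
the first subring, so they have the same Q-part (`f1`), while b C1 and B1 c + B2 c differ by an
element of the second, so they have the same P-part (`f2`). -/
lemma tau_symm_pmp (w : R) {a b c : R} (ha : S.Q a = 0) (hb : S.P b = 0) (hc : S.Q c = 0) :
    S.tau w a b c = S.tau w b a c := by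
  have a1 : S.P a = a := by rw [S.P_eq, ha, sub_zero]
  have b2 : S.Q b = b := by rw [S.Q_eq, hb, sub_zero]
  have c1 : S.P c = c := by rw [S.P_eq, hc, sub_zero]
  set A1 := S.P (w * a) with hA1
  set A2 := S.Q (w * a) with hA2
  set B1 := S.P (w * b) with hB1
  set B2 := S.Q (w * b) with hB2
  set C1 := S.P (w * c) with hC1
  set C2 := S.Q (w * c) with hC2
  have eA : A1 + A2 = w * a := S.add _
  have eB : B1 + B2 = w * b := S.add _
  have eC : C1 + C2 = w * c := S.add _
  have QA1 : S.Q A1 = 0 := S.QP _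
  have PA2 : S.P A2 = 0 := S.PQ _
  have PB2 : S.P B2 = 0 := S.PQ _
  have PC2 : S.P C2 = 0 := S.PQ _
  have QB1 : S.Q B1 = 0 := S.QP _
  have QC1 : S.Q C1 = 0 := S.QP _
  have x : S.P (w * a) - w * S.P a = -A2 := by rw [a1]; linear_combination eA
  have y : S.P (w * b) - w * S.P b = B1 := by rw [hb]; ring
  have δc1 : S.Q (S.δ c) = 0 := by rw [S.Qδ, hc, map_zero]
  have Pδc : S.P (S.δ c) = S.δ c := by rw [S.P_eq, δc1, sub_zero]
  have s1 : S.star a (S.δ b) = 0 := by simp only [star, ha, S.Pδ, hb, map_zero]; ring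
  have s2 : S.star a (S.δ c) = a * S.δ c := by simp only [star, a1, ha, Pδc]; ring
  have t1 : S.star b (S.δ a) = 0 := by simp only [star, hb, S.Qδ, ha, map_zero]; ring
  have t2 : S.star b (S.δ c) = 0 := by simp only [star, hb, δc1]; ring
  have d1 : S.diamond w b c = b * C1 - B2 * c := by
    simp only [diamond]; linear_combination c * eB
  have d2 : S.diamond w a c = A1 * c - a * C2 := by
    simp only [diamond]; linear_combination a * eC
  have s3 : S.star a (S.θ (S.diamond w b c)) = a * (S.θ (S.P (b * C1)) - S.θ (S.P (B2 * c))) := by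
    simp only [star, a1, ha, d1, S.P_θ, map_sub, S.θ_sub]; ring
  have QA1c : S.Q (A1 * c) = 0 := by rw [S.Q_eq, S.P_mul_of QA1 hc, sub_self]
  have t3 : S.star b (S.θ (S.diamond w a c)) = b * S.θ (S.Q (a * C2)) := by
    simp only [star, b2, hb, d2, S.Q_θ, map_sub, QA1c, zero_sub, S.θ_neg]; ring
  have e2 : S.P (w * (a * S.δ c)) = A1 * S.δ c + S.P (A2 * S.δ c) := by
    rw [show w * (a * S.δ c) = A1 * S.δ c + A2 * S.δ c by
      linear_combination -S.δ c * eA, map_add, S.P_mul_of QA1 δc1]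
  have e4 : S.θ (S.P (A2 * c)) = S.P (S.θ A2 * c) + S.P (A2 * S.δ c) := by
    rw [← S.P_θ, S.θ_mul, map_add]
  have e5 : S.P (S.θ A2 * b) = 0 := S.P_mul_zero (S.Pθ_zero PA2) hb
  have e6 : S.P (S.θ B1 * a) = S.θ B1 * a := S.P_mul_of (S.Qθ_zero QB1) ha
  have e7 : S.P (S.θ B1 * c) = S.θ B1 * c := S.P_mul_of (S.Qθ_zero QB1) hc
  have f1 : A2 * c - S.P (A2 * c) = S.Q (a * C2) := by
    have h : S.Q (A2 * c) = S.Q (a * C2) := by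
      rw [show A2 * c = A1 * (-c) + a * C1 + a * C2 by linear_combination c * eA - a * eC]
      rw [map_add, map_add, S.Q_eq (a * C1), S.P_mul_of ha QC1, mul_neg, map_neg, QA1c]
      ring
    rw [← h, S.Q_eq]
  have f2 : S.P (b * C1) = S.P (B2 * c) + B1 * c := by
    have h : b * C1 = B1 * c + B2 * c - b * C2 := by linear_combination b * eC - c * eB
    rw [h, map_sub, map_add, S.P_mul_of QB1 hc, S.P_mul_zero hb PC2]; ring
  simp only [tau, x, y, s1, s2, s3, t1, t2, t3, S.θ_neg]
  simp only [diamond, e2, neg_mul, map_neg, ← hC1, ← hB1, mul_zero, map_zero, zero_mul, e5, e6, e7]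
  rw [← f1, f2, S.θ_sub, S.θ_add, e4, S.θ_mul A2, S.θ_mul B1]
  linear_combination (-(b * S.δ c)) * eA

/-- The covariant derivative of the product is symmetric. -/
theorem tau_symm (w a b c : R) : S.tau w a b c = S.tau w b a c := by
  -- By trilinearity only arguments in one of the two subrings matter. The three computed sign
  -- patterns, their mirror images under `swap`, and the mixed case read backwards with a and b
  -- interchanged cover all eight.
  have base : ∀ (S : Splitting R) (w a b c : R),
      S.tau w (S.P a) (S.P b) c = S.tau w (S.P b) (S.P a) c ∧
      S.tau w (S.P a) (S.Q b) (S.P c) = S.tau w (S.Q b) (S.P a) (S.P c) := by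
    intro S w a b c
    refine ⟨?_, S.tau_symm_pmp w (S.QP _) (S.PQ _) (S.QP _)⟩
    rw [← S.add c, tau_add_right, tau_add_right,
      S.tau_symm_ppp w (S.QP a) (S.QP b) (S.QP c), S.tau_symm_ppm w (S.QP a) (S.QP b) (S.PQ c)]
  have h1 := (base S w a b c).1
  have h2 := (base S.swap w a b c).1
  have h3 := (base S w a b c).2
  have h4 := (base S.swap w a b c).2
  have h5 := (base S w b a c).2
  have h6 := (base S.swap w b a c).2
  simp only [tau_swap] at h2 h4 h6
  simp only [swap] at h2 h4 h6
  have dec : ∀ a b, S.tau w a b c = S.tau w (S.P a) (S.P b) c + S.tau w (S.Q a) (S.Q b) c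
      + (S.tau w (S.P a) (S.Q b) (S.P c) + S.tau w (S.P a) (S.Q b) (S.Q c))
      + (S.tau w (S.Q a) (S.P b) (S.P c) + S.tau w (S.Q a) (S.P b) (S.Q c)) := by
    intro a b
    rw [← S.tau_add_right, ← S.tau_add_right, S.add]
    conv_lhs => rw [← S.add a, ← S.add b]
    simp only [tau_add_left, tau_add_mid]
    ring
  rw [dec a b, dec b a]
  linear_combination h1 + h2 + h3 + h4 - h5 - h6

end Splitting
end FrobLaurent

namespace FrobLaurent

/-! ## Calculus of Laurent series at a marked point -/

lemma coeff_mul_eq_zero {f g : Laurent} {i : ℤ}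
    (h : ∀ j k, j + k = i → f.coeff j = 0 ∨ g.coeff k = 0) : (f * g).coeff i = 0 := by
  rw [HahnSeries.coeff_mul]
  refine Finset.sum_eq_zero fun x hx => ?_
  rw [Finset.mem_antidiagonal] at hx
  rcases h x.1 x.2 hx.2.2 with h | h <;> simp [h]

lemma derivative_coeff (f : Laurent) (i : ℤ) :
    (LaurentSeries.derivative ℂ f).coeff i = (i + 1) * f.coeff (i + 1) := by
  rw [LaurentSeries.derivative_apply, LaurentSeries.hasseDeriv_coeff]
  simp

/-- The operator z d/dz multiplies the i-th coefficient by i and does not enlarge supports, so after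
multiplication by z all three products are sums over the same pairs (j, k), and the rule is i = j +
k. -/
lemma derivative_mul (f g : Laurent) : LaurentSeries.derivative ℂ (f * g)
    = LaurentSeries.derivative ℂ f * g + f * LaurentSeries.derivative ℂ g := by
  have sh : ∀ h : Laurent, ∀ i, (HahnSeries.single (1 : ℤ) (1 : ℂ) *
      LaurentSeries.derivative ℂ h).coeff i = i * h.coeff i := by
    intro h i
    rw [HahnSeries.coeff_single_mul, derivative_coeff]; simp
  have hs : (HahnSeries.single (1 : ℤ) (1 : ℂ)) ≠ 0 := by simp
  apply mul_left_cancel₀ hs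
  rw [mul_add, ← mul_assoc, mul_left_comm]
  ext i
  have s1 : (HahnSeries.single (1 : ℤ) (1 : ℂ) * LaurentSeries.derivative ℂ f).support
      ⊆ f.support := by
    intro j hj
    simp only [HahnSeries.mem_support, sh] at hj ⊢
    exact right_ne_zero_of_mul hj
  have s2 : (HahnSeries.single (1 : ℤ) (1 : ℂ) * LaurentSeries.derivative ℂ g).support
      ⊆ g.support := by
    intro j hj
    simp only [HahnSeries.mem_support, sh] at hj ⊢
    exact right_ne_zero_of_mul hj
  rw [sh, HahnSeries.coeff_add, HahnSeries.coeff_mul,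
    HahnSeries.coeff_mul_left' f.isPWO_support s1,
    HahnSeries.coeff_mul_right' g.isPWO_support s2, Finset.mul_sum, ← Finset.sum_add_distrib]
  refine Finset.sum_congr rfl fun x hx => ?_
  rw [Finset.mem_antidiagonal] at hx
  rw [sh, sh, ← hx.2.2]; push_cast; ring

lemma smul_eq_C_mul (c : ℂ) (f : Laurent) : c • f = HahnSeries.C c * f :=
  HahnSeries.C_mul_eq_smul.symm

lemma laurent_zero_smul (f : Laurent) : (0 : ℂ) • f = 0 := zero_smul ℂ f

instance : IsScalarTower ℂ Laurent Laurent :=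
  ⟨fun c f g => by simp only [smul_eq_mul, smul_eq_C_mul, mul_assoc]⟩

instance : SMulCommClass ℂ Laurent Laurent :=
  ⟨fun c f g => by simp only [smul_eq_mul, smul_eq_C_mul, mul_left_comm]⟩

lemma coeff_C' (c : ℂ) (i : ℤ) :
    (HahnSeries.C c : Laurent).coeff i = if i = 0 then c else 0 := by
  by_cases h : i = 0 <;> simp [h]

namespace MarkedPoint

variable (ν : MarkedPoint)

/-- The residue of `f dp`, up to sign at infinity: the coefficient of `p⁻¹`, respectively of
`(p - v)⁻¹`. -/
def res : MarkedPoint → Laurent →ₗ[ℂ] ℂ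
  | infinity => { toFun f := f.coeff 1, map_add' _ _ := rfl, map_smul' _ _ := rfl }
  | finite _ => { toFun f := f.coeff (-1), map_add' _ _ := rfl, map_smul' _ _ := rfl }

lemma res_infinity (f : Laurent) : infinity.res f = f.coeff 1 := rfl
lemma res_finite (v : ℂ) (f : Laurent) : (finite v).res f = f.coeff (-1) := rfl

lemma p_infinity_mul_coeff (f : Laurent) (i : ℤ) :
    (infinity.p * f).coeff i = f.coeff (i + 1) := by
  rw [p, HahnSeries.coeff_single_mul]; simp

lemma p_finite_mul_coeff (v : ℂ) (f : Laurent) (i : ℤ) :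
    ((finite v).p * f).coeff i = v * f.coeff i + f.coeff (i - 1) := by
  rw [p, add_mul, HahnSeries.coeff_add, HahnSeries.coeff_single_mul, HahnSeries.C_mul_eq_smul]
  simp

lemma p_ne_zero : ν.p ≠ 0 := by
  intro h
  cases ν with
  | infinity => simp [p] at h
  | finite v =>
    have := congrArg (fun f : Laurent => f.coeff 1) h
    simp [p] at this

lemma nonneg_infinity_coeff (f : Laurent) (i : ℤ) :
    (infinity.nonneg f).coeff i = if i ≤ 0 then f.coeff i else 0 := rfl
lemma nonneg_finite_coeff (v : ℂ) (f : Laurent) (i : ℤ) :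
    ((finite v).nonneg f).coeff i = if 0 ≤ i then f.coeff i else 0 := rfl

lemma nonneg_add (f g : Laurent) : ν.nonneg (f + g) = ν.nonneg f + ν.nonneg g := by
  ext i
  cases ν <;> simp only [nonneg_infinity_coeff, nonneg_finite_coeff, HahnSeries.coeff_add] <;>
    split_ifs <;> simp

lemma nonneg_smul (c : ℂ) (f : Laurent) : ν.nonneg (c • f) = c • ν.nonneg f := by
  ext i
  cases ν <;> simp only [nonneg_infinity_coeff, nonneg_finite_coeff, HahnSeries.coeff_smul] <;>
    split_ifs <;> simp

/-- The projection on the nonnegative powers. -/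
def P : Laurent →ₗ[ℂ] Laurent where
  toFun := ν.nonneg
  map_add' := ν.nonneg_add
  map_smul' := ν.nonneg_smul

/-- The derivation `∂/∂p`. -/
def d : Laurent →ₗ[ℂ] Laurent where
  toFun := ν.dp
  map_add' f g := by
    cases ν <;> simp only [dp, map_add]
    ring
  map_smul' c f := by cases ν <;> simp [dp, mul_smul_comm]

lemma d_apply (f : Laurent) : ν.d f = ν.dp f := rfl
lemma P_apply (f : Laurent) : ν.P f = ν.nonneg f := rfl

lemma P_infinity_coeff (f : Laurent) (i : ℤ) :
    (infinity.P f).coeff i = if i ≤ 0 then f.coeff i else 0 := rfl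
lemma P_finite_coeff (v : ℂ) (f : Laurent) (i : ℤ) :
    ((finite v).P f).coeff i = if 0 ≤ i then f.coeff i else 0 := rfl

lemma d_infinity_coeff (f : Laurent) (i : ℤ) :
    (infinity.d f).coeff i = -((i - 1) * f.coeff (i - 1)) := by
  rw [d_apply, dp, HahnSeries.coeff_neg, HahnSeries.coeff_single_mul, derivative_coeff]
  push_cast
  ring_nf

lemma d_finite_coeff (v : ℂ) (f : Laurent) (i : ℤ) :
    ((finite v).d f).coeff i = (i + 1) * f.coeff (i + 1) := derivative_coeff f i

lemma d_mul (f g : Laurent) : ν.d (f * g) = ν.d f * g + f * ν.d g := by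
  cases ν with
  | infinity => simp only [d_apply, dp, derivative_mul]; ring
  | finite v => exact derivative_mul f g

lemma d_p : ν.d ν.p = 1 := by
  ext i
  cases ν with
  | infinity =>
    rw [d_infinity_coeff, p, HahnSeries.coeff_single, HahnSeries.coeff_one]
    by_cases h : i = 0
    · simp [h]
    · rw [if_neg (by omega), if_neg h]; simp
  | finite v =>
    rw [d_finite_coeff, p, HahnSeries.coeff_add, coeff_C', HahnSeries.coeff_single,
      HahnSeries.coeff_one]
    by_cases h : i = 0
    · simp [h]
    · rw [if_neg (by omega : ¬ i + 1 = 1), if_neg h]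
      split_ifs with h'
      · have : (i : ℂ) + 1 = 0 := by exact_mod_cast h'
        simp [this]
      · simp

lemma d_one : ν.d 1 = 0 := by
  have := ν.d_mul 1 1
  simpa using this

lemma P_d (f : Laurent) : ν.P (ν.d f) = ν.d (ν.P f) := by
  ext i
  cases ν with
  | infinity =>
    simp only [P_infinity_coeff, d_infinity_coeff]
    split_ifs with h h' h'
    · rfl
    · omega
    · have : i = 1 := by omega
      simp [this]
    · simp
  | finite v =>
    simp only [P_finite_coeff, d_finite_coeff]
    split_ifs with h h' h'
    · rfl
    · omega
    · have : i = -1 := by omega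
      simp [this]
    · simp

lemma P_P (f : Laurent) : ν.P (ν.P f) = ν.P f := by
  ext i
  cases ν <;> simp only [P_infinity_coeff, P_finite_coeff] <;> split_ifs <;> rfl

/-- The projection on the negative powers. -/
def Q : Laurent →ₗ[ℂ] Laurent := LinearMap.id - ν.P

lemma Q_apply (f : Laurent) : ν.Q f = f - ν.P f := rfl

lemma Q_infinity_coeff (f : Laurent) (i : ℤ) :
    (infinity.Q f).coeff i = if i ≤ 0 then 0 else f.coeff i := by
  rw [Q_apply, HahnSeries.coeff_sub, P_infinity_coeff]; split_ifs <;> simp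
lemma Q_finite_coeff (v : ℂ) (f : Laurent) (i : ℤ) :
    ((finite v).Q f).coeff i = if 0 ≤ i then 0 else f.coeff i := by
  rw [Q_apply, HahnSeries.coeff_sub, P_finite_coeff]; split_ifs <;> simp

lemma P_add_Q (f : Laurent) : ν.P f + ν.Q f = f := by rw [Q_apply]; ring
lemma P_Q (f : Laurent) : ν.P (ν.Q f) = 0 := by rw [Q_apply, map_sub, P_P, sub_self]
lemma Q_P (f : Laurent) : ν.Q (ν.P f) = 0 := by rw [Q_apply, P_P, sub_self]
lemma Q_d (f : Laurent) : ν.Q (ν.d f) = ν.d (ν.Q f) := by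
  rw [Q_apply, Q_apply, map_sub, P_d]

lemma Q_P_mul_P (f g : Laurent) : ν.Q (ν.P f * ν.P g) = 0 := by
  ext i
  cases ν with
  | infinity =>
    rw [Q_infinity_coeff]
    split_ifs with h
    · rfl
    · refine coeff_mul_eq_zero fun j k hjk => ?_
      rw [P_infinity_coeff, P_infinity_coeff]
      by_cases hj : j ≤ 0
      · right; rw [if_neg (by omega)]
      · left; rw [if_neg hj]
  | finite v =>
    rw [Q_finite_coeff]
    split_ifs with h
    · rfl
    · refine coeff_mul_eq_zero fun j k hjk => ?_
      rw [P_finite_coeff, P_finite_coeff]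
      by_cases hj : 0 ≤ j
      · right; rw [if_neg (by omega)]
      · left; rw [if_neg hj]

/-- A product of two series without nonnegative powers has a gap. -/
lemma P_p_mul_Q_mul_Q (f g : Laurent) : ν.P (ν.p * (ν.Q f * ν.Q g)) = 0 := by
  ext i
  cases ν with
  | infinity =>
    rw [P_infinity_coeff]
    split_ifs with h
    · rw [p_infinity_mul_coeff]
      refine coeff_mul_eq_zero fun j k hjk => ?_
      rw [Q_infinity_coeff, Q_infinity_coeff]
      by_cases hj : j ≤ 0
      · left; rw [if_pos hj]
      · right; rw [if_pos (by omega)]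
    · rfl
  | finite v =>
    rw [P_finite_coeff]
    split_ifs with h
    · have : ∀ l, -1 ≤ l → ((finite v).Q f * (finite v).Q g).coeff l = 0 := by
        intro l hl
        refine coeff_mul_eq_zero fun j k hjk => ?_
        rw [Q_finite_coeff, Q_finite_coeff]
        by_cases hj : 0 ≤ j
        · left; rw [if_pos hj]
        · right; rw [if_pos (by omega)]
      rw [p_finite_mul_coeff, this i (by omega), this (i - 1) (by omega)]; simp
    · rfl

lemma P_Q_mul_Q (f g : Laurent) : ν.P (ν.Q f * ν.Q g) = 0 := by
  ext i
  cases ν with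
  | infinity =>
    rw [P_infinity_coeff]
    split_ifs with h
    · refine coeff_mul_eq_zero fun j k hjk => ?_
      rw [Q_infinity_coeff, Q_infinity_coeff]
      by_cases hj : j ≤ 0
      · left; rw [if_pos hj]
      · right; rw [if_pos (by omega)]
    · rfl
  | finite v =>
    rw [P_finite_coeff]
    split_ifs with h
    · refine coeff_mul_eq_zero fun j k hjk => ?_
      rw [Q_finite_coeff, Q_finite_coeff]
      by_cases hj : 0 ≤ j
      · left; rw [if_pos hj]
      · right; rw [if_pos (by omega)]
    · rfl

lemma Q_p_mul_P (f : Laurent) : ν.Q (ν.p * ν.P f) = 0 := by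
  ext i
  cases ν with
  | infinity =>
    rw [Q_infinity_coeff]
    split_ifs with h
    · rfl
    · rw [p_infinity_mul_coeff, P_infinity_coeff, if_neg (by omega)]; rfl
  | finite v =>
    rw [Q_finite_coeff]
    split_ifs with h
    · rfl
    · rw [p_finite_mul_coeff, P_finite_coeff, P_finite_coeff, if_neg h, if_neg (by omega)]
      simp

/-- A derivative has no coefficient at exponent -1 of p, respectively of p - v, so multiplying the
derivative of a negative part by p does not reach exponent 0. This is why p ∂/∂p still respects the
splitting. -/
lemma P_p_mul_d_Q (f : Laurent) : ν.P (ν.p * ν.d (ν.Q f)) = 0 := by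
  ext i
  cases ν with
  | infinity =>
    rw [P_infinity_coeff]
    split_ifs with h
    · rw [p_infinity_mul_coeff, d_infinity_coeff, Q_infinity_coeff, if_pos (by omega)]; simp
    · rfl
  | finite v =>
    rw [P_finite_coeff]
    split_ifs with h
    · rw [p_finite_mul_coeff, d_finite_coeff, d_finite_coeff, Q_finite_coeff, Q_finite_coeff,
        if_pos (by omega)]
      split_ifs with h'
      · simp
      · have : i = 0 := by omega
        simp [this]
    · rfl

lemma P_p_mul_d (f : Laurent) : ν.P (ν.p * ν.d f) = ν.p * ν.d (ν.P f) := by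
  have h1 := ν.P_p_mul_d_Q f
  have h2 : ν.Q (ν.p * ν.d (ν.P f)) = 0 := by rw [← P_d, Q_p_mul_P]
  rw [Q_apply, sub_eq_zero] at h2
  conv_lhs => rw [← ν.P_add_Q f, map_add, mul_add, map_add, h1, ← h2, add_zero]

/-- Multiplication by p can push a negative part only as far as a constant. -/
lemma d_P_p_mul_Q (f : Laurent) : ν.d (ν.P (ν.p * ν.Q f)) = 0 := by
  ext i
  cases ν with
  | infinity =>
    rw [d_infinity_coeff, P_infinity_coeff]
    split_ifs with h
    · rw [p_infinity_mul_coeff, Q_infinity_coeff]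
      split_ifs with h'
      · simp
      · have : i = 1 := by omega
        simp [this]
    · simp
  | finite v =>
    rw [d_finite_coeff, P_finite_coeff]
    split_ifs with h
    · rw [p_finite_mul_coeff, Q_finite_coeff, Q_finite_coeff, if_pos h]
      split_ifs with h'
      · simp
      · have : i = -1 := by omega
        simp [this]
    · simp

lemma res_d (f : Laurent) : ν.res (ν.d f) = 0 := by
  cases ν with
  | infinity => rw [res_infinity, d_infinity_coeff]; simp
  | finite v => rw [res_finite, d_finite_coeff]; simp

lemma res_P_mul_P (f g : Laurent) : ν.res (ν.P f * ν.P g) = 0 := by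
  have h := ν.Q_P_mul_P f g
  rw [Q_apply, sub_eq_zero] at h
  rw [h]
  cases ν with
  | infinity => rw [res_infinity, P_infinity_coeff]; simp
  | finite v => rw [res_finite, P_finite_coeff]; simp

/-- A product of two negative parts starts at exponent -2. At a finite point p = v + (p - v), so the
information on p times the product is combined with that on the product itself. -/
lemma res_Q_mul_Q (f g : Laurent) : ν.res (ν.Q f * ν.Q g) = 0 := by
  have h := ν.P_p_mul_Q_mul_Q f g
  cases ν with
  | infinity =>
    have := congrArg (fun f : Laurent => f.coeff 0) h
    simpa [P_infinity_coeff, p_infinity_mul_coeff, res_infinity] using this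
  | finite v =>
    have := congrArg (fun f : Laurent => f.coeff 0) h
    have h2 := congrArg (fun f : Laurent => f.coeff 0) ((finite v).P_Q_mul_Q f g)
    simp only [P_finite_coeff, p_finite_mul_coeff, le_refl, if_true, HahnSeries.coeff_zero] at this h2
    rw [h2] at this
    simpa [res_finite] using this

/-- Both subalgebras are isotropic for the residue pairing, hence P and Q are adjoint to each other.
-/
lemma res_mul_P (f g : Laurent) : ν.res (f * ν.P g) = ν.res (ν.Q f * g) := by
  have h1 : ν.res (f * ν.P g) = ν.res (ν.Q f * ν.P g) := by
    conv_lhs => rw [← ν.P_add_Q f, add_mul, map_add, res_P_mul_P, zero_add]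
  have h2 : ν.res (ν.Q f * g) = ν.res (ν.Q f * ν.P g) := by
    conv_lhs => rw [← ν.P_add_Q g, mul_add, map_add, res_Q_mul_Q, add_zero]
  rw [h1, h2]

lemma res_d_mul (f g : Laurent) : ν.res (ν.d f * g) = -ν.res (f * ν.d g) := by
  have := ν.res_d (f * g)
  rw [d_mul, map_add] at this
  linear_combination this

/-- The residue pairing is perfect. -/
lemma eq_zero_of_res (f : Laurent) (h : ∀ g, ν.res (g * f) = 0) : f = 0 := by
  ext i
  cases ν with
  | infinity =>
    have := h (HahnSeries.single (1 - i) 1)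
    rw [res_infinity, HahnSeries.coeff_single_mul] at this
    simpa using this
  | finite v =>
    have := h (HahnSeries.single (-1 - i) 1)
    rw [res_finite, HahnSeries.coeff_single_mul] at this
    simpa using this

lemma tr_eq (s : ℕ) (f : Laurent) : ν.tr s f = ν.res ((ν.p ^ s)⁻¹ * f) := by
  cases ν <;> rfl

lemma pow_ne (s : ℕ) : ν.p ^ s ≠ 0 := pow_ne_zero _ ν.p_ne_zero

lemma tr_mul (s : ℕ) (f : Laurent) : ν.tr s (ν.p ^ s * f) = ν.res f := by
  rw [tr_eq, inv_mul_cancel_left₀ (ν.pow_ne s)]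

lemma tr_mul' (s : ℕ) (f g : Laurent) : ν.tr s (f * (ν.p ^ s * g)) = ν.res (f * g) := by
  rw [mul_left_comm, tr_mul]

/-- The trace form as a linear map. -/
def trL (s : ℕ) : Laurent →ₗ[ℂ] ℂ := ν.res ∘ₗ LinearMap.mulLeft ℂ ((ν.p ^ s)⁻¹)

lemma trL_apply (s : ℕ) (f : Laurent) : ν.trL s f = ν.tr s f := (ν.tr_eq s f).symm

end MarkedPoint
end FrobLaurent

/-! ### The difference product, `♯` and `∘` as operations on Laurent series -/

namespace FrobLaurent
namespace MarkedPoint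

variable (ν : MarkedPoint)

lemma P_C_mul (c : ℂ) (f : Laurent) : ν.P (HahnSeries.C c * f) = HahnSeries.C c * ν.P f := by
  rw [← smul_eq_C_mul, map_smul, smul_eq_C_mul]
lemma Q_C_mul (c : ℂ) (f : Laurent) : ν.Q (HahnSeries.C c * f) = HahnSeries.C c * ν.Q f := by
  rw [← smul_eq_C_mul, map_smul, smul_eq_C_mul]

/-- The derivation `pˢ ∂/∂p`. -/
def D (s : ℕ) : Laurent →ₗ[ℂ] Laurent where
  toFun f := ν.p ^ s * ν.d f
  map_add' f g := by rw [map_add, mul_add]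
  map_smul' c f := by rw [map_smul, RingHom.id_apply, mul_smul_comm]

lemma D_apply (s : ℕ) (f : Laurent) : ν.D s f = ν.p ^ s * ν.d f := rfl

/-- The product of the difference of the algebras of nonnegative and of negative powers. -/
def star (a b : Laurent) : Laurent := ν.P a * ν.P b - ν.Q a * ν.Q b

/-- The operator `♯` with `y` in the place of `λ_p`. -/
def sharpW (s : ℕ) (y a : Laurent) : Laurent := ν.p ^ s * (ν.P (y * a) - y * ν.P a)

/-- The multiplication `∘` with `y` in the place of `λ_p`. -/
def circW (s : ℕ) (y a b : Laurent) : Laurent :=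
  ν.p ^ s * (ν.P (y * a) * b + a * ν.P (y * b) - y * a * b)

lemma sharp_eq (s : ℕ) (l a : Laurent) : ν.sharp s l a = ν.sharpW s (ν.d l) a := by
  simp only [sharp, sharpW, P_apply, d_apply]; ring
lemma circ_eq (s : ℕ) (l a b : Laurent) : ν.circ s l a b = ν.circW s (ν.d l) a b := by
  simp only [circ, circW, P_apply, d_apply]; ring

lemma star_comm (a b : Laurent) : ν.star a b = ν.star b a := by simp only [star]; ring
lemma star_add_left (a b c : Laurent) : ν.star (a + b) c = ν.star a c + ν.star b c := by
  simp only [star, map_add]; ring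
lemma star_add_right (a b c : Laurent) : ν.star a (b + c) = ν.star a b + ν.star a c := by
  simp only [star, map_add]; ring
lemma star_sub_left (a b c : Laurent) : ν.star (a - b) c = ν.star a c - ν.star b c := by
  simp only [star, map_sub]; ring
lemma star_sub_right (a b c : Laurent) : ν.star a (b - c) = ν.star a b - ν.star a c := by
  simp only [star, map_sub]; ring
lemma star_smul_left (r : ℂ) (a b : Laurent) : ν.star (r • a) b = r • ν.star a b := by
  simp only [star, map_smul, smul_mul_assoc, smul_sub]
lemma star_smul_right (r : ℂ) (a b : Laurent) : ν.star a (r • b) = r • ν.star a b := by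
  simp only [star, map_smul, mul_smul_comm, smul_sub]

lemma P_mul_P (a b : Laurent) : ν.P (ν.P a * ν.P b) = ν.P a * ν.P b := by
  have := ν.Q_P_mul_P a b
  rw [Q_apply, sub_eq_zero] at this
  exact this.symm

lemma P_star (a b : Laurent) : ν.P (ν.star a b) = ν.P a * ν.P b := by
  rw [star, map_sub, P_Q_mul_Q, P_mul_P, sub_zero]
lemma Q_star (a b : Laurent) : ν.Q (ν.star a b) = -(ν.Q a * ν.Q b) := by
  rw [Q_apply, P_star, star]; ring

/-- P is multiplicative for `star`, and Q is multiplicative up to sign. -/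
lemma star_assoc (a b c : Laurent) : ν.star (ν.star a b) c = ν.star a (ν.star b c) := by
  rw [star, P_star, Q_star, star, P_star, Q_star]; ring

variable {s : ℕ} (hs : s = 0 ∨ s = 1)
include hs

lemma P_D (f : Laurent) : ν.P (ν.D s f) = ν.D s (ν.P f) := by
  rcases hs with rfl | rfl
  · simp only [D_apply, pow_zero, one_mul, P_d]
  · simp only [D_apply, pow_one, P_p_mul_d]

lemma Q_D (f : Laurent) : ν.Q (ν.D s f) = ν.D s (ν.Q f) := by
  rw [Q_apply, Q_apply, map_sub, ν.P_D hs]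

omit hs in
lemma D_mul (a b : Laurent) : ν.D s (a * b) = ν.D s a * b + a * ν.D s b := by
  simp only [D_apply, d_mul]; ring

lemma D_star (a b : Laurent) : ν.D s (ν.star a b) = ν.star (ν.D s a) b + ν.star a (ν.D s b) := by
  simp only [star, ν.P_D hs, ν.Q_D hs, map_sub, D_mul]; ring

lemma d_pow_eq : ν.d (ν.p ^ s) = HahnSeries.C (s : ℂ) := by
  rcases hs with rfl | rfl
  · simp [d_one]
  · rw [pow_one, d_p]; simp

/-- The splitting of the Laurent series into nonnegative and negative powers. -/
def splitting : Splitting Laurent where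
  P := ν.P.toAddMonoidHom
  Q := ν.Q.toAddMonoidHom
  δ := (ν.D s).toAddMonoidHom
  σ := HahnSeries.C (s : ℂ)
  add := ν.P_add_Q
  PQ := ν.P_Q
  QP := ν.Q_P
  QPP := ν.Q_P_mul_P
  PQQ := ν.P_Q_mul_Q
  leibniz := ν.D_mul
  Pδ := ν.P_D hs
  Qδ := ν.Q_D hs
  Pσ f := ν.P_C_mul _ f
  Qσ f := ν.Q_C_mul _ f

lemma d_pow_mul (f : Laurent) : ν.d (ν.p ^ s * f) = (ν.splitting hs).θ f := by
  rw [d_mul, ν.d_pow_eq hs]; rfl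

lemma D_pow_mul (f : Laurent) : ν.D s (ν.p ^ s * f) = ν.p ^ s * (ν.splitting hs).θ f := by
  rw [D_apply, ν.d_pow_mul hs]

lemma Q_pow_mul_P (f : Laurent) : ν.Q (ν.p ^ s * ν.P f) = 0 := by
  rcases hs with rfl | rfl
  · rw [pow_zero, one_mul, Q_P]
  · rw [pow_one, Q_p_mul_P]

lemma P_pow_mul_Q_mul_Q (f g : Laurent) : ν.P (ν.p ^ s * (ν.Q f * ν.Q g)) = 0 := by
  rcases hs with rfl | rfl
  · rw [pow_zero, one_mul, P_Q_mul_Q]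
  · rw [pow_one, P_p_mul_Q_mul_Q]

/-- Multiplication by p does not commute with P, but p^s θ f is D(p^s f). The defect P(p · Qf) is a
constant, which D annihilates. -/
lemma P_pow_mul_θ (f : Laurent) : ν.P (ν.p ^ s * (ν.splitting hs).θ f)
    = ν.p ^ s * ν.P ((ν.splitting hs).θ f) := by
  have h1 : ν.P ((ν.splitting hs).θ f) = (ν.splitting hs).θ (ν.P f) :=
    (ν.splitting hs).P_θ f
  have h2 : ν.d (ν.P (ν.p ^ s * ν.Q f)) = 0 := by
    rcases hs with rfl | rfl
    · rw [pow_zero, one_mul, P_Q, map_zero]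
    · rw [pow_one, d_P_p_mul_Q]
  have h3 : ν.P (ν.p ^ s * ν.P f) = ν.p ^ s * ν.P f := by
    have := ν.Q_pow_mul_P hs f
    rw [Q_apply, sub_eq_zero] at this
    exact this.symm
  rw [h1, ← D_pow_mul, ← D_pow_mul, P_D _ hs]
  conv_lhs => rw [← ν.P_add_Q f, mul_add, map_add, map_add, h3, D_apply _ _ (ν.P (_ * ν.Q f)), h2,
    mul_zero, add_zero]

lemma star_pow_mul_θ (a f : Laurent) : ν.star a (ν.p ^ s * (ν.splitting hs).θ f)
    = ν.p ^ s * (ν.splitting hs).star a ((ν.splitting hs).θ f) := by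
  have h := ν.P_pow_mul_θ hs f
  have h1 : ∀ f, (ν.splitting hs).P f = ν.P f := fun _ => rfl
  have h2 : ∀ f, (ν.splitting hs).Q f = ν.Q f := fun _ => rfl
  rw [star, Splitting.star, h1, h1, h2, h2, Q_apply _ (_ * _), Q_apply _ (Splitting.θ _ f), h]
  ring

/-- The covariant derivative of the multiplication is symmetric. -/
theorem nabla_circW_symm (w a b c : Laurent) :
    ν.circW s (ν.d (ν.sharpW s w a)) b c + ν.star a (ν.D s (ν.circW s w b c))
      - ν.circW s w (ν.star a (ν.D s b)) c - ν.circW s w b (ν.star a (ν.D s c))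
    = ν.circW s (ν.d (ν.sharpW s w b)) a c + ν.star b (ν.D s (ν.circW s w a c))
      - ν.circW s w (ν.star b (ν.D s a)) c - ν.circW s w a (ν.star b (ν.D s c)) := by
  -- With σ = s, which is the derivative of p^s for s = 0, 1, all powers of p come out of the
  -- expression as one common factor p^s.
  have key : ∀ a b : Laurent,
      ν.circW s (ν.d (ν.sharpW s w a)) b c + ν.star a (ν.D s (ν.circW s w b c))
      - ν.circW s w (ν.star a (ν.D s b)) c - ν.circW s w b (ν.star a (ν.D s c))
      = ν.p ^ s * (ν.splitting hs).tau w a b c := by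
    intro a b
    have e1 : ∀ y b c, ν.circW s y b c = ν.p ^ s * (ν.splitting hs).diamond y b c :=
      fun _ _ _ => rfl
    have e2 : ν.d (ν.sharpW s w a)
        = (ν.splitting hs).θ ((ν.splitting hs).P (w * a) - w * (ν.splitting hs).P a) :=
      ν.d_pow_mul hs _
    have e3 : ∀ a b, ν.star a b = (ν.splitting hs).star a b := fun _ _ => rfl
    have e4 : ∀ a, ν.D s a = (ν.splitting hs).δ a := fun _ => rfl
    rw [e1, e1, e1, e1, D_pow_mul _ hs, star_pow_mul_θ, e2, Splitting.tau]
    simp only [e3, e4]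
    ring
  rw [key, key, Splitting.tau_symm]

omit hs in
lemma circW_comm (w a b : Laurent) : ν.circW s w a b = ν.circW s w b a := by
  simp only [circW]; ring

omit hs in
-- Multiplication by w carries `circW` to p^s times the difference product of wa and wb. Since
-- p^s(Q·Q) has no nonnegative part, taking P leaves a product, and this gives associativity below
-- without any division by w.
lemma mul_circW (w a b : Laurent) : w * ν.circW s w a b
    = ν.p ^ s * (ν.P (w * a) * ν.P (w * b)) - ν.p ^ s * (ν.Q (w * a) * ν.Q (w * b)) := by
  simp only [circW, Q_apply]; ring

lemma P_mul_circW (w a b : Laurent) : ν.P (w * ν.circW s w a b)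
    = ν.p ^ s * (ν.P (w * a) * ν.P (w * b)) := by
  rw [mul_circW, map_sub, ν.P_pow_mul_Q_mul_Q hs, sub_zero, ← P_mul_P]
  have := ν.Q_pow_mul_P hs (ν.P (w * a) * ν.P (w * b))
  rw [Q_apply, sub_eq_zero] at this
  exact this.symm

lemma circW_assoc (w a b c : Laurent) : ν.circW s w (ν.circW s w a b) c
    = ν.circW s w a (ν.circW s w b c) := by
  rw [circW, ν.P_mul_circW hs, circW.eq_1 ν s w a (ν.circW s w b c), ν.P_mul_circW hs]
  simp only [circW]; ring

omit hs

/-- Adjointness of P and Q moves the projection off wa, respectively ya. The result is symmetric in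
a and c and linear in y; together with `tr_circW` it identifies the two descriptions of the metric.
-/
lemma tr_mul_sharpW (y a c : Laurent) :
    ν.tr s (c * ν.sharpW s y a) = -ν.res (y * ν.star a c) := by
  rw [sharpW, tr_mul', mul_sub, map_sub, res_mul_P, ← map_sub, ← map_neg]
  have h : ν.Q c * (y * a) - c * (y * ν.P a) = -(y * ν.star a c) := by
    simp only [star, Q_apply]; ring
  rw [h]

lemma tr_circW (y a b : Laurent) : ν.tr s (ν.circW s y a b) = -ν.res (y * ν.star a b) := by
  rw [circW, tr_mul, map_sub, map_add, mul_comm (ν.P (y * a)), res_mul_P, res_mul_P, ← map_add,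
    ← map_sub, ← map_neg]
  congr 1
  simp only [star, Q_apply]; ring

/-- By isotropy of the two subalgebras. With w = λ_p it says that a multiple of λ_p can be
subtracted from the unit field without changing its action. -/
lemma tr_mul_circW (w a b : Laurent) : ν.tr s (w * ν.circW s w a b) = 0 := by
  rw [mul_circW, ← mul_sub, tr_mul, map_sub, res_P_mul_P, res_Q_mul_Q, sub_zero]

lemma tr_mul_D (f g : Laurent) : ν.tr s (f * ν.D s g) = -ν.res (ν.d f * g) := by
  rw [D_apply, tr_mul', res_d_mul, neg_neg]

/-- The scaling operator of covectors. -/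
def kappa (s : ℕ) (c : ℂ) (f : Laurent) : Laurent :=
  (1 + c * (1 - s)) • f + c • (ν.p * ν.d f)

/-- `kappa` is the adjoint of y ↦ y - c p y_p under the trace. The constant c(1 - s) is what
integration by parts against p^{-s} produces. -/
lemma tr_mul_kappa (hs : s = 0 ∨ s = 1) (c : ℂ) (y f : Laurent) :
    ν.tr s (y * ν.kappa s c f) = ν.tr s ((y - c • (ν.p * ν.d y)) * f) := by
  have key : ν.tr s (y * ((1 - s : ℂ) • f + ν.p * ν.d f)) = -ν.tr s ((ν.p * ν.d y) * f) := by
    rcases hs with rfl | rfl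
    · simp only [tr_eq, pow_zero, inv_one, one_mul]
      have h := ν.res_d_mul y (ν.p * f)
      rw [d_mul, d_p] at h
      rw [show ν.p * ν.d y * f = ν.d y * (ν.p * f) by ring, h, neg_neg]
      simp
    · have h1 : y * ((1 - (1 : ℕ) : ℂ) • f + ν.p * ν.d f) = y * ν.D 1 f := by
        rw [Nat.cast_one, sub_self, laurent_zero_smul, zero_add, D_apply, pow_one]
      have h2 : ν.p * ν.d y * f = f * (ν.p ^ 1 * ν.d y) := by ring
      rw [h1, tr_mul_D, h2, tr_mul', mul_comm]
  have e1 : y * ν.kappa s c f = y * f + c • (y * ((1 - s : ℂ) • f + ν.p * ν.d f)) := by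
    simp only [kappa, smul_eq_C_mul, map_add, map_mul, map_one]; ring
  have e2 : (y - c • (ν.p * ν.d y)) * f = y * f - c • ((ν.p * ν.d y) * f) := by
    simp only [smul_eq_C_mul]; ring
  rw [e1, e2, ← trL_apply, ← trL_apply, map_add, map_sub, map_smul, map_smul, trL_apply, trL_apply,
    trL_apply, key]
  simp only [smul_eq_mul]; ring

include hs

lemma D_p_mul_d (f : Laurent) : ν.D s (ν.p * ν.d f)
    = (1 - s : ℂ) • ν.D s f + ν.p * ν.d (ν.D s f) := by
  rcases hs with rfl | rfl
  · simp [D_apply, d_mul, d_p]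
  · rw [Nat.cast_one, sub_self, laurent_zero_smul, zero_add, D_apply, D_apply, pow_one]

lemma star_D_p_mul_d (a b : Laurent) : ν.star (ν.D s a) (ν.p * ν.d b)
    = ν.star (ν.p * ν.d a) (ν.D s b) := by
  have h1 : ∀ f, ν.P (ν.p * ν.d f) = ν.p * ν.d (ν.P f) := ν.P_p_mul_d
  have h2 : ∀ f, ν.Q (ν.p * ν.d f) = ν.p * ν.d (ν.Q f) := by
    intro f; rw [Q_apply, Q_apply, h1, map_sub, mul_sub]
  simp only [star, h1, h2, ν.P_D hs, ν.Q_D hs]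
  simp only [D_apply]; ring

omit hs in
lemma p_mul_d_star (a b : Laurent) : ν.p * ν.d (ν.star a b)
    = ν.star (ν.p * ν.d a) b + ν.star a (ν.p * ν.d b) := by
  have h1 : ∀ f, ν.P (ν.p * ν.d f) = ν.p * ν.d (ν.P f) := ν.P_p_mul_d
  have h2 : ∀ f, ν.Q (ν.p * ν.d f) = ν.p * ν.d (ν.Q f) := by
    intro f; rw [Q_apply, Q_apply, h1, map_sub, mul_sub]
  simp only [star, h1, h2, map_sub, d_mul]; ring

/-- Paired with λ, the left side is the covariant derivative of the Euler field, tested on g. All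
terms with p ∂/∂p cancel, leaving first derivatives only. -/
lemma euler_first (c : ℂ) (a g : Laurent) :
    ν.D s (ν.star a (ν.kappa s c g)) - ν.kappa s c (ν.star a (ν.D s g))
      = (1 + c * (1 - s)) • ν.star (ν.D s a) g + (c * (1 - s)) • ν.star a (ν.D s g) := by
  simp only [kappa, star_add_right, star_smul_right, map_add, map_smul, ν.D_star hs,
    p_mul_d_star, ν.star_D_p_mul_d hs, ν.D_p_mul_d hs]
  module

/-- The bilinear expression for ∇E is itself parallel, for arbitrary coefficients k and l; only the
Leibniz rule, associativity and commutativity of `star` enter. -/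
lemma euler_second (k l : ℂ) (a b g : Laurent) :
    ν.D s (ν.star a (k • ν.star (ν.D s b) g + l • ν.star b (ν.D s g)))
      - (k • ν.star (ν.D s b) (ν.star a (ν.D s g)) + l • ν.star b (ν.D s (ν.star a (ν.D s g))))
      = k • ν.star (ν.D s (ν.star a (ν.D s b))) g + l • ν.star (ν.star a (ν.D s b)) (ν.D s g) := by
  have h1 : ∀ a b c, ν.star b (ν.star a c) = ν.star a (ν.star b c) := by
    intro a b c; rw [← star_assoc, star_comm ν b a, star_assoc]
  simp only [star_add_right, star_add_left, star_smul_right, map_add, map_smul, ν.D_star hs,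
    star_assoc, h1 a]
  have h2 : ν.star b (ν.star (ν.D s a) (ν.D s g)) = ν.star (ν.D s a) (ν.star b (ν.D s g)) := h1 _ _ _
  rw [h2]
  module

lemma lie_eta_identity (c : ℂ) (a b : Laurent) :
    ν.kappa s c (ν.D s (ν.star a b)) - ν.D s (ν.star (ν.kappa s c a) b)
      - ν.D s (ν.star a (ν.kappa s c b)) = (-(1 + 2 * c * (1 - s))) • ν.D s (ν.star a b) := by
  have h := ν.D_p_mul_d hs (ν.star a b)
  rw [p_mul_d_star] at h
  have h' : ν.p * ν.d (ν.D s (ν.star a b)) = ν.D s (ν.star (ν.p * ν.d a) b)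
      + ν.D s (ν.star a (ν.p * ν.d b)) - (1 - s : ℂ) • ν.D s (ν.star a b) := by
    rw [← map_add, h]; abel
  simp only [kappa, star_add_right, star_smul_right, star_add_left, star_smul_left, map_add,
    map_smul, h']
  module

lemma p_mul_d_circW (w a b : Laurent) : ν.p * ν.d (ν.circW s w a b)
    = (s : ℂ) • ν.circW s w a b + ν.circW s (ν.p * ν.d w) a b + ν.circW s w (ν.p * ν.d a) b
      + ν.circW s w a (ν.p * ν.d b) := by
  have hq : ν.p * ν.d (ν.p ^ s) = HahnSeries.C (s : ℂ) * ν.p ^ s := by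
    rcases hs with rfl | rfl
    · simp [d_one]
    · simp [d_p]
  have h1 : ∀ f, ν.p * ν.d (ν.P f) = ν.P (ν.p * ν.d f) := fun f => (ν.P_p_mul_d f).symm
  have h2 : ∀ f g, ν.p * ν.d (f * g) = (ν.p * ν.d f) * g + f * (ν.p * ν.d g) := by
    intro f g; rw [d_mul]; ring
  simp only [circW, smul_eq_C_mul]
  have e : ν.p * ν.d (ν.P (w * a) * b + a * ν.P (w * b) - w * a * b)
      = ν.p * ν.d (ν.P (w * a) * b) + ν.p * ν.d (a * ν.P (w * b)) - ν.p * ν.d (w * a * b) := by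
    rw [map_sub, map_add, mul_sub, mul_add]
  rw [h2, hq, e, h2 (ν.P _), h2 a, h2 (w * a), h1, h1, h2 w, h2 w, map_add, map_add]
  ring

/-- p ∂/∂p commutes with P, so it satisfies the product rule in all three arguments of `circW` and
picks up s from the factor p^s. The term w + p w_p is the derivative of p w. -/
lemma lie_circW_identity (c : ℂ) (w a b : Laurent) :
    ν.circW s (w - c • (w + ν.p * ν.d w)) a b + ν.kappa s c (ν.circW s w a b)
      - ν.circW s w (ν.kappa s c a) b - ν.circW s w a (ν.kappa s c b)
      = (2 * c * (s - 1)) • ν.circW s w a b := by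
  have e1 : ν.circW s (w - c • (w + ν.p * ν.d w)) a b = ν.circW s w a b
      - c • (ν.circW s w a b + ν.circW s (ν.p * ν.d w) a b) := by
    simp only [circW, smul_eq_C_mul, sub_mul, add_mul, mul_assoc, map_sub, map_add, P_C_mul]; ring
  have e2 : ∀ (k l : ℂ) (a a' b : Laurent), ν.circW s w (k • a + l • a') b
      = k • ν.circW s w a b + l • ν.circW s w a' b := by
    intro k l a a' b
    simp only [circW, smul_eq_C_mul, mul_add, mul_left_comm w, map_add, P_C_mul]; ring
  rw [e1]
  simp only [kappa, e2, circW_comm ν w a (_ + _), p_mul_d_circW _ hs]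
  rw [circW_comm ν w b a, circW_comm ν w _ a]
  module

end MarkedPoint
end FrobLaurent

namespace FrobLaurent

/-! ## Functions of finitely many coordinates -/

variable {ι : Type}

lemma RegFun.exists_superset {M : Set (ι → ℂ)} {f : (ι → ℂ) → ℂ} (S : Finset ι)
    (g : (S → ℂ) → ℂ)
    (h : ∀ u ∈ M, AnalyticAt ℂ g (fun i => u i) ∧ f u = g (fun i => u i)) (T : Finset ι)
    (hST : S ⊆ T) :
    ∃ g' : (T → ℂ) → ℂ,
      ∀ u ∈ M, AnalyticAt ℂ g' (fun i => u i) ∧ f u = g' (fun i => u i) := by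
  let L : (T → ℂ) →L[ℂ] (S → ℂ) :=
    ContinuousLinearMap.pi fun i => ContinuousLinearMap.proj (⟨i.1, hST i.2⟩ : T)
  refine ⟨fun x => g (L x), fun u hu => ⟨?_, (h u hu).2⟩⟩
  have h1 : AnalyticAt ℂ g (L fun i : T => u i) := (h u hu).1
  exact h1.comp (L.analyticAt _)

lemma RegFun.map₂ {M : Set (ι → ℂ)} {f₁ f₂ : (ι → ℂ) → ℂ} (h₁ : RegFun M f₁) (h₂ : RegFun M f₂)
    (op : ℂ → ℂ → ℂ)
    (hop : ∀ (T : Finset ι) (g₁ g₂ : (T → ℂ) → ℂ) (u : ι → ℂ), u ∈ M →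
      AnalyticAt ℂ g₁ (fun i => u i) → AnalyticAt ℂ g₂ (fun i => u i) →
      AnalyticAt ℂ (fun x => op (g₁ x) (g₂ x)) (fun i => u i)) :
    RegFun M fun u => op (f₁ u) (f₂ u) := by
  classical
  obtain ⟨S₁, g₁, h₁⟩ := h₁
  obtain ⟨S₂, g₂, h₂⟩ := h₂
  obtain ⟨g₁', h₁'⟩ := RegFun.exists_superset S₁ g₁ h₁ (S₁ ∪ S₂) Finset.subset_union_left
  obtain ⟨g₂', h₂'⟩ := RegFun.exists_superset S₂ g₂ h₂ (S₁ ∪ S₂) Finset.subset_union_right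
  refine ⟨S₁ ∪ S₂, fun x => op (g₁' x) (g₂' x), fun u hu => ⟨?_, ?_⟩⟩
  · exact hop _ _ _ u hu (h₁' u hu).1 (h₂' u hu).1
  · simp only [(h₁' u hu).2, (h₂' u hu).2]

lemma RegFun.const (M : Set (ι → ℂ)) (c : ℂ) : RegFun M fun _ => c :=
  ⟨∅, fun _ => c, fun _ _ => ⟨analyticAt_const, rfl⟩⟩

lemma RegFun.coord (M : Set (ι → ℂ)) (k : ι) : RegFun M fun u => u k :=
  ⟨{k}, fun x => x ⟨k, by simp⟩, fun _ _ =>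
    ⟨(ContinuousLinearMap.proj (R := ℂ) (φ := fun _ : ({k} : Finset ι) => ℂ)
      ⟨k, by simp⟩).analyticAt _, rfl⟩⟩

lemma RegFun.add {M : Set (ι → ℂ)} {f₁ f₂ : (ι → ℂ) → ℂ} (h₁ : RegFun M f₁) (h₂ : RegFun M f₂) :
    RegFun M fun u => f₁ u + f₂ u :=
  h₁.map₂ h₂ (· + ·) fun _ _ _ _ _ a b => a.add b

lemma RegFun.sub {M : Set (ι → ℂ)} {f₁ f₂ : (ι → ℂ) → ℂ} (h₁ : RegFun M f₁) (h₂ : RegFun M f₂) :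
    RegFun M fun u => f₁ u - f₂ u :=
  h₁.map₂ h₂ (· - ·) fun _ _ _ _ _ a b => a.sub b

lemma RegFun.mul {M : Set (ι → ℂ)} {f₁ f₂ : (ι → ℂ) → ℂ} (h₁ : RegFun M f₁) (h₂ : RegFun M f₂) :
    RegFun M fun u => f₁ u * f₂ u :=
  h₁.map₂ h₂ (· * ·) fun _ _ _ _ _ a b => a.mul b

lemma RegFun.neg {M : Set (ι → ℂ)} {f : (ι → ℂ) → ℂ} (h : RegFun M f) :
    RegFun M fun u => -f u := by
  simpa using (RegFun.const M 0).sub h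

lemma RegFun.inv {M : Set (ι → ℂ)} {f : (ι → ℂ) → ℂ} (h : RegFun M f) (h0 : ∀ u ∈ M, f u ≠ 0) :
    RegFun M fun u => (f u)⁻¹ := by
  obtain ⟨S, g, h⟩ := h
  refine ⟨S, fun x => (g x)⁻¹, fun u hu => ⟨?_, by simp only [(h u hu).2]⟩⟩
  exact (h u hu).1.inv (by rw [← (h u hu).2]; exact h0 u hu)

lemma RegFun.sum {M : Set (ι → ℂ)} {κ : Type*} (T : Finset κ) {f : κ → (ι → ℂ) → ℂ}
    (h : ∀ k ∈ T, RegFun M (f k)) : RegFun M fun u => ∑ k ∈ T, f k u := by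
  classical
  induction T using Finset.induction_on with
  | empty => simpa using RegFun.const M 0
  | insert a T ha ih =>
    simp only [Finset.sum_insert ha]
    exact (h a (by simp)).add (ih fun k hk => h k (by simp [hk]))

lemma RegFun.mono {M M' : Set (ι → ℂ)} {f : (ι → ℂ) → ℂ} (h : RegFun M f) (hM : M' ⊆ M) :
    RegFun M' f := by
  obtain ⟨S, g, h⟩ := h
  exact ⟨S, g, fun u hu => h u (hM hu)⟩

lemma RegFun.congr {M : Set (ι → ℂ)} {f f' : (ι → ℂ) → ℂ} (h : RegFun M f)
    (hf : ∀ u ∈ M, f' u = f u) : RegFun M f' := by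
  obtain ⟨S, g, h⟩ := h
  exact ⟨S, g, fun u hu => ⟨(h u hu).1, (hf u hu).trans (h u hu).2⟩⟩

lemma hasLineDerivAt_mul {f g : (ι → ℂ) → ℂ} {f' g' : ℂ} {u X : ι → ℂ}
    (hf : HasLineDerivAt ℂ f f' u X) (hg : HasLineDerivAt ℂ g g' u X) :
    HasLineDerivAt ℂ (fun w => f w * g w) (f' * g u + f u * g') u X := by
  have h := HasDerivAt.fun_mul hf hg
  have h0 : u + (0 : ℂ) • X = u := by rw [zero_smul, add_zero]
  rw [h0] at h
  exact h

/-- Points of `M` stay in `M` for small displacements along a line. -/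
lemma FinitelyOpen.eventually {M : Set (ι → ℂ)} (hM : FinitelyOpen M) {u : ι → ℂ} (hu : u ∈ M)
    (X : ι → ℂ) : ∀ᶠ t : ℂ in 𝓝 0, u + t • X ∈ M := by
  have h := hM u 1 fun _ => X
  have hc : Continuous fun t : ℂ => (fun _ : Fin 1 => t) := by fun_prop
  have h2 := (h.preimage hc).mem_nhds (x := 0) (by simpa using hu)
  filter_upwards [h2] with t ht
  simpa using ht

/-- A derivative along a line sees only nearby points of that line, so finite openness of M suffices
although M need not be open in the product topology. -/
lemma hasLineDerivAt_of_analytic {M : Set (ι → ℂ)} (hM : FinitelyOpen M) {f : (ι → ℂ) → ℂ}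
    {S : Finset ι} {g : (S → ℂ) → ℂ}
    (h : ∀ u ∈ M, AnalyticAt ℂ g (fun i => u i) ∧ f u = g (fun i => u i)) {u : ι → ℂ}
    (hu : u ∈ M) (X : ι → ℂ) :
    HasLineDerivAt ℂ f (fderiv ℂ g (fun i => u i) fun i => X i) u X := by
  have h1 : HasLineDerivAt ℂ g (fderiv ℂ g (fun i => u i) fun i => X i) (fun i => u i)
      (fun i => X i) := (h u hu).1.differentiableAt.hasFDerivAt.hasLineDerivAt _
  refine HasDerivAt.congr_of_eventuallyEq h1 ?_
  filter_upwards [hM.eventually hu X] with t ht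
  exact (h _ ht).2

lemma RegFun.hasLineDerivAt {M : Set (ι → ℂ)} (hM : FinitelyOpen M) {f : (ι → ℂ) → ℂ}
    (h : RegFun M f) {u : ι → ℂ} (hu : u ∈ M) (X : ι → ℂ) :
    HasLineDerivAt ℂ f (dirFun X f u) u X := by
  obtain ⟨S, g, h⟩ := h
  have := hasLineDerivAt_of_analytic hM h hu X
  rwa [dirFun, this.lineDeriv]

lemma RegFun.dirFun_add {M : Set (ι → ℂ)} (hM : FinitelyOpen M) {f : (ι → ℂ) → ℂ}
    (h : RegFun M f) {u : ι → ℂ} (hu : u ∈ M) (X Y : ι → ℂ) :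
    dirFun (X + Y) f u = dirFun X f u + dirFun Y f u := by
  obtain ⟨S, g, h⟩ := h
  simp only [dirFun, (hasLineDerivAt_of_analytic hM h hu _).lineDeriv]
  exact map_add (fderiv ℂ g _) (fun i : S => X i) (fun i : S => Y i)

lemma RegFun.dirFun_smul {M : Set (ι → ℂ)} (hM : FinitelyOpen M) {f : (ι → ℂ) → ℂ}
    (h : RegFun M f) {u : ι → ℂ} (hu : u ∈ M) (c : ℂ) (X : ι → ℂ) :
    dirFun (c • X) f u = c * dirFun X f u := by
  obtain ⟨S, g, h⟩ := h
  simp only [dirFun, (hasLineDerivAt_of_analytic hM h hu _).lineDeriv]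
  exact map_smul (fderiv ℂ g _) c (fun i : S => X i)

lemma fderiv_eq_sum [DecidableEq ι] {S : Finset ι} (L : (S → ℂ) →L[ℂ] ℂ) (X : S → ℂ) :
    L X = ∑ i, L (Pi.single i 1) * X i := by
  conv_lhs => rw [← Finset.univ_sum_single X, map_sum]
  refine Finset.sum_congr rfl fun i _ => ?_
  rw [mul_comm, ← smul_eq_mul, ← map_smul, ← Pi.single_smul, smul_eq_mul, mul_one]

/-- A derivative in the direction of a smooth vector field is smooth. -/
lemma RegFun.dirFun {M : Set (ι → ℂ)} (hM : FinitelyOpen M) {f : (ι → ℂ) → ℂ}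
    (h : RegFun M f) {Y : (ι → ℂ) → (ι → ℂ)} (hY : RegVec M Y) :
    RegFun M fun u => dirFun (Y u) f u := by
  classical
  obtain ⟨S, g, h⟩ := h
  have h2 : RegFun M fun u => ∑ i : S, fderiv ℂ g (fun j => u j) (Pi.single i 1) * Y u i := by
    refine RegFun.sum _ fun i _ => RegFun.mul ⟨S, fun x => fderiv ℂ g x (Pi.single i 1),
      fun u hu => ⟨?_, rfl⟩⟩ (hY i)
    exact ((ContinuousLinearMap.apply ℂ ℂ (Pi.single i 1 : S → ℂ)).analyticAt _).comp
      (h u hu).1.fderiv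
  refine h2.congr fun u hu => ?_
  rw [FrobLaurent.dirFun, (hasLineDerivAt_of_analytic hM h hu _).lineDeriv]
  exact fderiv_eq_sum _ _

/-- The commutator of the derivatives along two vector fields. -/
theorem RegFun.dirFun_comm {M : Set (ι → ℂ)} (hM : FinitelyOpen M) {f : (ι → ℂ) → ℂ}
    (h : RegFun M f) {X Y : (ι → ℂ) → (ι → ℂ)} (hX : RegVec M X) (hY : RegVec M Y) {u : ι → ℂ}
    (hu : u ∈ M) :
    FrobLaurent.dirFun (X u) (fun w => FrobLaurent.dirFun (Y w) f w) u
      - FrobLaurent.dirFun (Y u) (fun w => FrobLaurent.dirFun (X w) f w) u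
      = FrobLaurent.dirFun (fun k => FrobLaurent.dirFun (X u) (fun w => Y w k) u
          - FrobLaurent.dirFun (Y u) (fun w => X w k) u) f u := by
  classical
  obtain ⟨S, g, h⟩ := h
  -- The iterated derivative splits into the second derivative of g and a first derivative along the
  -- changing vector field. In the commutator only the latter survives.
  have key : ∀ {X Y : (ι → ℂ) → (ι → ℂ)}, RegVec M Y →
      FrobLaurent.dirFun (X u) (fun w => FrobLaurent.dirFun (Y w) f w) u =
        fderiv ℂ (fderiv ℂ g) (fun i => u i) (fun i => X u i) (fun i => Y u i)
        + fderiv ℂ g (fun i => u i) fun i => FrobLaurent.dirFun (X u) (fun w => Y w i) u := by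
    intro X Y hY
    have hg : ∀ i : S, HasLineDerivAt ℂ (fun w : ι → ℂ => fderiv ℂ g (fun j => w j)
        (Pi.single i 1)) (fderiv ℂ (fderiv ℂ g) (fun i => u i) (fun i => X u i) (Pi.single i 1))
        u (X u) := by
      intro i
      have h1 : HasLineDerivAt ℂ (fderiv ℂ g) (fderiv ℂ (fderiv ℂ g) (fun i => u i)
          fun i => X u i) (fun i => u i) (fun i => X u i) :=
        (h u hu).1.fderiv.differentiableAt.hasFDerivAt.hasLineDerivAt _
      exact ((ContinuousLinearMap.apply ℂ ℂ (Pi.single i 1 : S → ℂ)).hasFDerivAt).comp_hasDerivAt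
        (0 : ℂ) h1
    have hsum : HasLineDerivAt ℂ (fun w : ι → ℂ => ∑ i : S, fderiv ℂ g (fun j => w j)
        (Pi.single i 1) * Y w i) (∑ i : S,
        (fderiv ℂ (fderiv ℂ g) (fun i => u i) (fun i => X u i) (Pi.single i 1) * Y u i
          + fderiv ℂ g (fun j => u j) (Pi.single i 1)
            * FrobLaurent.dirFun (X u) (fun w => Y w i) u)) u (X u) := by
      refine HasDerivAt.fun_sum fun i _ => ?_
      exact hasLineDerivAt_mul (hg i) ((hY i).hasLineDerivAt hM hu (X u))
    have heq : HasLineDerivAt ℂ (fun w => FrobLaurent.dirFun (Y w) f w) (∑ i : S,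
        (fderiv ℂ (fderiv ℂ g) (fun i => u i) (fun i => X u i) (Pi.single i 1) * Y u i
          + fderiv ℂ g (fun j => u j) (Pi.single i 1)
            * FrobLaurent.dirFun (X u) (fun w => Y w i) u)) u (X u) := by
      refine HasDerivAt.congr_of_eventuallyEq hsum ?_
      filter_upwards [hM.eventually hu (X u)] with t ht
      rw [FrobLaurent.dirFun, (hasLineDerivAt_of_analytic hM h ht _).lineDeriv]
      exact fderiv_eq_sum _ _
    conv_lhs => rw [FrobLaurent.dirFun, heq.lineDeriv, Finset.sum_add_distrib]
    rw [fderiv_eq_sum (fderiv ℂ (fderiv ℂ g) _ _), fderiv_eq_sum (fderiv ℂ g _)]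
  rw [key hY, key hX]
  conv_rhs => rw [FrobLaurent.dirFun, (hasLineDerivAt_of_analytic hM h hu _).lineDeriv]
  have hsymm : IsSymmSndFDerivAt ℂ g (fun i : S => u i) :=
    (h u hu).1.contDiffAt.isSymmSndFDerivAt (n := ⊤) (by simp)
  rw [hsymm.eq, add_sub_add_left_eq_sub, ← map_sub]
  rfl

end FrobLaurent

namespace FrobLaurent

/-! ## Families of Laurent series -/

variable {ι : Type}

/-- Series without powers of the local parameter below `N`. -/
def ordGe (N : ℤ) : Submodule ℂ Laurent where
  carrier := {f | ∀ i < N, f.coeff i = 0}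
  add_mem' {f g} hf hg i hi := by
    rw [HahnSeries.coeff_add, hf i hi, hg i hi, add_zero]
  zero_mem' i _ := rfl
  smul_mem' c f hf i hi := by rw [HahnSeries.coeff_smul, hf i hi, smul_zero]

lemma exists_ordGe (f : Laurent) : ∃ N, f ∈ ordGe N := by
  by_cases h : f = 0
  · exact ⟨0, fun i _ => by rw [h]; rfl⟩
  · exact ⟨f.order, fun i hi => HahnSeries.coeff_eq_zero_of_lt_order hi⟩

lemma ordGe_mono {N N' : ℤ} (h : N' ≤ N) {f : Laurent} (hf : f ∈ ordGe N) : f ∈ ordGe N' :=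
  fun i hi => hf i (by omega)

lemma coeff_mul_eq_sum {f g : Laurent} {N N' : ℤ} (hf : f ∈ ordGe N) (hg : g ∈ ordGe N') (i : ℤ) :
    (f * g).coeff i = ∑ j ∈ Finset.Icc N (i - N'), f.coeff j * g.coeff (i - j) := by
  rw [HahnSeries.coeff_mul]
  refine Finset.sum_bij_ne_zero (fun x _ _ => x.1) ?_ ?_ ?_ ?_
  · intro x hx h0
    rw [Finset.mem_antidiagonal] at hx
    have h1 : ¬ x.1 < N := fun h => h0 (by rw [hf _ h, zero_mul])
    have h2 : ¬ x.2 < N' := fun h => h0 (by rw [hg _ h, mul_zero])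
    rw [Finset.mem_Icc]; omega
  · intro x hx _ y hy _ hxy
    rw [Finset.mem_antidiagonal] at hx hy
    ext
    · exact hxy
    · have := hx.2.2; have := hy.2.2; omega
  · intro j hj h0
    refine ⟨(j, i - j), ?_, h0, rfl⟩
    rw [Finset.mem_antidiagonal]
    exact ⟨left_ne_zero_of_mul h0, right_ne_zero_of_mul h0, by simp⟩
  · intro x hx _
    rw [Finset.mem_antidiagonal] at hx
    rw [← hx.2.2, add_sub_cancel_left]

lemma mul_mem_ordGe {f g : Laurent} {N N' : ℤ} (hf : f ∈ ordGe N) (hg : g ∈ ordGe N') :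
    f * g ∈ ordGe (N + N') := by
  intro i hi
  rw [coeff_mul_eq_sum hf hg, Finset.Icc_eq_empty (by omega), Finset.sum_empty]

lemma MarkedPoint.P_mem_ordGe (ν : MarkedPoint) {f : Laurent} {N : ℤ} (hf : f ∈ ordGe N) :
    ν.P f ∈ ordGe N := by
  intro i hi
  cases ν
  · rw [MarkedPoint.P_infinity_coeff, hf i hi, ite_self]
  · rw [MarkedPoint.P_finite_coeff, hf i hi, ite_self]

lemma MarkedPoint.d_mem_ordGe (ν : MarkedPoint) {f : Laurent} {N : ℤ} (hf : f ∈ ordGe N) :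
    ν.d f ∈ ordGe (N - 1) := by
  intro i hi
  cases ν
  · rw [MarkedPoint.d_infinity_coeff, hf _ (by omega), mul_zero, neg_zero]
  · rw [MarkedPoint.d_finite_coeff, hf _ (by omega), mul_zero]

/-- The coefficients of the derivative. -/
lemma MarkedPoint.exists_d_coeff (ν : MarkedPoint) : ∃ (k : ℤ → ℂ) (σ : ℤ → ℤ), ∀ f i,
    (ν.d f).coeff i = k i * f.coeff (σ i) := by
  cases ν with
  | infinity =>
    refine ⟨fun i => -(i - 1), fun i => i - 1, fun f i => ?_⟩
    rw [MarkedPoint.d_infinity_coeff, neg_mul]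
  | finite v => exact ⟨fun i => i + 1, fun i => i + 1, fun f i => MarkedPoint.d_finite_coeff v f i⟩

lemma MarkedPoint.exists_P_coeff (ν : MarkedPoint) : ∃ k : ℤ → ℂ, ∀ f i,
    (ν.P f).coeff i = k i * f.coeff i := by
  cases ν with
  | infinity =>
    refine ⟨fun i => if i ≤ 0 then 1 else 0, fun f i => ?_⟩
    rw [MarkedPoint.P_infinity_coeff]; by_cases h : i ≤ 0 <;> simp [h]
  | finite v =>
    refine ⟨fun i => if 0 ≤ i then 1 else 0, fun f i => ?_⟩
    rw [MarkedPoint.P_finite_coeff]; by_cases h : 0 ≤ i <;> simp [h]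

/-- Smooth families of Laurent series. -/
def RegL (M : Set (ι → ℂ)) (φ : (ι → ℂ) → Laurent) : Prop :=
  (∃ N, ∀ u ∈ M, φ u ∈ ordGe N) ∧ ∀ i, RegFun M fun u => (φ u).coeff i

section RegL

variable {M : Set (ι → ℂ)} {φ ψ : (ι → ℂ) → Laurent}

lemma RegL.const (M : Set (ι → ℂ)) (f : Laurent) : RegL M fun _ => f :=
  ⟨(exists_ordGe f).imp fun _ h _ _ => h, fun _ => RegFun.const M _⟩

lemma RegL.congr (h : RegL M φ) (hf : ∀ u ∈ M, ψ u = φ u) : RegL M ψ :=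
  ⟨h.1.imp fun _ h u hu => by rw [hf u hu]; exact h u hu,
    fun i => (h.2 i).congr fun u hu => by rw [hf u hu]⟩

lemma RegL.add (h : RegL M φ) (h' : RegL M ψ) : RegL M fun u => φ u + ψ u := by
  obtain ⟨⟨N, hN⟩, hc⟩ := h
  obtain ⟨⟨N', hN'⟩, hc'⟩ := h'
  refine ⟨⟨min N N', fun u hu => (ordGe _).add_mem (ordGe_mono (min_le_left _ _) (hN u hu))
    (ordGe_mono (min_le_right _ _) (hN' u hu))⟩, fun i => ?_⟩
  simp only [HahnSeries.coeff_add]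
  exact (hc i).add (hc' i)

lemma RegL.neg (h : RegL M φ) : RegL M fun u => -φ u := by
  obtain ⟨⟨N, hN⟩, hc⟩ := h
  refine ⟨⟨N, fun u hu => (ordGe _).neg_mem (hN u hu)⟩, fun i => ?_⟩
  simp only [HahnSeries.coeff_neg]
  exact (hc i).neg

lemma RegL.sub (h : RegL M φ) (h' : RegL M ψ) : RegL M fun u => φ u - ψ u :=
  (h.add h'.neg).congr fun _ _ => sub_eq_add_neg _ _

lemma RegL.mul (h : RegL M φ) (h' : RegL M ψ) : RegL M fun u => φ u * ψ u := by
  obtain ⟨⟨N, hN⟩, hc⟩ := h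
  obtain ⟨⟨N', hN'⟩, hc'⟩ := h'
  refine ⟨⟨N + N', fun u hu => mul_mem_ordGe (hN u hu) (hN' u hu)⟩, fun i => ?_⟩
  refine RegFun.congr (RegFun.sum (Finset.Icc N (i - N'))
    fun j _ => (hc j).mul (hc' (i - j))) fun u hu => ?_
  exact coeff_mul_eq_sum (hN u hu) (hN' u hu) i

lemma RegL.pow (h : RegL M φ) (n : ℕ) : RegL M fun u => φ u ^ n := by
  induction n with
  | zero => simpa using RegL.const M 1
  | succ n ih => simpa only [pow_succ] using ih.mul h

lemma RegL.smul {f : (ι → ℂ) → ℂ} (hf : RegFun M f) (h : RegL M φ) : RegL M fun u => f u • φ u := by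
  obtain ⟨⟨N, hN⟩, hc⟩ := h
  refine ⟨⟨N, fun u hu => (ordGe _).smul_mem _ (hN u hu)⟩, fun i => ?_⟩
  simp only [HahnSeries.coeff_smul, smul_eq_mul]
  exact hf.mul (hc i)

lemma RegL.P (ν : MarkedPoint) (h : RegL M φ) : RegL M fun u => ν.P (φ u) := by
  obtain ⟨⟨N, hN⟩, hc⟩ := h
  obtain ⟨k, hk⟩ := ν.exists_P_coeff
  refine ⟨⟨N, fun u hu => ν.P_mem_ordGe (hN u hu)⟩, fun i => ?_⟩
  simp only [hk]
  exact (RegFun.const M _).mul (hc i)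

lemma RegL.Q (ν : MarkedPoint) (h : RegL M φ) : RegL M fun u => ν.Q (φ u) := h.sub (h.P ν)

lemma RegL.d (ν : MarkedPoint) (h : RegL M φ) : RegL M fun u => ν.d (φ u) := by
  obtain ⟨⟨N, hN⟩, hc⟩ := h
  obtain ⟨k, σ, hk⟩ := ν.exists_d_coeff
  refine ⟨⟨N - 1, fun u hu => ν.d_mem_ordGe (hN u hu)⟩, fun i => ?_⟩
  simp only [hk]
  exact (RegFun.const M _).mul (hc _)

lemma RegL.star (ν : MarkedPoint) (h : RegL M φ) (h' : RegL M ψ) :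
    RegL M fun u => ν.star (φ u) (ψ u) :=
  ((h.P ν).mul (h'.P ν)).sub ((h.Q ν).mul (h'.Q ν))

lemma RegL.res (ν : MarkedPoint) (h : RegL M φ) : RegFun M fun u => ν.res (φ u) := by
  cases ν
  · exact h.2 1
  · exact h.2 (-1)

end RegL

/-! ### The derivative at fixed `p` -/

/-- `ψ` is the derivative at fixed `p` of the family `φ` of Laurent series at `u` along `X`, where
`c` is the velocity of the marked point. -/
structure HasD (ν : MarkedPoint) (c : ℂ) (φ : (ι → ℂ) → Laurent) (ψ : Laurent) (u X : ι → ℂ) :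
    Prop where
  bdd : ∃ N, ∀ᶠ t : ℂ in 𝓝 0, φ (u + t • X) ∈ ordGe N
  -- Coefficients refer to the local parameter, which moves with the marked point. For φ = ∑ φ_i (p
  -- - v)^i the derivative at fixed p is ∑ φ_i' (p - v)^i minus the velocity of v times φ_p.
  coeff : ∀ i, HasLineDerivAt ℂ (fun w => (φ w).coeff i) ((ψ + c • ν.d (φ u)).coeff i) u X

section HasD

variable {ν : MarkedPoint} {c : ℂ} {φ φ₁ φ₂ : (ι → ℂ) → Laurent} {ψ ψ₁ ψ₂ : Laurent} {u X : ι → ℂ}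

lemma HasD.unique (h₁ : HasD ν c φ ψ₁ u X) (h₂ : HasD ν c φ ψ₂ u X) : ψ₁ = ψ₂ := by
  ext i
  have := (h₁.coeff i).unique (h₂.coeff i)
  simpa using this

lemma HasD.mem_of_bdd {N : ℤ} (h : HasD ν c φ ψ u X)
    (hN : ∀ᶠ t : ℂ in 𝓝 0, φ (u + t • X) ∈ ordGe N) :
    φ u ∈ ordGe N ∧ ψ + c • ν.d (φ u) ∈ ordGe N := by
  constructor
  · have := hN.self_of_nhds
    rwa [zero_smul, add_zero] at this
  · intro i hi
    refine (h.coeff i).unique ?_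
    refine HasDerivAt.congr_of_eventuallyEq (hasDerivAt_const (0 : ℂ) (0 : ℂ)) ?_
    filter_upwards [hN] with t ht
    exact ht i hi

lemma HasD.const (f : Laurent) : HasD ν c (fun _ => f) (-(c • ν.d f)) u X where
  bdd := (exists_ordGe f).imp fun _ h => Filter.Eventually.of_forall fun _ => h
  coeff i := by
    rw [neg_add_cancel]
    exact hasDerivAt_const _ _

lemma HasD.congr (h : HasD ν c φ ψ u X) (hu : φ₁ u = φ u)
    (he : ∀ᶠ t : ℂ in 𝓝 0, φ₁ (u + t • X) = φ (u + t • X)) : HasD ν c φ₁ ψ u X where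
  bdd := h.bdd.imp fun N hN => by
    filter_upwards [hN, he] with t h1 h2
    rwa [h2]
  coeff i := by
    rw [hu]
    refine HasDerivAt.congr_of_eventuallyEq (h.coeff i) ?_
    filter_upwards [he] with t ht
    rw [ht]

lemma HasD.add (h₁ : HasD ν c φ₁ ψ₁ u X) (h₂ : HasD ν c φ₂ ψ₂ u X) :
    HasD ν c (fun w => φ₁ w + φ₂ w) (ψ₁ + ψ₂) u X where
  bdd := by
    obtain ⟨N₁, hN₁⟩ := h₁.bdd
    obtain ⟨N₂, hN₂⟩ := h₂.bdd
    refine ⟨min N₁ N₂, ?_⟩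
    filter_upwards [hN₁, hN₂] with t h1 h2
    exact (ordGe _).add_mem (ordGe_mono (min_le_left _ _) h1) (ordGe_mono (min_le_right _ _) h2)
  coeff i := by
    have h := HasDerivAt.fun_add (h₁.coeff i) (h₂.coeff i)
    rw [← HahnSeries.coeff_add] at h
    rw [map_add, smul_add, add_add_add_comm]
    exact h

lemma HasD.smul (r : ℂ) (h : HasD ν c φ ψ u X) : HasD ν c (fun w => r • φ w) (r • ψ) u X where
  bdd := h.bdd.imp fun N hN => hN.mono fun t ht => (ordGe N).smul_mem r ht
  coeff i := by
    have h := HasDerivAt.const_mul r (h.coeff i)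
    have e : r • ψ + c • ν.d (r • φ u) = r • (ψ + c • ν.d (φ u)) := by
      rw [map_smul]; module
    rw [e]
    exact h

lemma HasD.sub (h₁ : HasD ν c φ₁ ψ₁ u X) (h₂ : HasD ν c φ₂ ψ₂ u X) :
    HasD ν c (fun w => φ₁ w - φ₂ w) (ψ₁ - ψ₂) u X := by
  have h := h₁.add (h₂.smul (-1))
  have e : ∀ f : Laurent, (-1 : ℂ) • f = -f := fun f => neg_one_smul ℂ f
  simp only [e, ← sub_eq_add_neg] at h
  exact h

/-- The common lower bounds on the exponents near u turn each coefficient of the product into a sum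
over a fixed finite range, which can be differentiated term by term. -/
lemma HasD.mul (h₁ : HasD ν c φ₁ ψ₁ u X) (h₂ : HasD ν c φ₂ ψ₂ u X) :
    HasD ν c (fun w => φ₁ w * φ₂ w) (ψ₁ * φ₂ u + φ₁ u * ψ₂) u X := by
  obtain ⟨N₁, hN₁⟩ := h₁.bdd
  obtain ⟨N₂, hN₂⟩ := h₂.bdd
  refine ⟨⟨N₁ + N₂, ?_⟩, fun i => ?_⟩
  · filter_upwards [hN₁, hN₂] with t h1 h2
    exact mul_mem_ordGe h1 h2
  · obtain ⟨m1, m1'⟩ := h₁.mem_of_bdd hN₁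
    obtain ⟨m2, m2'⟩ := h₂.mem_of_bdd hN₂
    have e : ψ₁ * φ₂ u + φ₁ u * ψ₂ + c • ν.d (φ₁ u * φ₂ u)
        = (ψ₁ + c • ν.d (φ₁ u)) * φ₂ u + φ₁ u * (ψ₂ + c • ν.d (φ₂ u)) := by
      rw [MarkedPoint.d_mul]; simp only [smul_eq_C_mul]; ring
    rw [e, HahnSeries.coeff_add, coeff_mul_eq_sum m1' m2, coeff_mul_eq_sum m1 m2',
      ← Finset.sum_add_distrib]
    have hs : HasLineDerivAt ℂ (fun w => ∑ j ∈ Finset.Icc N₁ (i - N₂),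
        (φ₁ w).coeff j * (φ₂ w).coeff (i - j)) _ u X :=
      HasDerivAt.fun_sum fun j _ => hasLineDerivAt_mul (h₁.coeff j) (h₂.coeff (i - j))
    refine HasDerivAt.congr_of_eventuallyEq hs ?_
    filter_upwards [hN₁, hN₂] with t h1 h2
    exact coeff_mul_eq_sum h1 h2 i

lemma HasD.P (h : HasD ν c φ ψ u X) : HasD ν c (fun w => ν.P (φ w)) (ν.P ψ) u X where
  bdd := h.bdd.imp fun N hN => hN.mono fun t ht => ν.P_mem_ordGe ht
  coeff i := by
    obtain ⟨k, hk⟩ := ν.exists_P_coeff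
    rw [← MarkedPoint.P_d, ← map_smul, ← map_add]
    simp only [hk]
    exact HasDerivAt.const_mul _ (h.coeff i)

lemma HasD.Q (h : HasD ν c φ ψ u X) : HasD ν c (fun w => ν.Q (φ w)) (ν.Q ψ) u X := h.sub h.P

lemma HasD.d (h : HasD ν c φ ψ u X) : HasD ν c (fun w => ν.d (φ w)) (ν.d ψ) u X where
  bdd := by
    obtain ⟨N, hN⟩ := h.bdd
    exact ⟨N - 1, hN.mono fun t ht => ν.d_mem_ordGe ht⟩
  coeff i := by
    obtain ⟨k, σ, hk⟩ := ν.exists_d_coeff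
    rw [← map_smul, ← map_add]
    simp only [hk]
    exact HasDerivAt.const_mul _ (h.coeff (σ i))

lemma HasD.star (h₁ : HasD ν c φ₁ ψ₁ u X) (h₂ : HasD ν c φ₂ ψ₂ u X) :
    HasD ν c (fun w => ν.star (φ₁ w) (φ₂ w)) (ν.star ψ₁ (φ₂ u) + ν.star (φ₁ u) ψ₂) u X := by
  have e : ν.star ψ₁ (φ₂ u) + ν.star (φ₁ u) ψ₂ = ν.P ψ₁ * ν.P (φ₂ u) + ν.P (φ₁ u) * ν.P ψ₂
      - (ν.Q ψ₁ * ν.Q (φ₂ u) + ν.Q (φ₁ u) * ν.Q ψ₂) := by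
    rw [MarkedPoint.star, MarkedPoint.star]; ring
  rw [e]
  exact (h₁.P.mul h₂.P).sub (h₁.Q.mul h₂.Q)

/-- The motion of the marked point contributes a derivative, which has no residue. -/
lemma HasD.res (h : HasD ν c φ ψ u X) :
    HasLineDerivAt ℂ (fun w => ν.res (φ w)) (ν.res ψ) u X := by
  have e : ν.res (ψ + c • ν.d (φ u)) = ν.res ψ := by
    rw [map_add, map_smul, MarkedPoint.res_d, smul_zero, add_zero]
  rw [← e]
  cases ν
  · exact h.coeff 1
  · exact h.coeff (-1)

lemma HasD.pow_zero_deriv (h : HasD ν c φ 0 u X) (n : ℕ) :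
    HasD ν c (fun w => φ w ^ n) 0 u X := by
  induction n with
  | zero =>
    simpa [MarkedPoint.d_one] using (HasD.const 1 : HasD ν c (fun _ : ι → ℂ => (1 : Laurent)) _ u X)
  | succ n ih =>
    have := ih.mul h
    simpa only [pow_succ, mul_zero, zero_mul, add_zero] using this

end HasD

/-- The derivative at fixed `p` of a family of Laurent series. -/
def DL (ν : MarkedPoint) (c : ℂ) (X : ι → ℂ) (φ : (ι → ℂ) → Laurent) (u : ι → ℂ) : Laurent := by
  classical
  exact (if h : BddBelow (Function.support fun i => dirFun X (fun w => (φ w).coeff i) u) then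
    HahnSeries.ofSuppBddBelow _ h else 0) - c • ν.d (φ u)

lemma RegL.hasD {M : Set (ι → ℂ)} (hM : FinitelyOpen M) (ν : MarkedPoint) (c : ℂ)
    {φ : (ι → ℂ) → Laurent} (h : RegL M φ) {u : ι → ℂ} (hu : u ∈ M) (X : ι → ℂ) :
    HasD ν c φ (DL ν c X φ u) u X := by
  obtain ⟨⟨N, hN⟩, hc⟩ := h
  refine ⟨⟨N, (hM.eventually hu X).mono fun t ht => hN _ ht⟩, fun i => ?_⟩
  have hb : BddBelow (Function.support fun i => dirFun X (fun w => (φ w).coeff i) u) := by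
    refine ⟨N, fun i hi => ?_⟩
    by_contra hlt
    refine hi (((hc i).hasLineDerivAt hM hu X).unique ?_)
    refine HasDerivAt.congr_of_eventuallyEq (hasDerivAt_const (0 : ℂ) (0 : ℂ)) ?_
    filter_upwards [hM.eventually hu X] with t ht
    exact hN _ ht i (not_le.mp hlt)
  rw [DL, dif_pos hb, sub_add_cancel, HahnSeries.coeff_ofSuppBddBelow]
  exact (hc i).hasLineDerivAt hM hu X

/-- The velocity of the marked point, if it is the coordinate `j`, or if it is fixed. -/
def vel : Option ι → (ι → ℂ) →ₗ[ℂ] ℂ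
  | none => 0
  | some j => LinearMap.proj j

lemma RegVec.vel {M : Set (ι → ℂ)} {Y : (ι → ℂ) → (ι → ℂ)} (hY : RegVec M Y) (j : Option ι) :
    RegFun M fun u => vel j (Y u) := by
  cases j with
  | none => exact RegFun.const M 0
  | some j => exact hY j

lemma dirFun_vel (j : Option ι) (X : ι → ℂ) (Y : (ι → ℂ) → (ι → ℂ)) (u : ι → ℂ) :
    dirFun X (fun w => vel j (Y w)) u = vel j fun k => dirFun X (fun w => Y w k) u := by
  cases j with
  | none => exact (hasDerivAt_const (0 : ℂ) (0 : ℂ)).deriv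
  | some j => rfl

section DL

variable {M : Set (ι → ℂ)} (hM : FinitelyOpen M) (ν : MarkedPoint) {φ : (ι → ℂ) → Laurent}
include hM

lemma RegL.DL_coeff (h : RegL M φ) {u : ι → ℂ} (hu : u ∈ M) (c : ℂ) (X : ι → ℂ) (i : ℤ) :
    (DL ν c X φ u).coeff i
      = dirFun X (fun w => (φ w).coeff i) u - c * (ν.d (φ u)).coeff i := by
  have h1 := (h.hasD hM ν c hu X).coeff i
  rw [dirFun, h1.lineDeriv]; simp

lemma RegL.DL (h : RegL M φ) {Y : (ι → ℂ) → (ι → ℂ)} (hY : RegVec M Y) {c : (ι → ℂ) → ℂ}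
    (hc : RegFun M c) : RegL M fun u => DL ν (c u) (Y u) φ u := by
  obtain ⟨N, hN⟩ := h.1
  refine ⟨⟨N - 1, fun u hu => ?_⟩, fun i => ?_⟩
  · have h1 := h.hasD hM ν (c u) hu (Y u)
    have h2 := (h1.mem_of_bdd ((hM.eventually hu (Y u)).mono fun t ht => hN _ ht)).2
    have h3 := (ordGe (N - 1)).sub_mem (ordGe_mono (by omega) h2)
      ((ordGe (N - 1)).smul_mem (c u) (ν.d_mem_ordGe (hN u hu)))
    rwa [add_sub_cancel_right] at h3
  · exact (((h.2 i).dirFun hM hY).sub (hc.mul ((h.d ν).2 i))).congr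
      fun u hu => h.DL_coeff hM ν hu _ _ i

lemma RegL.DL_add (h : RegL M φ) {u : ι → ℂ} (hu : u ∈ M) (c c' : ℂ) (X Y : ι → ℂ) :
    FrobLaurent.DL ν (c + c') (X + Y) φ u
      = FrobLaurent.DL ν c X φ u + FrobLaurent.DL ν c' Y φ u := by
  ext i
  rw [HahnSeries.coeff_add, h.DL_coeff hM ν hu, h.DL_coeff hM ν hu, h.DL_coeff hM ν hu,
    (h.2 i).dirFun_add hM hu]
  ring

lemma RegL.DL_smul (h : RegL M φ) {u : ι → ℂ} (hu : u ∈ M) (r c : ℂ) (X : ι → ℂ) :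
    FrobLaurent.DL ν (r * c) (r • X) φ u = r • FrobLaurent.DL ν c X φ u := by
  ext i
  rw [HahnSeries.coeff_smul, h.DL_coeff hM ν hu, h.DL_coeff hM ν hu, (h.2 i).dirFun_smul hM hu,
    smul_eq_mul]
  ring

/-- The commutator of derivatives at fixed `p`. -/
theorem RegL.DL_comm (j : Option ι) (h : RegL M φ) {X Y : (ι → ℂ) → (ι → ℂ)} (hX : RegVec M X)
    (hY : RegVec M Y) {u : ι → ℂ} (hu : u ∈ M) {Z : ι → ℂ}
    (hZ : ∀ k, Z k = dirFun (X u) (fun w => Y w k) u - dirFun (Y u) (fun w => X w k) u) :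
    FrobLaurent.DL ν (vel j (X u)) (X u) (fun w => FrobLaurent.DL ν (vel j (Y w)) (Y w) φ w) u
      - FrobLaurent.DL ν (vel j (Y u)) (Y u)
          (fun w => FrobLaurent.DL ν (vel j (X w)) (X w) φ w) u
      = FrobLaurent.DL ν (vel j Z) Z φ u := by
  obtain ⟨k, σ, hk⟩ := ν.exists_d_coeff
  have hZ' : Z = fun k => dirFun (X u) (fun w => Y w k) u - dirFun (Y u) (fun w => X w k) u :=
    funext hZ
  ext i
  -- Second derivatives of coefficients and the velocity terms are separated. After
  -- antisymmetrization the products of two velocities cancel and the derivatives of the velocities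
  -- form the velocity of the bracket.
  have key : ∀ {X Y : (ι → ℂ) → (ι → ℂ)}, RegVec M X → RegVec M Y →
      (FrobLaurent.DL ν (vel j (X u)) (X u)
        (fun w => FrobLaurent.DL ν (vel j (Y w)) (Y w) φ w) u).coeff i
      = dirFun (X u) (fun w => dirFun (Y w) (fun w => (φ w).coeff i) w) u
        - ((vel j fun k => dirFun (X u) (fun w => Y w k) u) * (k i * (φ u).coeff (σ i))
          + vel j (Y u) * (k i * dirFun (X u) (fun w => (φ w).coeff (σ i)) u))
        - vel j (X u) * (k i * (dirFun (Y u) (fun w => (φ w).coeff (σ i)) u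
          - vel j (Y u) * (k (σ i) * (φ u).coeff (σ (σ i))))) := by
    intro X Y hX hY
    rw [(h.DL hM ν hY (hY.vel j)).DL_coeff hM ν hu, hk, h.DL_coeff hM ν hu, hk]
    congr 1
    have h1 := ((h.2 i).dirFun hM hY).hasLineDerivAt hM hu (X u)
    have h0 : HasLineDerivAt ℂ (fun w => k i * (φ w).coeff (σ i))
        (k i * dirFun (X u) (fun w => (φ w).coeff (σ i)) u) u (X u) :=
      HasDerivAt.const_mul (k i) ((h.2 (σ i)).hasLineDerivAt hM hu (X u))
    have h2 := hasLineDerivAt_mul ((hY.vel j).hasLineDerivAt hM hu (X u)) h0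
    have h3 := HasDerivAt.fun_sub h1 h2
    rw [dirFun_vel] at h3
    refine HasDerivAt.deriv (HasDerivAt.congr_of_eventuallyEq h3 ?_)
    filter_upwards [hM.eventually hu (X u)] with t ht
    rw [h.DL_coeff hM ν ht, hk]
  rw [HahnSeries.coeff_sub, key hX hY, key hY hX, h.DL_coeff hM ν hu, hk, hZ',
    ← (h.2 i).dirFun_comm hM hX hY hu]
  have hv : (vel j fun k => dirFun (X u) (fun w => Y w k) u - dirFun (Y u) (fun w => X w k) u)
      = (vel j fun k => dirFun (X u) (fun w => Y w k) u)
        - (vel j fun k => dirFun (Y u) (fun w => X w k) u) := by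
    rw [← map_sub]; rfl
  rw [hv]
  ring

end DL

end FrobLaurent

namespace FrobLaurent

variable {ι : Type}

/-! ## The pairing of covectors and vectors -/

lemma pair_eq (a : ι →₀ ℂ) (X : ι → ℂ) : pair a X = Finsupp.linearCombination ℂ X a := by
  rw [Finsupp.linearCombination_apply]; rfl

lemma pair_add_left (a b : ι →₀ ℂ) (X : ι → ℂ) : pair (a + b) X = pair a X + pair b X := by
  simp only [pair_eq, map_add]
lemma pair_sub_left (a b : ι →₀ ℂ) (X : ι → ℂ) : pair (a - b) X = pair a X - pair b X := by
  simp only [pair_eq, map_sub]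
lemma pair_smul_left (c : ℂ) (a : ι →₀ ℂ) (X : ι → ℂ) : pair (c • a) X = c * pair a X := by
  simp only [pair_eq, map_smul, smul_eq_mul]
lemma pair_zero_left (X : ι → ℂ) : pair 0 X = 0 := by simp only [pair_eq, map_zero]

lemma pair_eq_sum (a : ι →₀ ℂ) (X : ι → ℂ) {S : Finset ι} (h : a.support ⊆ S) :
    pair a X = ∑ k ∈ S, a k * X k :=
  Finsupp.sum_of_support_subset a h _ fun _ _ => zero_mul _

lemma pair_sub_right (a : ι →₀ ℂ) (X Y : ι → ℂ) : pair a (X - Y) = pair a X - pair a Y := by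
  simp only [pair_eq_sum a _ subset_rfl, Pi.sub_apply, mul_sub, Finset.sum_sub_distrib]

lemma pair_single_left (k : ι) (X : ι → ℂ) : pair (Finsupp.single k 1) X = X k := by
  rw [pair_eq, Finsupp.linearCombination_single, one_smul]

lemma pair_single_right [DecidableEq ι] (a : ι →₀ ℂ) (k : ι) : pair a (Pi.single k 1) = a k := by
  rw [pair_eq_sum a _ subset_rfl]
  by_cases hk : k ∈ a.support
  · rw [Finset.sum_eq_single_of_mem k hk fun b _ hb => by rw [Pi.single_eq_of_ne hb, mul_zero],
      Pi.single_eq_same, mul_one]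
  · rw [Finsupp.notMem_support_iff.mp hk]
    refine Finset.sum_eq_zero fun b hb => ?_
    rw [Pi.single_eq_of_ne (by rintro rfl; exact hk hb), mul_zero]

lemma covec_ext {a b : ι →₀ ℂ} (h : ∀ X, pair a X = pair b X) : a = b := by
  classical
  ext k
  simpa only [pair_single_right] using h (Pi.single k 1)

lemma vec_ext {X Y : ι → ℂ} (h : ∀ a, pair a X = pair a Y) : X = Y := by
  ext k
  simpa only [pair_single_left] using h (Finsupp.single k 1)

lemma toCovec_apply {f : ι → ℂ} (h : (Function.support f).Finite) (k : ι) : toCovec f k = f k := by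
  rw [toCovec, dif_pos h]; rfl

lemma pair_toCovec {f : ι → ℂ} {S : Finset ι} (h : ∀ k ∉ S, f k = 0) (X : ι → ℂ) :
    pair (toCovec f) X = ∑ k ∈ S, f k * X k := by
  have hf : Function.support f ⊆ S := fun k hk => by
    by_contra hS
    exact hk (h k hS)
  have hfin : (Function.support f).Finite := S.finite_toSet.subset hf
  rw [pair_eq_sum (S := S)]
  · exact Finset.sum_congr rfl fun k _ => by rw [toCovec_apply hfin]
  · intro k hk
    rw [Finsupp.mem_support_iff, toCovec_apply hfin] at hk
    exact hf hk

lemma dirFun_const (X : ι → ℂ) (c : ℂ) (u : ι → ℂ) : dirFun X (fun _ => c) u = 0 :=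
  (hasDerivAt_const (0 : ℂ) c).deriv

lemma dirFun_congr {M : Set (ι → ℂ)} (hM : FinitelyOpen M) {f g : (ι → ℂ) → ℂ}
    (h : ∀ u ∈ M, f u = g u) {u : ι → ℂ} (hu : u ∈ M) (X : ι → ℂ) :
    dirFun X f u = dirFun X g u := by
  refine Filter.EventuallyEq.deriv_eq ?_
  filter_upwards [hM.eventually hu X] with t ht
  exact h _ ht

lemma dirForm_const (X : ι → ℂ) (a : ι →₀ ℂ) (u : ι → ℂ) : dirForm X (fun _ => a) u = 0 := by
  have h : dirForm X (fun _ => a) u = toCovec fun _ => 0 := by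
    simp only [dirForm, dirFun_const]
  rw [h]
  ext k
  rw [toCovec_apply (by simp)]; rfl

/-- The pairing of a directional derivative with a constant vector. -/
lemma pair_dirForm {M : Set (ι → ℂ)} (hM : FinitelyOpen M) {β : (ι → ℂ) → (ι →₀ ℂ)}
    (hβ : RegForm M β) {u : ι → ℂ} (hu : u ∈ M) (X Y : ι → ℂ) :
    pair (dirForm X β u) Y = dirFun X (fun w => pair (β w) Y) u := by
  obtain ⟨⟨S, hS⟩, hc⟩ := hβ
  have h0 : ∀ k ∉ S, dirFun X (fun w => β w k) u = 0 := by
    intro k hk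
    rw [dirFun_congr hM (g := fun _ => 0) _ hu, dirFun_const]
    intro w hw
    exact Finsupp.notMem_support_iff.mp fun h => hk (hS w hw h)
  rw [dirForm, pair_toCovec h0, dirFun_congr hM (fun w hw => pair_eq_sum (β w) Y (hS w hw)) hu]
  symm
  refine HasDerivAt.deriv (HasDerivAt.fun_sum fun k _ => ?_)
  exact HasDerivAt.mul_const ((hc k).hasLineDerivAt hM hu X) _

lemma pair_dirFun {M : Set (ι → ℂ)} (hM : FinitelyOpen M) {Y : (ι → ℂ) → (ι → ℂ)}
    (hY : RegVec M Y) {u : ι → ℂ} (hu : u ∈ M) (X : ι → ℂ) (a : ι →₀ ℂ) :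
    pair a (fun k => dirFun X (fun w => Y w k) u) = dirFun X (fun w => pair a (Y w)) u := by
  simp only [pair_eq_sum a _ subset_rfl]
  symm
  refine HasDerivAt.deriv (HasDerivAt.fun_sum fun k _ => ?_)
  exact HasDerivAt.const_mul _ ((hY k).hasLineDerivAt hM hu X)

lemma pair_nablaVec {M : Set (ι → ℂ)} (hM : FinitelyOpen M) (F : FrobeniusData ι) (G : Conn ι)
    {Y : (ι → ℂ) → (ι → ℂ)} (hY : RegVec M Y) {u : ι → ℂ} (hu : u ∈ M) (a c : ι →₀ ℂ) :
    pair c (nablaVec F G a Y u)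
      = dirFun (F.sharp u a) (fun w => pair c (Y w)) u - pair (G u a c) (Y u) := by
  have e : nablaVec F G a Y u = (fun k => dirFun (F.sharp u a) (fun w => Y w k) u)
      - fun k => pair (G u a (Finsupp.single k 1)) (Y u) := rfl
  rw [e, pair_sub_right, pair_dirFun hM hY hu]
  congr 1
  have h : ∀ k : ι, pair (G u a (Finsupp.single k 1)) (Y u)
      = (Finsupp.linearCombination ℂ (Y u) ∘ₗ G u a) (Finsupp.single k 1) := fun k => pair_eq _ _
  rw [pair_eq (G u a c)]
  change _ = (Finsupp.linearCombination ℂ (Y u) ∘ₗ G u a) c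
  conv_rhs => rw [← Finsupp.sum_single c, Finsupp.sum, map_sum]
  rw [pair_eq_sum c _ subset_rfl]
  refine Finset.sum_congr rfl fun k _ => ?_
  rw [h, ← smul_eq_mul, ← map_smul, Finsupp.smul_single_one]

namespace LaurentSpace

variable {L : LaurentSpace ι}

lemma circ_eq (w : ι → ℂ) (a b : Laurent) :
    L.circ w a b = (L.point w).circW L.s (L.lamp w) a b := MarkedPoint.circ_eq _ _ _ _ _

lemma sharp_eq (w : ι → ℂ) (a : Laurent) :
    L.sharp w a = (L.point w).sharpW L.s (L.lamp w) a := MarkedPoint.sharp_eq _ _ _ _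

lemma tr_add (u : ι → ℂ) (f g : Laurent) : L.tr u (f + g) = L.tr u f + L.tr u g := by
  simp only [LaurentSpace.tr, ← MarkedPoint.trL_apply, map_add]
lemma tr_sub (u : ι → ℂ) (f g : Laurent) : L.tr u (f - g) = L.tr u f - L.tr u g := by
  simp only [LaurentSpace.tr, ← MarkedPoint.trL_apply, map_sub]
lemma tr_smul (u : ι → ℂ) (c : ℂ) (f : Laurent) : L.tr u (c • f) = c * L.tr u f := by
  simp only [LaurentSpace.tr, ← MarkedPoint.trL_apply, map_smul, smul_eq_mul]
lemma tr_zero (u : ι → ℂ) : L.tr u 0 = 0 := by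
  simp only [LaurentSpace.tr, ← MarkedPoint.trL_apply, map_zero]

lemma rep_add {u : ι → ℂ} {a b : ι →₀ ℂ} {α β : Laurent} (ha : L.Represents u a α)
    (hb : L.Represents u b β) : L.Represents u (a + b) (α + β) := fun X => by
  rw [pair_add_left, ha, hb, mul_add, tr_add]
lemma rep_sub {u : ι → ℂ} {a b : ι →₀ ℂ} {α β : Laurent} (ha : L.Represents u a α)
    (hb : L.Represents u b β) : L.Represents u (a - b) (α - β) := fun X => by
  rw [pair_sub_left, ha, hb, mul_sub, tr_sub]
lemma rep_smul {u : ι → ℂ} {a : ι →₀ ℂ} {α : Laurent} (c : ℂ) (ha : L.Represents u a α) :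
    L.Represents u (c • a) (c • α) := fun X => by
  rw [pair_smul_left, ha, mul_smul_comm, tr_smul]
lemma rep_unique {u : ι → ℂ} {a b : ι →₀ ℂ} {α : Laurent} (ha : L.Represents u a α)
    (hb : L.Represents u b α) : a = b := covec_ext fun X => by rw [ha, hb]
lemma rep_zero {u : ι → ℂ} {a : ι →₀ ℂ} (ha : L.Represents u a 0) : a = 0 :=
  covec_ext fun X => by rw [ha, mul_zero, tr_zero, pair_zero_left]

lemma tr_single_eq_zero [DecidableEq ι] {u : ι → ℂ} {α : Laurent} {S : Finset ι}
    (hS : ∀ X, L.tr u (L.dlam u X * α)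
      = ∑ k ∈ S, X k * L.tr u (L.dlam u (Pi.single k 1) * α)) (k : ι) (hk : k ∉ S) :
    L.tr u (L.dlam u (Pi.single k 1) * α) = 0 := by
  rw [hS]
  refine Finset.sum_eq_zero fun i hi => ?_
  rw [Pi.single_eq_of_ne (by rintro rfl; exact hk hi), zero_mul]

/-- The operator `♯` on Laurent series. -/
def sharpLin (L : LaurentSpace ι) (u : ι → ℂ) : Laurent →ₗ[ℂ] Laurent where
  toFun := L.sharp u
  map_add' a b := by
    simp only [sharp_eq, MarkedPoint.sharpW, mul_add, map_add]; ring
  map_smul' c a := by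
    simp only [sharp_eq, MarkedPoint.sharpW, smul_eq_C_mul, mul_left_comm (L.lamp u),
      MarkedPoint.P_C_mul, RingHom.id_apply]
    ring

/-- The multiplication `∘` on Laurent series. -/
def circLin (L : LaurentSpace ι) (u : ι → ℂ) : Laurent →ₗ[ℂ] Laurent →ₗ[ℂ] Laurent :=
  LinearMap.mk₂ ℂ (L.circ u)
    (fun a b c => by
      simp only [circ_eq, MarkedPoint.circW, mul_add, add_mul, map_add]; ring)
    (fun c a b => by
      simp only [circ_eq, MarkedPoint.circW, smul_eq_C_mul,
        mul_left_comm (L.lamp u) (HahnSeries.C c), MarkedPoint.P_C_mul]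
      ring)
    (fun a b c => by
      simp only [circ_eq, MarkedPoint.circW, mul_add, map_add]; ring)
    (fun c a b => by
      simp only [circ_eq, MarkedPoint.circW, smul_eq_C_mul,
        mul_left_comm (L.lamp u) (HahnSeries.C c), MarkedPoint.P_C_mul]
      ring)

lemma circLin_apply (u : ι → ℂ) (a b : Laurent) : L.circLin u a b = L.circ u a b := rfl

end LaurentSpace

/-! ## Charts of spaces of Laurent series -/

/-- Properties of a space of Laurent series which make it a Frobenius manifold. The orthogonal
complement of the tangent spaces is the constant subspace `I`; `sec` chooses representatives of
covectors; `vec` computes the coordinates of tangent vectors. The Euler vector field is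
`λ - c p λ_p`, and the unit vector field `1 - f λ_p`. -/
structure LaurentChart [DecidableEq ι] (L : LaurentSpace ι) where
  ν : MarkedPoint
  j : Option ι
  -- In terms of coefficients the projection, the derivative and the residue do not depend on the
  -- point of the chart; only the series p does.
  kind : ∀ w, (L.point w).P = ν.P ∧ (L.point w).d = ν.d ∧ (L.point w).res = ν.res
  hs : L.s = 0 ∨ L.s = 1
  dom_open : FinitelyOpen L.dom
  reg_p : RegL L.dom fun w => (L.point w).p
  hasD_p : ∀ u ∈ L.dom, ∀ X, HasD ν (vel j X) (fun w => (L.point w).p) 0 u X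
  reg_inv : RegL L.dom fun w => ((L.point w).p ^ L.s)⁻¹
  reg_lam : RegL L.dom L.lam
  hasD_lam : ∀ u ∈ L.dom, ∀ X, HasD ν (vel j X) L.lam (L.dlam u X) u X
  dlam_add : ∀ u X Y, L.dlam u (X + Y) = L.dlam u X + L.dlam u Y
  -- The finite set depends only on the order bound, not on u; this gives one-forms with smooth
  -- representatives a common finite support.
  fin : ∀ N, ∃ S : Finset ι, ∀ u, ∀ f ∈ ordGe N, ∀ X, ν.res (L.dlam u X * f)
    = ∑ k ∈ S, X k * ν.res (L.dlam u (Pi.single k 1) * f)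
  sec : (ι → ℂ) → (ι →₀ ℂ) →ₗ[ℂ] Laurent
  reg_sec : ∀ a, RegL L.dom fun w => sec w a
  sec_rep : ∀ u ∈ L.dom, ∀ a, L.Represents u a (sec u a)
  vec : (ι → ℂ) → Laurent →ₗ[ℂ] (ι → ℂ)
  reg_vec : ∀ y, RegL L.dom y → RegVec L.dom fun u => vec u (y u)
  dlam_sharp : ∀ u ∈ L.dom, ∀ α, L.dlam u (vec u (L.sharp u α)) = L.sharp u α
  I : Submodule ℂ Laurent
  perp : ∀ u ∈ L.dom, ∀ α, (∀ X, L.tr u (L.dlam u X * α) = 0) ↔ α ∈ I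
  -- The covariant derivative along α♯ does not depend on the representative of α.
  star_mem : ∀ u ∈ L.dom, ∀ κ ∈ I, ∀ g, (L.point u).star κ ((L.point u).D L.s g) ∈ I
  -- The covariant derivative maps annihilating series to annihilating series: a κ with constant
  -- coefficients has derivative minus the velocity times ∂κ/∂p at fixed p.
  conn_mem : ∀ u ∈ L.dom, ∀ κ ∈ I, ∀ α, (L.point u).star α ((L.point u).D L.s κ)
    - vel j (vec u (L.sharp u α)) • ν.d κ ∈ I
  circ_mem : ∀ u ∈ L.dom, ∀ κ ∈ I, ∀ β, L.circ u κ β ∈ I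
  c : ℂ
  E : (ι → ℂ) → (ι → ℂ)
  reg_E : RegVec L.dom E
  dlam_E : ∀ u ∈ L.dom, L.dlam u (E u) = L.lam u - c • ((L.point u).p * L.lamp u)
  kappa_mem : ∀ u ∈ L.dom, ∀ κ ∈ I,
    (L.point u).kappa L.s c κ - vel j (E u) • ν.d κ ∈ I
  e : (ι → ℂ) → (ι → ℂ)
  reg_e : RegVec L.dom e
  f : (ι → ℂ) → ℂ
  reg_f : RegFun L.dom f
  dlam_e : ∀ u ∈ L.dom, L.dlam u (e u) = 1 - f u • L.lamp u

namespace LaurentChart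

variable [DecidableEq ι] {L : LaurentSpace ι} (C : LaurentChart L)

open LaurentSpace

include C

lemma P_eq (w : ι → ℂ) : (L.point w).P = C.ν.P := (C.kind w).1
lemma d_eq (w : ι → ℂ) : (L.point w).d = C.ν.d := (C.kind w).2.1
lemma res_eq (w : ι → ℂ) : (L.point w).res = C.ν.res := (C.kind w).2.2
lemma Q_eq (w : ι → ℂ) : (L.point w).Q = C.ν.Q := by
  rw [MarkedPoint.Q, MarkedPoint.Q, C.P_eq]
lemma star_eq (w : ι → ℂ) (a b : Laurent) : (L.point w).star a b = C.ν.star a b := by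
  rw [MarkedPoint.star, MarkedPoint.star, C.P_eq, C.Q_eq]
lemma lamp_eq (w : ι → ℂ) : L.lamp w = C.ν.d (L.lam w) := by
  rw [← C.d_eq w]; rfl

/-- The derivative at fixed `p` along `X` in a chart. -/
def DX (X : ι → ℂ) (φ : (ι → ℂ) → Laurent) (u : ι → ℂ) : Laurent := DL C.ν (vel C.j X) X φ u

/-- `ψ` is the derivative at fixed `p` along `X` of the family `φ` in a chart. -/
abbrev HD (φ : (ι → ℂ) → Laurent) (ψ : Laurent) (u X : ι → ℂ) : Prop :=
  HasD C.ν (vel C.j X) φ ψ u X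

section Families

variable {φ φ₁ φ₂ : (ι → ℂ) → Laurent} {ψ ψ₁ ψ₂ : Laurent} {u X : ι → ℂ}

lemma hd (h : RegL L.dom φ) (hu : u ∈ L.dom) (X : ι → ℂ) : C.HD φ (C.DX X φ u) u X :=
  h.hasD C.dom_open _ _ hu X

lemma reg_DX (h : RegL L.dom φ) {Y : (ι → ℂ) → (ι → ℂ)} (hY : RegVec L.dom Y) :
    RegL L.dom fun w => C.DX (Y w) φ w :=
  h.DL C.dom_open _ hY (hY.vel _)

lemma reg_pow : RegL L.dom fun w => (L.point w).p ^ L.s := C.reg_p.pow _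

lemma reg_star (h₁ : RegL L.dom φ₁) (h₂ : RegL L.dom φ₂) :
    RegL L.dom fun w => (L.point w).star (φ₁ w) (φ₂ w) :=
  (h₁.star C.ν h₂).congr fun w _ => C.star_eq w _ _

lemma reg_D (h : RegL L.dom φ) : RegL L.dom fun w => (L.point w).D L.s (φ w) :=
  (C.reg_pow.mul (h.d C.ν)).congr fun w _ => by rw [MarkedPoint.D_apply, C.d_eq]

lemma reg_lamp : RegL L.dom L.lamp := (C.reg_lam.d C.ν).congr fun w _ => C.lamp_eq w

lemma reg_tr (h : RegL L.dom φ) : RegFun L.dom fun w => L.tr w (φ w) :=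
  ((C.reg_inv.mul h).res C.ν).congr fun w _ => by
    rw [LaurentSpace.tr, MarkedPoint.tr_eq, C.res_eq]

lemma reg_circ (h₁ : RegL L.dom φ₁) (h₂ : RegL L.dom φ₂) :
    RegL L.dom fun w => L.circ w (φ₁ w) (φ₂ w) :=
  (C.reg_pow.mul (((((C.reg_lamp.mul h₁).P C.ν).mul h₂).add
    (h₁.mul ((C.reg_lamp.mul h₂).P C.ν))).sub ((C.reg_lamp.mul h₁).mul h₂))).congr fun w _ => by
      rw [LaurentSpace.circ_eq, MarkedPoint.circW, C.P_eq]

lemma reg_sharpL (h : RegL L.dom φ) : RegL L.dom fun w => L.sharp w (φ w) :=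
  (C.reg_pow.mul (((C.reg_lamp.mul h).P C.ν).sub (C.reg_lamp.mul (h.P C.ν)))).congr fun w _ => by
    rw [LaurentSpace.sharp_eq, MarkedPoint.sharpW, C.P_eq]

lemma reg_dlam (X : ι → ℂ) : RegL L.dom fun w => L.dlam w X :=
  (C.reg_DX C.reg_lam (Y := fun _ => X) fun _ => RegFun.const _ _).congr fun w hw =>
    (C.hasD_lam w hw X).unique (C.hd C.reg_lam hw X)

lemma hd_pow (hu : u ∈ L.dom) (X : ι → ℂ) : C.HD (fun w => (L.point w).p ^ L.s) 0 u X :=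
  (C.hasD_p u hu X).pow_zero_deriv _

/-- Differentiate p^s · p^{-s} = 1 by the product rule. -/
lemma hd_inv (hu : u ∈ L.dom) (X : ι → ℂ) : C.HD (fun w => ((L.point w).p ^ L.s)⁻¹) 0 u X := by
  have h := C.hd C.reg_inv hu X
  have h2 := (C.hd_pow hu X).mul h
  have h3 : C.HD (fun w => (L.point w).p ^ L.s * ((L.point w).p ^ L.s)⁻¹) 0 u X := by
    have : (fun w => (L.point w).p ^ L.s * ((L.point w).p ^ L.s)⁻¹) = fun _ => 1 := by
      funext w
      exact mul_inv_cancel₀ ((L.point w).pow_ne _)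
    rw [this]
    simpa [MarkedPoint.d_one] using
      (HasD.const 1 : HasD C.ν (vel C.j X) (fun _ : ι → ℂ => (1 : Laurent)) _ u X)
  have h4 := h2.unique h3
  rw [zero_mul, zero_add] at h4
  rwa [(mul_eq_zero.mp h4).resolve_left ((L.point u).pow_ne _)] at h

lemma hd_star (h₁ : C.HD φ₁ ψ₁ u X) (h₂ : C.HD φ₂ ψ₂ u X) :
    C.HD (fun w => (L.point w).star (φ₁ w) (φ₂ w))
      ((L.point u).star ψ₁ (φ₂ u) + (L.point u).star (φ₁ u) ψ₂) u X := by
  simp only [C.star_eq]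
  exact h₁.star h₂

lemma hd_D (hu : u ∈ L.dom) (h : C.HD φ ψ u X) :
    C.HD (fun w => (L.point w).D L.s (φ w)) ((L.point u).D L.s ψ) u X := by
  have := (C.hd_pow hu X).mul h.d
  simp only [MarkedPoint.D_apply, C.d_eq]
  simpa only [zero_mul, zero_add] using this

lemma hd_lamp (hu : u ∈ L.dom) (X : ι → ℂ) :
    C.HD L.lamp ((L.point u).d (L.dlam u X)) u X := by
  rw [C.d_eq, show L.lamp = fun w => C.ν.d (L.lam w) from funext C.lamp_eq]
  exact (C.hasD_lam u hu X).d

lemma hd_tr (hu : u ∈ L.dom) (h : C.HD φ ψ u X) :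
    HasLineDerivAt ℂ (fun w => L.tr w (φ w)) (L.tr u ψ) u X := by
  have h2 := ((C.hd_inv hu X).mul h).res
  rw [zero_mul, zero_add] at h2
  simp only [LaurentSpace.tr, MarkedPoint.tr_eq, C.res_eq]
  exact h2

lemma hd_circ (hu : u ∈ L.dom) (h₁ : C.HD φ₁ ψ₁ u X) (h₂ : C.HD φ₂ ψ₂ u X) :
    C.HD (fun w => L.circ w (φ₁ w) (φ₂ w))
      ((L.point u).circW L.s ((L.point u).d (L.dlam u X)) (φ₁ u) (φ₂ u)
        + L.circ u ψ₁ (φ₂ u) + L.circ u (φ₁ u) ψ₂) u X := by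
  have hl := C.hd_lamp hu X
  have h := (C.hd_pow hu X).mul
    ((((hl.mul h₁).P.mul h₂).add (h₁.mul (hl.mul h₂).P)).sub ((hl.mul h₁).mul h₂))
  simp only [LaurentSpace.circ_eq, MarkedPoint.circW, C.P_eq] at h ⊢
  convert h using 1
  simp only [map_add]
  ring

end Families

/-! ### Representatives of covectors -/

lemma rep_sub_mem {u : ι → ℂ} (hu : u ∈ L.dom) {a : ι →₀ ℂ} {α β : Laurent}
    (ha : L.Represents u a α) (hb : L.Represents u a β) : α - β ∈ C.I := by
  rw [← C.perp u hu]
  intro X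
  rw [mul_sub, tr_sub, ← ha, ← hb, sub_self]

lemma rep_of_sub_mem {u : ι → ℂ} (hu : u ∈ L.dom) {a : ι →₀ ℂ} {α β : Laurent}
    (ha : L.Represents u a α) (h : β - α ∈ C.I) : L.Represents u a β := by
  intro X
  have := (C.perp u hu _).mpr h X
  rw [mul_sub, tr_sub, sub_eq_zero] at this
  rw [this, ha]

lemma exists_finset (u : ι → ℂ) (α : Laurent) : ∃ S : Finset ι, ∀ X, L.tr u (L.dlam u X * α)
    = ∑ k ∈ S, X k * L.tr u (L.dlam u (Pi.single k 1) * α) := by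
  obtain ⟨N, hN⟩ := exists_ordGe (((L.point u).p ^ L.s)⁻¹ * α)
  obtain ⟨S, hS⟩ := C.fin N
  refine ⟨S, fun X => ?_⟩
  have e : ∀ X, L.tr u (L.dlam u X * α)
      = C.ν.res (L.dlam u X * (((L.point u).p ^ L.s)⁻¹ * α)) := by
    intro X
    rw [LaurentSpace.tr, MarkedPoint.tr_eq, C.res_eq]
    congr 1; ring
  simp only [e]
  exact hS u _ hN X

lemma support_finite (u : ι → ℂ) (α : Laurent) :
    (Function.support fun k => L.tr u (L.dlam u (Pi.single k 1) * α)).Finite := by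
  obtain ⟨S, hS⟩ := C.exists_finset u α
  refine S.finite_toSet.subset fun k hk => ?_
  by_contra h
  exact hk (tr_single_eq_zero hS k h)

/-- The covector represented by a Laurent series. -/
def cov (u : ι → ℂ) : Laurent →ₗ[ℂ] (ι →₀ ℂ) where
  toFun α := toCovec fun k => L.tr u (L.dlam u (Pi.single k 1) * α)
  map_add' α β := by
    ext k
    rw [Finsupp.add_apply, toCovec_apply (C.support_finite u _),
      toCovec_apply (C.support_finite u _), toCovec_apply (C.support_finite u _), mul_add, tr_add]
  map_smul' c α := by
    ext k
    rw [RingHom.id_apply, Finsupp.smul_apply, toCovec_apply (C.support_finite u _),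
      toCovec_apply (C.support_finite u _), mul_smul_comm, tr_smul, smul_eq_mul]

lemma cov_apply (u : ι → ℂ) (α : Laurent) (k : ι) :
    C.cov u α k = L.tr u (L.dlam u (Pi.single k 1) * α) := toCovec_apply (C.support_finite u α) k

lemma rep_cov (u : ι → ℂ) (α : Laurent) : L.Represents u (C.cov u α) α := by
  intro X
  obtain ⟨S, hS⟩ := C.exists_finset u α
  rw [hS]
  change pair (toCovec _) X = _
  rw [pair_toCovec (tr_single_eq_zero hS)]
  exact Finset.sum_congr rfl fun k _ => mul_comm _ _

/-- One-forms with smooth representatives are smooth. -/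
lemma regForm_of_rep {β : (ι → ℂ) → (ι →₀ ℂ)} {B : (ι → ℂ) → Laurent} (hB : RegL L.dom B)
    (h : ∀ w ∈ L.dom, L.Represents w (β w) (B w)) : RegForm L.dom β := by
  have hβ : ∀ w ∈ L.dom, β w = C.cov w (B w) := fun w hw => rep_unique (h w hw) (C.rep_cov w _)
  constructor
  · obtain ⟨⟨N, hN⟩, -⟩ := C.reg_inv.mul hB
    obtain ⟨S, hS⟩ := C.fin N
    refine ⟨S, fun w hw k hk => ?_⟩
    by_contra hkS
    rw [Finsupp.mem_support_iff, hβ w hw, C.cov_apply] at hk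
    refine hk (tr_single_eq_zero (fun X => ?_) k hkS)
    have e : ∀ X, L.tr w (L.dlam w X * B w)
        = C.ν.res (L.dlam w X * (((L.point w).p ^ L.s)⁻¹ * B w)) := by
      intro X
      rw [LaurentSpace.tr, MarkedPoint.tr_eq, C.res_eq]
      congr 1; ring
    simp only [e]
    exact hS w _ (hN w hw) X
  · intro k
    refine (C.reg_tr ((C.reg_dlam (Pi.single k 1)).mul hB)).congr fun w hw => ?_
    rw [hβ w hw, C.cov_apply]

/-! ### The tensors and the connection -/

/-- The tensors of the Frobenius manifold. -/
def frob : FrobeniusData ι where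
  sharp u := C.vec u ∘ₗ L.sharpLin u ∘ₗ C.sec u
  mul u := ((L.circLin u).compl₁₂ (C.sec u) (C.sec u)).compr₂ (C.cov u)
  e := C.e
  E := C.E
  d := 1 + (L.s - 1) * (2 * C.c)

lemma frob_sharp (u : ι → ℂ) (a : ι →₀ ℂ) :
    C.frob.sharp u a = C.vec u (L.sharp u (C.sec u a)) := rfl
lemma frob_mul (u : ι → ℂ) (a b : ι →₀ ℂ) :
    C.frob.mul u a b = C.cov u (L.circ u (C.sec u a) (C.sec u b)) := rfl

lemma reg_sharp (a : ι →₀ ℂ) : RegVec L.dom fun w => C.frob.sharp w a :=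
  C.reg_vec _ (C.reg_sharpL (C.reg_sec a))

/-- The Laurent series which represents `∇_{a♯} b`, for one-forms `a`, `b` with constant
components. -/
def connL (u : ι → ℂ) (a b : ι →₀ ℂ) : Laurent :=
  C.DX (C.frob.sharp u a) (fun w => C.sec w b) u
    + (L.point u).star (C.sec u a) ((L.point u).D L.s (C.sec u b))

lemma hd_sec {u : ι → ℂ} (hu : u ∈ L.dom) (a : ι →₀ ℂ) (X : ι → ℂ) :
    C.HD (fun w => C.sec w a) (C.DX X (fun w => C.sec w a) u) u X := C.hd (C.reg_sec a) hu X

lemma DX_add_dir {φ : (ι → ℂ) → Laurent} (h : RegL L.dom φ) {u : ι → ℂ} (hu : u ∈ L.dom)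
    (X Y : ι → ℂ) : C.DX (X + Y) φ u = C.DX X φ u + C.DX Y φ u := by
  rw [DX, map_add, h.DL_add C.dom_open _ hu]; rfl

lemma DX_smul_dir {φ : (ι → ℂ) → Laurent} (h : RegL L.dom φ) {u : ι → ℂ} (hu : u ∈ L.dom)
    (r : ℂ) (X : ι → ℂ) : C.DX (r • X) φ u = r • C.DX X φ u := by
  rw [DX, map_smul, smul_eq_mul, h.DL_smul C.dom_open _ hu]; rfl

/-- The Levi-Civita connection. -/
def conn : Conn ι := by
  classical
  -- Linearity in the direction holds only where the sections are known to be smooth, so the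
  -- connection is extended by zero outside the domain.
  exact fun u => if hu : u ∈ L.dom then
    LinearMap.mk₂ ℂ (fun a b => C.cov u (C.connL u a b))
    (fun a b c => by
      rw [← map_add]
      congr 1
      simp only [connL, map_add]
      rw [C.DX_add_dir (C.reg_sec c) hu, MarkedPoint.star_add_left]
      abel)
    (fun r a b => by
      rw [← map_smul]
      congr 1
      simp only [connL, map_smul]
      rw [C.DX_smul_dir (C.reg_sec b) hu, MarkedPoint.star_smul_left, smul_add])
    (fun a b c => by
      have h := (C.hd_sec hu b (C.frob.sharp u a)).add (C.hd_sec hu c (C.frob.sharp u a))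
      simp only [← map_add] at h
      rw [← map_add]
      congr 1
      simp only [connL]
      rw [(C.hd_sec hu (b + c) _).unique h, map_add, map_add, MarkedPoint.star_add_right]
      abel)
    (fun r a b => by
      have h := (C.hd_sec hu b (C.frob.sharp u a)).smul r
      simp only [← map_smul] at h
      rw [← map_smul]
      congr 1
      simp only [connL]
      rw [(C.hd_sec hu (r • b) _).unique h, map_smul, map_smul, MarkedPoint.star_smul_right,
        smul_add])
  else 0

lemma rep_conn {u : ι → ℂ} (hu : u ∈ L.dom) (a b : ι →₀ ℂ) :
    L.Represents u (C.conn u a b) (C.connL u a b) := by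
  rw [conn, dif_pos hu]
  exact C.rep_cov u _

end LaurentChart
end FrobLaurent

/-! ### The metric on representatives and covariant derivatives of one-forms -/

namespace FrobLaurent

variable {ι : Type}

lemma nabla_const (F : FrobeniusData ι) (G : Conn ι) (a b : ι →₀ ℂ) (u : ι → ℂ) :
    nabla F G (fun _ => a) (fun _ => b) u = G u a b := by
  rw [nabla, dirForm_const, zero_add]

lemma hasLineDerivAt_congr {M : Set (ι → ℂ)} (hM : FinitelyOpen M) {f g : (ι → ℂ) → ℂ}
    (h : ∀ u ∈ M, g u = f u) {u X : ι → ℂ} (hu : u ∈ M) {c : ℂ}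
    (hf : HasLineDerivAt ℂ f c u X) : HasLineDerivAt ℂ g c u X := by
  refine HasDerivAt.congr_of_eventuallyEq hf ?_
  filter_upwards [hM.eventually hu X] with t ht
  exact h _ ht

namespace LaurentSpace

variable {L : LaurentSpace ι}

/-- The contravariant metric on Laurent series. -/
def met (L : LaurentSpace ι) (u : ι → ℂ) (a b : Laurent) : ℂ :=
  -(L.point u).res (L.lamp u * (L.point u).star a b)

lemma tr_mul_sharp (u : ι → ℂ) (a c : Laurent) : L.tr u (c * L.sharp u a) = L.met u a c := by
  rw [sharp_eq, LaurentSpace.tr, MarkedPoint.tr_mul_sharpW, met]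
lemma tr_circ (u : ι → ℂ) (a b : Laurent) : L.tr u (L.circ u a b) = L.met u a b := by
  rw [circ_eq, LaurentSpace.tr, MarkedPoint.tr_circW, met]
lemma met_comm (u : ι → ℂ) (a b : Laurent) : L.met u a b = L.met u b a := by
  rw [met, met, MarkedPoint.star_comm]
lemma met_add_left (u : ι → ℂ) (a b c : Laurent) :
    L.met u (a + b) c = L.met u a c + L.met u b c := by
  simp only [met, MarkedPoint.star_add_left, mul_add, map_add]; ring
lemma met_sub_left (u : ι → ℂ) (a b c : Laurent) :
    L.met u (a - b) c = L.met u a c - L.met u b c := by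
  simp only [met, MarkedPoint.star_sub_left, mul_sub, map_sub]; ring
lemma met_add_right (u : ι → ℂ) (a b c : Laurent) :
    L.met u a (b + c) = L.met u a b + L.met u a c := by
  rw [met_comm, met_add_left, met_comm u b, met_comm u c]
lemma met_star (u : ι → ℂ) (a b c : Laurent) :
    L.met u ((L.point u).star a b) c = L.met u a ((L.point u).star b c) := by
  rw [met, met, MarkedPoint.star_assoc]
lemma met_star_left (u : ι → ℂ) (a b c : Laurent) :
    L.met u a ((L.point u).star b c) = L.met u b ((L.point u).star a c) := by
  rw [← met_star, ← met_star, MarkedPoint.star_comm _ a]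
lemma met_circ (hs : L.s = 0 ∨ L.s = 1) (u : ι → ℂ) (a b c : Laurent) :
    L.met u (L.circ u a b) c = L.met u a (L.circ u b c) := by
  rw [← tr_circ, ← tr_circ]
  simp only [circ_eq]
  rw [MarkedPoint.circW_assoc _ hs]

lemma circ_comm (u : ι → ℂ) (a b : Laurent) : L.circ u a b = L.circ u b a := by
  simp only [circ_eq, MarkedPoint.circW_comm _ _ a]

lemma eq_zero_of_tr (u : ι → ℂ) (f : Laurent) (h : ∀ g, L.tr u (g * f) = 0) : f = 0 := by
  refine (L.point u).eq_zero_of_res f fun g => ?_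
  have := h ((L.point u).p ^ L.s * g)
  rwa [LaurentSpace.tr, mul_assoc, MarkedPoint.tr_mul] at this

end LaurentSpace

namespace LaurentChart

variable [DecidableEq ι] {L : LaurentSpace ι} (C : LaurentChart L)

open LaurentSpace

include C

/-- By symmetry of the metric, pairing κ♯ with g is pairing the tangent vector g♯ with κ, which
vanishes. Nondegeneracy of the residue pairing finishes. -/
lemma sharp_of_mem {u : ι → ℂ} (hu : u ∈ L.dom) {κ : Laurent} (hκ : κ ∈ C.I) :
    L.sharp u κ = 0 := by
  refine eq_zero_of_tr (L := L) u _ fun g => ?_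
  rw [tr_mul_sharp, met_comm, ← tr_mul_sharp, mul_comm, ← C.dlam_sharp u hu]
  exact (C.perp u hu κ).mpr hκ _

lemma sharp_eq_of_sub_mem {u : ι → ℂ} (hu : u ∈ L.dom) {α β : Laurent} (h : α - β ∈ C.I) :
    L.sharp u α = L.sharp u β := by
  have := C.sharp_of_mem hu h
  change L.sharpLin u (α - β) = 0 at this
  rw [map_sub, sub_eq_zero] at this
  exact this

lemma sharp_of_rep {u : ι → ℂ} (hu : u ∈ L.dom) {a : ι →₀ ℂ} {α : Laurent}
    (ha : L.Represents u a α) : C.frob.sharp u a = C.vec u (L.sharp u α) := by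
  rw [frob_sharp, C.sharp_eq_of_sub_mem hu (C.rep_sub_mem hu (C.sec_rep u hu a) ha)]

lemma dlam_frob_sharp {u : ι → ℂ} (hu : u ∈ L.dom) {a : ι →₀ ℂ} {α : Laurent}
    (ha : L.Represents u a α) : L.dlam u (C.frob.sharp u a) = L.sharp u α := by
  rw [C.sharp_of_rep hu ha, C.dlam_sharp u hu]

lemma pair_sharp {u : ι → ℂ} (hu : u ∈ L.dom) {a b : ι →₀ ℂ} {α β : Laurent}
    (ha : L.Represents u a α) (hb : L.Represents u b β) :
    pair b (C.frob.sharp u a) = L.met u α β := by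
  rw [hb, C.dlam_frob_sharp hu ha, mul_comm, tr_mul_sharp]

lemma eta_eq {u : ι → ℂ} (hu : u ∈ L.dom) {a b : ι →₀ ℂ} {α β : Laurent}
    (ha : L.Represents u a α) (hb : L.Represents u b β) :
    eta C.frob u a b = L.met u α β := C.pair_sharp hu ha hb

lemma rep_mul {u : ι → ℂ} (hu : u ∈ L.dom) {a b : ι →₀ ℂ} {α β : Laurent}
    (ha : L.Represents u a α) (hb : L.Represents u b β) :
    L.Represents u (C.frob.mul u a b) (L.circ u α β) := by
  refine C.rep_of_sub_mem hu (C.rep_cov u _) ?_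
  have h1 := C.circ_mem u hu _ (C.rep_sub_mem hu ha (C.sec_rep u hu a)) β
  have h2 := C.circ_mem u hu _ (C.rep_sub_mem hu hb (C.sec_rep u hu b)) (C.sec u a)
  rw [← circLin_apply] at h1 h2
  rw [map_sub, LinearMap.sub_apply, circLin_apply, circLin_apply] at h1 h2
  rw [circ_comm u β, circ_comm u (C.sec u b)] at h2
  have h3 := C.I.add_mem h1 h2
  rwa [sub_add_sub_cancel] at h3

lemma reg_mul (a b : ι →₀ ℂ) : RegForm L.dom fun u => C.frob.mul u a b :=
  C.regForm_of_rep (C.reg_circ (C.reg_sec a) (C.reg_sec b)) fun _ _ => C.rep_cov _ _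

lemma reg_connL (a b : ι →₀ ℂ) : RegL L.dom fun u => C.connL u a b :=
  (C.reg_DX (C.reg_sec b) (C.reg_sharp a)).add
    (C.reg_star (C.reg_sec a) (C.reg_D (C.reg_sec b)))

lemma reg_conn (a b : ι →₀ ℂ) : RegForm L.dom fun u => C.conn u a b :=
  C.regForm_of_rep (C.reg_connL a b) fun _ hu => C.rep_conn hu a b

/-- The derivative of the metric. -/
lemma hd_met {u : ι → ℂ} (hu : u ∈ L.dom) {a : ι →₀ ℂ} {α : Laurent} (ha : L.Represents u a α)
    {φ₁ φ₂ : (ι → ℂ) → Laurent} {ψ₁ ψ₂ : Laurent} (h₁ : C.HD φ₁ ψ₁ u (C.frob.sharp u a))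
    (h₂ : C.HD φ₂ ψ₂ u (C.frob.sharp u a)) :
    HasLineDerivAt ℂ (fun w => L.met w (φ₁ w) (φ₂ w))
      (L.met u α ((L.point u).D L.s ((L.point u).star (φ₁ u) (φ₂ u)))
        + L.met u ψ₁ (φ₂ u) + L.met u (φ₁ u) ψ₂) u (C.frob.sharp u a) := by
  have h := ((C.hd_lamp hu (C.frob.sharp u a)).mul (C.hd_star h₁ h₂)).res
  have h' := HasDerivAt.fun_neg h
  -- Along α♯ the variation of λ_p is the derivative of α♯. Integration by parts moves it to D
  -- applied to the difference product, and the pairing with α♯ is again the metric.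
  have e : L.met u α ((L.point u).D L.s ((L.point u).star (φ₁ u) (φ₂ u)))
      + L.met u ψ₁ (φ₂ u) + L.met u (φ₁ u) ψ₂
      = -C.ν.res ((L.point u).d (L.dlam u (C.frob.sharp u a)) * (L.point u).star (φ₁ u) (φ₂ u)
        + L.lamp u * ((L.point u).star ψ₁ (φ₂ u) + (L.point u).star (φ₁ u) ψ₂)) := by
    rw [← tr_mul_sharp, mul_comm, ← C.dlam_frob_sharp hu ha, LaurentSpace.tr,
      MarkedPoint.tr_mul_D]
    simp only [met, C.res_eq, map_add, mul_add]
    ring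
  rw [e]
  simp only [met, C.res_eq]
  exact h'

/-- Second derivatives of `λ` are symmetric. -/
lemma DX_dlam_comm {u : ι → ℂ} (hu : u ∈ L.dom) (X Y : ι → ℂ) :
    C.DX Y (fun w => L.dlam w X) u = C.DX X (fun w => L.dlam w Y) u := by
  have h := C.reg_lam.DL_comm C.dom_open C.ν C.j (X := fun _ => X) (Y := fun _ => Y)
    (fun _ => RegFun.const _ _) (fun _ => RegFun.const _ _) hu (Z := 0)
    (fun k => by simp only [dirFun_const, sub_zero, Pi.zero_apply])
  have e : ∀ X Y, DL C.ν (vel C.j Y) Y (fun w => DL C.ν (vel C.j X) X L.lam w) u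
      = C.DX Y (fun w => L.dlam w X) u := by
    intro X Y
    refine (C.hd (C.reg_DX C.reg_lam (Y := fun _ => X) fun _ => RegFun.const _ _) hu Y).unique
      ((C.hd (C.reg_dlam X) hu Y).congr ((C.hd C.reg_lam hu X).unique (C.hasD_lam u hu X)) ?_)
    filter_upwards [C.dom_open.eventually hu Y] with t ht
    exact (C.hd C.reg_lam ht X).unique (C.hasD_lam _ ht X)
  rw [e, e] at h
  have h0 : DL C.ν (vel C.j 0) 0 L.lam u = 0 := by
    have := C.reg_lam.DL_smul C.dom_open C.ν hu 0 0 (0 : ι → ℂ)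
    rw [zero_smul, zero_mul, laurent_zero_smul] at this
    rw [map_zero, this]
  rw [h0, sub_eq_zero] at h
  exact h.symm

/-- One-forms with constant components are closed. -/
lemma tr_DX_sec {u : ι → ℂ} (hu : u ∈ L.dom) (a : ι →₀ ℂ) (X Y : ι → ℂ) :
    L.tr u (L.dlam u X * C.DX Y (fun w => C.sec w a) u)
      = L.tr u (L.dlam u Y * C.DX X (fun w => C.sec w a) u) := by
  -- The pairing of the one-form with a fixed coordinate vector is constant, so its derivative
  -- vanishes. Symmetry then reduces to that of the second derivatives of λ.
  have key : ∀ X Y, L.tr u (L.dlam u X * C.DX Y (fun w => C.sec w a) u)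
      = -L.tr u (C.DX Y (fun w => L.dlam w X) u * C.sec u a) := by
    intro X Y
    have h1 := C.hd_tr hu ((C.hd (C.reg_dlam X) hu Y).mul (C.hd_sec hu a Y))
    have h2 : HasLineDerivAt ℂ (fun w => L.tr w (L.dlam w X * C.sec w a)) 0 u Y :=
      hasLineDerivAt_congr C.dom_open (f := fun _ => pair a X)
        (fun w hw => (C.sec_rep w hw a X).symm) hu (hasDerivAt_const (0 : ℂ) _)
    have h3 := h1.unique h2
    rw [tr_add] at h3
    linear_combination h3
  rw [key, key, C.DX_dlam_comm hu]

/-- The component-wise derivative of a one-form. -/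
lemma rep_dirForm {u : ι → ℂ} (hu : u ∈ L.dom) (X : ι → ℂ) {β : (ι → ℂ) → (ι →₀ ℂ)}
    {B : (ι → ℂ) → Laurent} (hB : RegL L.dom B) (h : ∀ w ∈ L.dom, L.Represents w (β w) (B w)) :
    L.Represents u (dirForm X β u) (C.DX X B u - C.DX X (fun w => C.sec w (β u)) u
      + vel C.j X • C.ν.d (B u - C.sec u (β u))) := by
  intro Y
  rw [pair_dirForm C.dom_open (C.regForm_of_rep hB h) hu]
  have hd := C.hd (C.reg_dlam Y) hu X
  have h1 := C.hd_tr hu (hd.mul (C.hd hB hu X))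
  have h2 := C.hd_tr hu (hd.mul (C.hd_sec hu (β u) X))
  have h2' : HasLineDerivAt ℂ (fun w => L.tr w (L.dlam w Y * C.sec w (β u))) 0 u X :=
    hasLineDerivAt_congr C.dom_open (f := fun _ => pair (β u) Y)
      (fun w hw => (C.sec_rep w hw _ Y).symm) hu (hasDerivAt_const (0 : ℂ) _)
  have hκ := C.rep_sub_mem hu (h u hu) (C.sec_rep u hu (β u))
  -- The difference κ of the two representatives stays in the annihilator at nearby points when its
  -- coefficients are frozen. This accounts for the term with the velocity.
  have h3 := C.hd_tr hu (hd.mul (HasD.const (B u - C.sec u (β u))))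
  have h3' : HasLineDerivAt ℂ (fun w => L.tr w (L.dlam w Y * (B u - C.sec u (β u)))) 0 u X :=
    hasLineDerivAt_congr C.dom_open (f := fun _ => 0)
      (fun w hw => (C.perp w hw _).mpr hκ Y) hu (hasDerivAt_const (0 : ℂ) _)
  have e2 := h2.unique h2'
  have e3 := h3.unique h3'
  have e1 : dirFun X (fun w => pair (β w) Y) u = _ :=
    (dirFun_congr C.dom_open (fun w hw => h w hw Y) hu X).trans h1.lineDeriv
  rw [e1]
  have hneg : ∀ f g, L.tr u (f * -g) = -L.tr u (f * g) := fun f g => by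
    have : f * -g = 0 - f * g := by ring
    rw [this, tr_sub, tr_zero, zero_sub]
  simp only [tr_add, mul_sub, mul_add, tr_sub, hneg] at e2 e3 ⊢
  linear_combination e3 + e2

/-- The covariant derivative of a one-form. -/
lemma rep_nabla {u : ι → ℂ} (hu : u ∈ L.dom) {a : (ι → ℂ) → (ι →₀ ℂ)} {α : Laurent}
    (ha : L.Represents u (a u) α) {β : (ι → ℂ) → (ι →₀ ℂ)} {B : (ι → ℂ) → Laurent}
    (hB : RegL L.dom B) (h : ∀ w ∈ L.dom, L.Represents w (β w) (B w)) :
    L.Represents u (nabla C.frob C.conn a β u)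
      (C.DX (C.frob.sharp u (a u)) B u + (L.point u).star α ((L.point u).D L.s (B u))) := by
  have h1 := rep_add (C.rep_dirForm hu (C.frob.sharp u (a u)) hB h) (C.rep_conn hu (a u) (β u))
  refine C.rep_of_sub_mem hu h1 ?_
  have hκ := C.rep_sub_mem hu (h u hu) (C.sec_rep u hu (β u))
  have hα := C.rep_sub_mem hu ha (C.sec_rep u hu (a u))
  -- The two ambiguities, in the direction and in the differentiated form, are exactly what
  -- `star_mem` and `conn_mem` absorb.
  have m1 := C.star_mem u hu _ hα (B u)
  have m2 := C.conn_mem u hu _ hκ (C.sec u (a u))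
  rw [← frob_sharp] at m2
  convert C.I.add_mem m1 m2 using 1
  rw [connL, MarkedPoint.star_sub_left, map_sub ((L.point u).D L.s), MarkedPoint.star_sub_right]
  abel

lemma rep_nabla_const {u : ι → ℂ} (hu : u ∈ L.dom) {a : ι →₀ ℂ} {α : Laurent}
    (ha : L.Represents u a α) (b : ι →₀ ℂ) :
    L.Represents u (nabla C.frob C.conn (fun _ => a) (fun _ => b) u)
      (C.DX (C.frob.sharp u a) (fun w => C.sec w b) u
        + (L.point u).star α ((L.point u).D L.s (C.sec u b))) :=
  C.rep_nabla hu (a := fun _ => a) ha (C.reg_sec b) fun w hw => C.sec_rep w hw b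

lemma rep_conn' {u : ι → ℂ} (hu : u ∈ L.dom) {a : ι →₀ ℂ} {α : Laurent}
    (ha : L.Represents u a α) (b : ι →₀ ℂ) :
    L.Represents u (C.conn u a b) (C.DX (C.frob.sharp u a) (fun w => C.sec w b) u
        + (L.point u).star α ((L.point u).D L.s (C.sec u b))) := by
  rw [← nabla_const C.frob]
  exact C.rep_nabla_const hu ha b

/-! ### The structure equations -/

/-- The derivative of the metric on one-forms with constant components. -/
lemma hasLineDerivAt_eta {u : ι → ℂ} (hu : u ∈ L.dom) (a b c : ι →₀ ℂ) :
    HasLineDerivAt ℂ (fun w => eta C.frob w b c)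
      (L.met u (C.sec u a) ((L.point u).D L.s ((L.point u).star (C.sec u b) (C.sec u c)))
        + L.met u (C.DX (C.frob.sharp u a) (fun w => C.sec w b) u) (C.sec u c)
        + L.met u (C.sec u b) (C.DX (C.frob.sharp u a) (fun w => C.sec w c) u))
      u (C.frob.sharp u a) := by
  refine hasLineDerivAt_congr C.dom_open
    (f := fun w => L.met w (C.sec w b) (C.sec w c)) (fun w hw => ?_) hu ?_
  · exact C.eta_eq hw (C.sec_rep w hw b) (C.sec_rep w hw c)
  · exact C.hd_met hu (C.sec_rep u hu a) (C.hd_sec hu b _) (C.hd_sec hu c _)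

/-- Since D is a derivation of the difference product, and the metric is invariant under it, the
term η*(α, D(β ★ γ)) splits into η*(α ★ Dβ, γ) and η*(β, α ★ Dγ). -/
theorem metric {u : ι → ℂ} (hu : u ∈ L.dom) (a b c : ι →₀ ℂ) :
    dirFun (C.frob.sharp u a) (fun w => eta C.frob w b c) u =
    eta C.frob u (nabla C.frob C.conn (fun _ => a) (fun _ => b) u) c
      + eta C.frob u b (nabla C.frob C.conn (fun _ => a) (fun _ => c) u) := by
  have ha := C.sec_rep u hu a
  have hb := C.sec_rep u hu b
  have hc := C.sec_rep u hu c
  rw [C.eta_eq hu (C.rep_nabla_const hu ha b) hc, C.eta_eq hu hb (C.rep_nabla_const hu ha c),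
    dirFun, (C.hasLineDerivAt_eta hu a b c).lineDeriv, MarkedPoint.D_star _ C.hs]
  simp only [met_add_left, met_add_right, met_star]
  rw [met_star_left u (C.sec u b)]
  ring

/-- Tested on a constant one-form c, the bracket is a difference of two derivatives of the metric.
The part in which c is differentiated cancels because c is closed, and the part with Dc cancels by
symmetry of the invariant product. -/
theorem torsionless {u : ι → ℂ} (hu : u ∈ L.dom) (a b : ι →₀ ℂ) :
    bracketSharp C.frob (fun _ => a) (fun _ => b) u =
    C.frob.sharp u (nabla C.frob C.conn (fun _ => a) (fun _ => b) u
      - nabla C.frob C.conn (fun _ => b) (fun _ => a) u) := by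
  refine vec_ext fun c => ?_
  have ha := C.sec_rep u hu a
  have hb := C.sec_rep u hu b
  have hc := C.sec_rep u hu c
  have e : bracketSharp C.frob (fun _ => a) (fun _ => b) u
      = (fun k => dirFun (C.frob.sharp u a) (fun w => C.frob.sharp w b k) u)
      - fun k => dirFun (C.frob.sharp u b) (fun w => C.frob.sharp w a k) u := rfl
  rw [e, pair_sub_right, pair_dirFun C.dom_open (C.reg_sharp b) hu,
    pair_dirFun C.dom_open (C.reg_sharp a) hu,
    C.pair_sharp hu (rep_sub (C.rep_nabla_const hu ha b) (C.rep_nabla_const hu hb a)) hc]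
  have h1 : dirFun (C.frob.sharp u a) (fun w => pair c (C.frob.sharp w b)) u = _ :=
    (C.hasLineDerivAt_eta hu a b c).lineDeriv
  have h2 : dirFun (C.frob.sharp u b) (fun w => pair c (C.frob.sharp w a)) u = _ :=
    (C.hasLineDerivAt_eta hu b a c).lineDeriv
  have h3 := C.tr_DX_sec hu c (C.frob.sharp u a) (C.frob.sharp u b)
  rw [C.dlam_frob_sharp hu ha, C.dlam_frob_sharp hu hb, mul_comm, tr_mul_sharp, mul_comm,
    tr_mul_sharp] at h3
  rw [h1, h2, MarkedPoint.D_star _ C.hs, MarkedPoint.D_star _ C.hs]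
  simp only [met_add_left, met_add_right, met_sub_left, met_star]
  rw [met_star_left u (C.sec u b) (C.sec u a)]
  linear_combination -h3

/-- The commutator of the plain derivatives is the derivative along the bracket. What remains is α ★
D(β ★ Dγ) - β ★ D(α ★ Dγ) = (α ★ Dβ - β ★ Dα) ★ Dγ, which holds by the Leibniz rule, commutativity
and associativity. -/
theorem flat {u : ι → ℂ} (hu : u ∈ L.dom) (a b c : ι →₀ ℂ) :
    curvature C.frob C.conn a b c u = 0 := by
  have rep1 : ∀ w ∈ L.dom, ∀ b, L.Represents w (nabla C.frob C.conn (fun _ => b) (fun _ => c) w)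
      (C.connL w b c) := fun w hw b => C.rep_nabla_const hw (C.sec_rep w hw b) c
  have ha := C.sec_rep u hu a
  have hb := C.sec_rep u hu b
  have r1 := C.rep_nabla hu (a := fun _ => a) ha (C.reg_connL b c) fun w hw => rep1 w hw b
  have r2 := C.rep_nabla hu (a := fun _ => b) hb (C.reg_connL a c) fun w hw => rep1 w hw a
  have rab := rep_sub (C.rep_nabla_const hu ha b) (C.rep_nabla_const hu hb a)
  have r3 := C.rep_nabla hu (a := fun w => nabla C.frob C.conn (fun _ => a) (fun _ => b) w
        - nabla C.frob C.conn (fun _ => b) (fun _ => a) w) rab (C.reg_sec c)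
        (fun w hw => C.sec_rep w hw c)
  have r := rep_sub (rep_sub r1 r2) r3
  -- The third term is differentiated along ([a, b])♯. Vanishing torsion replaces this by the Lie
  -- bracket, to which the commutator formula applies.
  rw [← C.torsionless hu] at r
  refine rep_zero (u := u) (L := L) ?_
  rw [curvature]
  convert r using 1
  have hcl := (C.reg_sec c).DL_comm C.dom_open C.ν C.j (C.reg_sharp a) (C.reg_sharp b) hu
    (Z := bracketSharp C.frob (fun _ => a) (fun _ => b) u) (fun k => rfl)
  have d1 : ∀ a b, C.DX (C.frob.sharp u a) (fun w => C.connL w b c) u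
      = C.DX (C.frob.sharp u a) (fun w => C.DX (C.frob.sharp w b) (fun w => C.sec w c) w) u
        + ((L.point u).star (C.DX (C.frob.sharp u a) (fun w => C.sec w b) u)
            ((L.point u).D L.s (C.sec u c))
          + (L.point u).star (C.sec u b) ((L.point u).D L.s
            (C.DX (C.frob.sharp u a) (fun w => C.sec w c) u))) := by
    intro a b
    exact (C.hd (C.reg_connL b c) hu _).unique ((C.hd (C.reg_DX (C.reg_sec c) (C.reg_sharp b))
      hu _).add (C.hd_star (C.hd_sec hu b _) (C.hd_D hu (C.hd_sec hu c _))))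
  have hcl' : C.DX (C.frob.sharp u a)
        (fun w => C.DX (C.frob.sharp w b) (fun w => C.sec w c) w) u
      - C.DX (C.frob.sharp u b) (fun w => C.DX (C.frob.sharp w a) (fun w => C.sec w c) w) u
      = C.DX (bracketSharp C.frob (fun _ => a) (fun _ => b) u) (fun w => C.sec w c) u := hcl
  rw [d1, d1, ← hcl', connL, connL]
  simp only [map_add, MarkedPoint.star_add_right, MarkedPoint.star_sub_left,
    MarkedPoint.star_add_left, MarkedPoint.D_star _ C.hs, MarkedPoint.star_assoc]
  have h1 := MarkedPoint.star_assoc (L.point u) (C.sec u b) (C.sec u a)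
    ((L.point u).D L.s ((L.point u).D L.s (C.sec u c)))
  rw [MarkedPoint.star_comm _ (C.sec u b) (C.sec u a), MarkedPoint.star_assoc] at h1
  rw [h1]
  abel

/-- The derivative of the multiplication. -/
lemma cTensor_eq {u : ι → ℂ} (hu : u ∈ L.dom) {a b c : ι →₀ ℂ} {α β γ : Laurent}
    (ha : L.Represents u a α) (hb : L.Represents u b β) (hc : L.Represents u c γ) :
    cTensor C.frob u a b c = L.met u (L.circ u α β) γ :=
  C.eta_eq hu (C.rep_mul hu ha hb) hc

lemma cTensor_swap_left {u : ι → ℂ} (hu : u ∈ L.dom) (a b c : ι →₀ ℂ) :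
    cTensor C.frob u a b c = cTensor C.frob u b a c := by
  have ha := C.sec_rep u hu a
  have hb := C.sec_rep u hu b
  have hc := C.sec_rep u hu c
  rw [C.cTensor_eq hu ha hb hc, C.cTensor_eq hu hb ha hc, circ_comm]

lemma cTensor_swap_right {u : ι → ℂ} (hu : u ∈ L.dom) (a b c : ι →₀ ℂ) :
    cTensor C.frob u a b c = cTensor C.frob u a c b := by
  have ha := C.sec_rep u hu a
  have hb := C.sec_rep u hu b
  have hc := C.sec_rep u hu c
  rw [C.cTensor_eq hu ha hb hc, C.cTensor_eq hu ha hc hb, circ_comm, met_circ C.hs, met_comm]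

/-- The derivatives of the chosen representatives cancel against those in the connection, and the
derivative of the last argument is moved by invariance of the metric. The purely algebraic
expression of `nabla_circW_symm` is left. -/
lemma nablaC_eq {u : ι → ℂ} (hu : u ∈ L.dom) (a b c d : ι →₀ ℂ) :
    nablaC C.frob C.conn u a b c d = L.met u
      ((L.point u).circW L.s ((L.point u).d ((L.point u).sharpW L.s (L.lamp u) (C.sec u a)))
          (C.sec u b) (C.sec u c)
        + (L.point u).star (C.sec u a) ((L.point u).D L.s
          ((L.point u).circW L.s (L.lamp u) (C.sec u b) (C.sec u c)))
        - (L.point u).circW L.s (L.lamp u) ((L.point u).star (C.sec u a)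
          ((L.point u).D L.s (C.sec u b))) (C.sec u c)
        - (L.point u).circW L.s (L.lamp u) (C.sec u b) ((L.point u).star (C.sec u a)
          ((L.point u).D L.s (C.sec u c)))) (C.sec u d) := by
  have ha := C.sec_rep u hu a
  have hb := C.sec_rep u hu b
  have hc := C.sec_rep u hu c
  have hd := C.sec_rep u hu d
  have h1 := C.hd_met hu ha
    (C.hd_circ hu (C.hd_sec hu b (C.frob.sharp u a)) (C.hd_sec hu c (C.frob.sharp u a)))
    (C.hd_sec hu d (C.frob.sharp u a))
  have h2 : dirFun (C.frob.sharp u a) (fun w => cTensor C.frob w b c d) u = _ :=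
    (dirFun_congr C.dom_open (fun w hw => C.cTensor_eq hw (C.sec_rep w hw b) (C.sec_rep w hw c)
      (C.sec_rep w hw d)) hu _).trans h1.lineDeriv
  rw [nablaC, h2, C.cTensor_eq hu (C.rep_conn' hu ha b) hc hd,
    C.cTensor_eq hu hb (C.rep_conn' hu ha c) hd, C.cTensor_eq hu hb hc (C.rep_conn' hu ha d),
    C.dlam_frob_sharp hu ha, ← LaurentSpace.sharp_eq, ← LaurentSpace.circ_eq,
    ← LaurentSpace.circ_eq, ← LaurentSpace.circ_eq, MarkedPoint.D_star _ C.hs]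
  simp only [← circLin_apply, map_add, LinearMap.add_apply, met_add_left, met_add_right,
    met_sub_left, met_star]
  rw [met_star_left u (C.sec u a) _ ((L.point u).D L.s (C.sec u d))]
  ring

/-- Only the first exchange is deep. The other two are inherited from the total symmetry of c
itself. -/
theorem nablaC_symm {u : ι → ℂ} (hu : u ∈ L.dom) (a b c d : ι →₀ ℂ) :
    nablaC C.frob C.conn u a b c d = nablaC C.frob C.conn u b a c d ∧
    nablaC C.frob C.conn u a b c d = nablaC C.frob C.conn u a c b d ∧
    nablaC C.frob C.conn u a b c d = nablaC C.frob C.conn u a b d c := by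
  refine ⟨?_, ?_, ?_⟩
  · rw [C.nablaC_eq hu, C.nablaC_eq hu, MarkedPoint.nabla_circW_symm _ C.hs]
  · rw [nablaC, nablaC, C.cTensor_swap_left hu (C.conn u a b) c,
      C.cTensor_swap_left hu b (C.conn u a c), C.cTensor_swap_left hu b c,
      dirFun_congr C.dom_open (fun w hw => C.cTensor_swap_left hw b c d) hu]
    ring
  · rw [nablaC, nablaC, C.cTensor_swap_right hu (C.conn u a b) c,
      C.cTensor_swap_right hu b (C.conn u a c), C.cTensor_swap_right hu b c,
      dirFun_congr C.dom_open (fun w hw => C.cTensor_swap_right hw b c d) hu]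
    ring

end LaurentChart
end FrobLaurent

/-! ### Derivatives of the Euler and unit vector fields -/

namespace FrobLaurent

variable {ι : Type}

namespace LaurentSpace

variable {L : LaurentSpace ι}

/-- One integration by parts makes the metric linear in λ itself, the form in which it can be
compared with ⟨a, E⟩ = Tr(λ κ(α)). -/
lemma met_eq (u : ι → ℂ) (a b : Laurent) :
    L.met u a b = L.tr u (L.lam u * (L.point u).D L.s ((L.point u).star a b)) := by
  rw [LaurentSpace.tr, MarkedPoint.tr_mul_D]; rfl

end LaurentSpace

namespace LaurentChart

variable [DecidableEq ι] {L : LaurentSpace ι} (C : LaurentChart L)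

open LaurentSpace

include C

lemma dlam_injective {u : ι → ℂ} (hu : u ∈ L.dom) {X Y : ι → ℂ} (h : L.dlam u X = L.dlam u Y) :
    X = Y := vec_ext fun a => by rw [C.sec_rep u hu a, C.sec_rep u hu a, h]

lemma dlam_zero (u : ι → ℂ) : L.dlam u 0 = 0 := by
  have := C.dlam_add u 0 0
  rwa [add_zero, left_eq_add] at this

/-! ### The Euler vector field -/

lemma tr_euler (u : ι → ℂ) (f : Laurent) :
    L.tr u ((L.lam u - C.c • ((L.point u).p * L.lamp u)) * f)
      = L.tr u (L.lam u * (L.point u).kappa L.s C.c f) := by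
  rw [LaurentSpace.tr, LaurentSpace.tr, MarkedPoint.tr_mul_kappa _ C.hs]; rfl

lemma pair_E {u : ι → ℂ} (hu : u ∈ L.dom) {a : ι →₀ ℂ} {α : Laurent} (ha : L.Represents u a α) :
    pair a (C.E u) = L.tr u (L.lam u * (L.point u).kappa L.s C.c α) := by
  rw [ha, C.dlam_E u hu, tr_euler]

lemma hd_kappa {φ : (ι → ℂ) → Laurent} {ψ : Laurent} {u X : ι → ℂ} (hu : u ∈ L.dom)
    (h : C.HD φ ψ u X) : C.HD (fun w => (L.point w).kappa L.s C.c (φ w))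
      ((L.point u).kappa L.s C.c ψ) u X := by
  have h1 := (h.smul (1 + C.c * (1 - L.s))).add (((C.hasD_p u hu X).mul h.d).smul C.c)
  simp only [MarkedPoint.kappa, C.d_eq]
  simpa only [zero_mul, zero_add] using h1

lemma dirFun_pair_E {u : ι → ℂ} (hu : u ∈ L.dom) (a : ι →₀ ℂ) (X : ι → ℂ) :
    dirFun X (fun w => pair a (C.E w)) u
      = L.tr u (L.dlam u X * (L.point u).kappa L.s C.c (C.sec u a))
        + L.tr u (L.lam u * (L.point u).kappa L.s C.c (C.DX X (fun w => C.sec w a) u)) := by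
  rw [← tr_add]
  exact (dirFun_congr C.dom_open (fun w hw => C.pair_E hw (C.sec_rep w hw a)) hu X).trans
    (C.hd_tr hu ((C.hasD_lam u hu X).mul (C.hd_kappa hu (C.hd_sec hu a X)))).lineDeriv

/-- The covariant derivative of the Euler vector field on representatives. -/
def nablaE (u : ι → ℂ) (α γ : Laurent) : Laurent :=
  (1 + C.c * (1 - L.s)) • (L.point u).star ((L.point u).D L.s α) γ
    + (C.c * (1 - L.s)) • (L.point u).star α ((L.point u).D L.s γ)

lemma reg_nablaE {φ₁ φ₂ : (ι → ℂ) → Laurent} (h₁ : RegL L.dom φ₁) (h₂ : RegL L.dom φ₂) :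
    RegL L.dom fun w => C.nablaE w (φ₁ w) (φ₂ w) :=
  (RegL.smul (RegFun.const _ _) (C.reg_star (C.reg_D h₁) h₂)).add
    (RegL.smul (RegFun.const _ _) (C.reg_star h₁ (C.reg_D h₂)))

lemma hd_nablaE {φ₁ φ₂ : (ι → ℂ) → Laurent} {ψ₁ ψ₂ : Laurent} {u X : ι → ℂ} (hu : u ∈ L.dom)
    (h₁ : C.HD φ₁ ψ₁ u X) (h₂ : C.HD φ₂ ψ₂ u X) :
    C.HD (fun w => C.nablaE w (φ₁ w) (φ₂ w))
      (C.nablaE u ψ₁ (φ₂ u) + C.nablaE u (φ₁ u) ψ₂) u X := by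
  have h := ((C.hd_star (C.hd_D hu h₁) h₂).smul (1 + C.c * (1 - L.s))).add
    ((C.hd_star h₁ (C.hd_D hu h₂)).smul (C.c * (1 - L.s)))
  have e : ∀ (k l : ℂ) (a b c d : Laurent),
      (k • a + l • c) + (k • b + l • d) = k • (a + b) + l • (c + d) := by
    intros; module
  simp only [nablaE]
  rw [e]
  exact h

lemma nablaE_add_left (u : ι → ℂ) (a b c : Laurent) :
    C.nablaE u (a + b) c = C.nablaE u a c + C.nablaE u b c := by
  simp only [nablaE, map_add, MarkedPoint.star_add_left]; module

lemma nablaE_add_right (u : ι → ℂ) (a b c : Laurent) :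
    C.nablaE u a (b + c) = C.nablaE u a b + C.nablaE u a c := by
  simp only [nablaE, map_add, MarkedPoint.star_add_right]; module

lemma nablaE_sub_right (u : ι → ℂ) (a b c : Laurent) :
    C.nablaE u a (b - c) = C.nablaE u a b - C.nablaE u a c := by
  simp only [nablaE, map_sub, MarkedPoint.star_sub_right]; module

/-- Differentiating the relation that κ annihilates the vector X, along Y, gives the velocity term;
symmetry of the second derivatives of λ exchanges X and Y. -/
lemma vel_mul_tr {u : ι → ℂ} (hu : u ∈ L.dom) {κ : Laurent} (hκ : κ ∈ C.I) (X Y : ι → ℂ) :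
    vel C.j Y * L.tr u (L.dlam u X * C.ν.d κ) = vel C.j X * L.tr u (L.dlam u Y * C.ν.d κ) := by
  have key : ∀ X Y, vel C.j Y * L.tr u (L.dlam u X * C.ν.d κ)
      = L.tr u (C.DX Y (fun w => L.dlam w X) u * κ) := by
    intro X Y
    have h1 := C.hd_tr hu ((C.hd (C.reg_dlam X) hu Y).mul (HasD.const κ))
    have h2 : HasLineDerivAt ℂ (fun w => L.tr w (L.dlam w X * κ)) 0 u Y :=
      hasLineDerivAt_congr C.dom_open (f := fun _ => 0)
        (fun w hw => (C.perp w hw _).mpr hκ X) hu (hasDerivAt_const (0 : ℂ) _)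
    have h3 := h1.unique h2
    have e : ∀ f g : Laurent, ∀ r : ℂ, f * -(r • g) = 0 - r • (f * g) := by
      intro f g r
      rw [smul_eq_C_mul, smul_eq_C_mul]; ring
    rw [tr_add, e, tr_sub, tr_zero, tr_smul] at h3
    linear_combination -h3
  rw [key, key, C.DX_dlam_comm hu]

/-- By `euler_first` the value is a difference of two pairings. The stability conditions `kappa_mem`
and `conn_mem` reduce both to velocity terms, which agree by `vel_mul_tr`. So ∇E may be computed on
any representative of the test covector. -/
lemma tr_lam_nablaE_of_mem {u : ι → ℂ} (hu : u ∈ L.dom) {κ : Laurent} (hκ : κ ∈ C.I)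
    (α : Laurent) : L.tr u (L.lam u * C.nablaE u α κ) = 0 := by
  have h1 := C.kappa_mem u hu κ hκ
  have h2 := C.conn_mem u hu κ hκ α
  have h3 := (C.perp u hu _).mpr h1 (C.vec u (L.sharp u α))
  have h4 := (C.perp u hu _).mpr h2 (C.E u)
  have h5 := C.vel_mul_tr hu hκ (C.E u) (C.vec u (L.sharp u α))
  rw [mul_sub, tr_sub, mul_smul_comm, tr_smul, C.dlam_sharp u hu, mul_comm, tr_mul_sharp] at h3
  rw [mul_sub, tr_sub, mul_smul_comm, tr_smul, C.dlam_E u hu, tr_euler] at h4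
  rw [C.dlam_sharp u hu, C.dlam_E u hu] at h5
  have h6 := MarkedPoint.euler_first (L.point u) C.hs C.c α κ
  rw [nablaE, ← h6, mul_sub, tr_sub, ← met_eq]
  linear_combination h3 - h4 - h5

theorem pair_nablaVec_E {u : ι → ℂ} (hu : u ∈ L.dom) {a c : ι →₀ ℂ} {α γ : Laurent}
    (ha : L.Represents u a α) (hc : L.Represents u c γ) :
    pair c (nablaVec C.frob C.conn a C.E u) = L.tr u (L.lam u * C.nablaE u α γ) := by
  have h0 := C.tr_lam_nablaE_of_mem hu (C.rep_sub_mem hu hc (C.sec_rep u hu c)) α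
  rw [nablaE_sub_right, mul_sub, tr_sub, sub_eq_zero] at h0
  rw [h0, pair_nablaVec C.dom_open _ _ C.reg_E hu, C.dirFun_pair_E hu, C.dlam_frob_sharp hu ha,
    mul_comm, tr_mul_sharp, C.pair_E hu (C.rep_conn' hu ha c), nablaE,
    ← MarkedPoint.euler_first (L.point u) C.hs, mul_sub, tr_sub, met_eq]
  have e : ∀ f g, (L.point u).kappa L.s C.c (f + g)
      = (L.point u).kappa L.s C.c f + (L.point u).kappa L.s C.c g := by
    intro f g
    simp only [MarkedPoint.kappa, map_add, mul_add]; module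
  rw [e, mul_add, tr_add]
  ring

lemma reg_nablaVec_E (b : ι →₀ ℂ) : RegVec L.dom (nablaVec C.frob C.conn b C.E) := fun k =>
  (C.reg_tr (C.reg_lam.mul (C.reg_nablaE (C.reg_sec b)
    (C.reg_sec (Finsupp.single k 1))))).congr fun w hw => by
      rw [← C.pair_nablaVec_E hw (C.sec_rep w hw b) (C.sec_rep w hw _), pair_single_left]

/-- The derivative of ⟨c, ∇_b E⟩ = Tr(λ · `nablaE`) is taken along a♯; derivatives of
representatives are absorbed by the connection, and the rest is `euler_second`. -/
theorem euler_affine {u : ι → ℂ} (hu : u ∈ L.dom) (a b : ι →₀ ℂ) :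
    nablaVec C.frob C.conn a (nablaVec C.frob C.conn b C.E) u
      = nablaVec C.frob C.conn (nabla C.frob C.conn (fun _ => a) (fun _ => b) u) C.E u := by
  refine vec_ext fun c => ?_
  have ha := C.sec_rep u hu a
  have hb := C.sec_rep u hu b
  have hc := C.sec_rep u hu c
  have h1 : dirFun (C.frob.sharp u a) (fun w => pair c (nablaVec C.frob C.conn b C.E w)) u = _ :=
    (dirFun_congr C.dom_open
      (fun w hw => C.pair_nablaVec_E hw (C.sec_rep w hw b) (C.sec_rep w hw c)) hu _).trans
    (C.hd_tr hu ((C.hasD_lam u hu (C.frob.sharp u a)).mul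
      (C.hd_nablaE hu (C.hd_sec hu b _) (C.hd_sec hu c _)))).lineDeriv
  rw [pair_nablaVec C.dom_open _ _ (C.reg_nablaVec_E b) hu, h1, C.dlam_frob_sharp hu ha,
    C.pair_nablaVec_E hu hb (C.rep_conn' hu ha c),
    C.pair_nablaVec_E hu (C.rep_nabla_const hu ha b) hc, nablaE_add_left, nablaE_add_right]
  simp only [tr_add, mul_add]
  rw [mul_comm, tr_mul_sharp, met_eq]
  have h2 := MarkedPoint.euler_second (L.point u) C.hs (1 + C.c * (1 - L.s)) (C.c * (1 - L.s))
    (C.sec u a) (C.sec u b) (C.sec u c)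
  have h3 := congrArg (fun f => L.tr u (L.lam u * f)) h2
  simp only [mul_sub (L.lam u), tr_sub] at h3
  simp only [nablaE] at h3 ⊢
  linear_combination h3

/-- For a closed one-form the Lie derivative is d⟨a, E⟩. Closedness exchanges the direction of
differentiation with E, which turns the second term into the derivative along E. -/
lemma lieCovec_eq {u : ι → ℂ} (hu : u ∈ L.dom) (a : ι →₀ ℂ) :
    lieCovec C.frob a u = C.cov u (C.DX (C.E u) (fun w => C.sec w a) u
      + (L.point u).kappa L.s C.c (C.sec u a)) := by
  rw [lieCovec]
  change toCovec _ = toCovec _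
  congr 1
  funext k
  rw [Finsupp.single_eq_pi_single]
  refine (C.dirFun_pair_E hu a _).trans ?_
  rw [← C.tr_euler, ← C.dlam_E u hu, C.tr_DX_sec hu a, mul_add, tr_add, add_comm]

lemma rep_lieCovec {u : ι → ℂ} (hu : u ∈ L.dom) (a : ι →₀ ℂ) :
    L.Represents u (lieCovec C.frob a u) (C.DX (C.E u) (fun w => C.sec w a) u
      + (L.point u).kappa L.s C.c (C.sec u a)) := by
  rw [C.lieCovec_eq hu]
  exact C.rep_cov u _

/-- The Lie derivative of a one-form along the Euler vector field. -/
lemma rep_lie {u : ι → ℂ} (hu : u ∈ L.dom) {β : (ι → ℂ) → (ι →₀ ℂ)}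
    {B : (ι → ℂ) → Laurent} (hB : RegL L.dom B) (h : ∀ w ∈ L.dom, L.Represents w (β w) (B w)) :
    L.Represents u (dirForm (C.E u) β u + lieCovec C.frob (β u) u)
      (C.DX (C.E u) B u + (L.point u).kappa L.s C.c (B u)) := by
  refine C.rep_of_sub_mem hu (rep_add (C.rep_dirForm hu (C.E u) hB h)
    (C.rep_lieCovec hu (β u))) ?_
  have h1 := C.kappa_mem u hu _ (C.rep_sub_mem hu (h u hu) (C.sec_rep u hu (β u)))
  convert h1 using 1
  simp only [MarkedPoint.kappa, map_sub, mul_sub]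
  module

theorem lie_mul {u : ι → ℂ} (hu : u ∈ L.dom) (a b : ι →₀ ℂ) :
    dirForm (C.frob.E u) (fun w => C.frob.mul w a b) u + lieCovec C.frob (C.frob.mul u a b) u
      - C.frob.mul u (lieCovec C.frob a u) b - C.frob.mul u a (lieCovec C.frob b u)
      = (C.frob.d - 1) • C.frob.mul u a b := by
  have ha := C.sec_rep u hu a
  have hb := C.sec_rep u hu b
  have r := rep_sub (rep_sub (C.rep_lie hu (C.reg_circ (C.reg_sec a) (C.reg_sec b))
      (fun w hw => C.rep_mul hw (C.sec_rep w hw a) (C.sec_rep w hw b)))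
    (C.rep_mul hu (C.rep_lieCovec hu a) hb)) (C.rep_mul hu ha (C.rep_lieCovec hu b))
  refine rep_unique r ?_
  have r' := rep_smul (C.frob.d - 1) (C.rep_mul hu ha hb)
  convert r' using 1
  have h1 : C.DX (C.E u) (fun w => L.circ w (C.sec w a) (C.sec w b)) u = _ :=
    (C.hd (C.reg_circ (C.reg_sec a) (C.reg_sec b)) hu (C.E u)).unique
      (C.hd_circ hu (C.hd_sec hu a (C.E u)) (C.hd_sec hu b (C.E u)))
  have h2 := MarkedPoint.lie_circW_identity (L.point u) C.hs C.c (L.lamp u) (C.sec u a)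
    (C.sec u b)
  have h3 : (L.point u).d (L.dlam u (C.E u))
      = L.lamp u - C.c • (L.lamp u + (L.point u).p * (L.point u).d (L.lamp u)) := by
    rw [C.dlam_E u hu, map_sub, map_smul, MarkedPoint.d_mul, MarkedPoint.d_p, one_mul]; rfl
  have h4 : C.frob.d - 1 = 2 * C.c * (L.s - 1) := by
    change 1 + (L.s - 1) * (2 * C.c) - 1 = _
    ring
  rw [h4, h1, h3]
  simp only [← circLin_apply, map_add, LinearMap.add_apply]
  simp only [circLin_apply, circ_eq] at h2 ⊢
  rw [← h2]
  abel

theorem lie_eta {u : ι → ℂ} (hu : u ∈ L.dom) (a b : ι →₀ ℂ) :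
    dirFun (C.frob.E u) (fun w => eta C.frob w a b) u
      - eta C.frob u (lieCovec C.frob a u) b - eta C.frob u a (lieCovec C.frob b u)
      = (C.frob.d - 2) * eta C.frob u a b := by
  have ha := C.sec_rep u hu a
  have hb := C.sec_rep u hu b
  have h1 : dirFun (C.E u) (fun w => eta C.frob w a b) u = _ :=
    (dirFun_congr C.dom_open (fun w hw => (C.eta_eq hw (C.sec_rep w hw a)
      (C.sec_rep w hw b)).trans (met_eq w _ _)) hu _).trans
    (C.hd_tr hu ((C.hasD_lam u hu (C.E u)).mul
      (C.hd_D hu (C.hd_star (C.hd_sec hu a _) (C.hd_sec hu b _))))).lineDeriv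
  change dirFun (C.E u) _ u - _ - _ = (1 + (L.s - 1) * (2 * C.c) - 2) * _
  rw [h1, C.eta_eq hu (C.rep_lieCovec hu a) hb, C.eta_eq hu ha (C.rep_lieCovec hu b),
    C.eta_eq hu ha hb, C.dlam_E u hu]
  simp only [met_add_left, met_add_right, tr_add, mul_add, map_add, tr_euler]
  simp only [met_eq]
  have h2 := MarkedPoint.lie_eta_identity (L.point u) C.hs C.c (C.sec u a) (C.sec u b)
  have h3 := congrArg (fun f => L.tr u (L.lam u * f)) h2
  simp only [mul_sub, tr_sub, mul_smul_comm, tr_smul] at h3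
  linear_combination h3

/-! ### The unit vector field -/

/-- The λ_p-part of e pairs to zero with every product, and the part 1 gives Tr(α ∘ β), which is the
metric. -/
theorem unit {u : ι → ℂ} (hu : u ∈ L.dom) (a b : ι →₀ ℂ) :
    pair (C.frob.mul u a b) (C.frob.e u) = pair a (C.frob.sharp u b) := by
  have ha := C.sec_rep u hu a
  have hb := C.sec_rep u hu b
  have e : ∀ f g : Laurent, ∀ r : ℂ, (1 - r • f) * g = g - r • (f * g) := by
    intro f g r
    rw [smul_eq_C_mul, smul_eq_C_mul]; ring
  change pair _ (C.e u) = _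
  rw [C.rep_mul hu ha hb, C.dlam_e u hu, C.pair_sharp hu hb ha, e, tr_sub, tr_smul, tr_circ,
    circ_eq, LaurentSpace.tr, MarkedPoint.tr_mul_circW, mul_zero, sub_zero, met_comm]

/-- Because both projections commute with D and with ∂/∂p, the factor p^s comes out of the
difference product, and the remaining residue vanishes by isotropy. Thus the constant field 1 is
parallel. -/
lemma tr_star_D {u : ι → ℂ} (a b : Laurent) :
    L.tr u ((L.point u).star a ((L.point u).D L.s b)) = 0 := by
  have h : (L.point u).star a ((L.point u).D L.s b)
      = (L.point u).p ^ L.s * (L.point u).star a ((L.point u).d b) := by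
    rw [MarkedPoint.star, MarkedPoint.star, MarkedPoint.P_D _ C.hs, MarkedPoint.Q_D _ C.hs,
      MarkedPoint.P_d, MarkedPoint.Q_d, MarkedPoint.D_apply, MarkedPoint.D_apply]
    ring
  rw [h, LaurentSpace.tr, MarkedPoint.tr_mul, MarkedPoint.star, map_sub, MarkedPoint.res_P_mul_P,
    MarkedPoint.res_Q_mul_Q, sub_zero]

lemma tr_lamp_mul_star_D {u : ι → ℂ} (a b : Laurent) :
    L.tr u (L.lamp u * (L.point u).star a ((L.point u).D L.s b))
      = -L.tr u ((L.point u).d b * L.sharp u a) := by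
  have h : (L.point u).star a ((L.point u).D L.s b)
      = (L.point u).p ^ L.s * (L.point u).star a ((L.point u).d b) := by
    rw [MarkedPoint.star, MarkedPoint.star, MarkedPoint.P_D _ C.hs, MarkedPoint.Q_D _ C.hs,
      MarkedPoint.P_d, MarkedPoint.Q_d, MarkedPoint.D_apply, MarkedPoint.D_apply]
    ring
  rw [h, LaurentSpace.tr, MarkedPoint.tr_mul', tr_mul_sharp, met, neg_neg]

/-- The covariant derivative of the unit vector field. -/
theorem pair_nablaVec_e {u : ι → ℂ} (hu : u ∈ L.dom) (a c : ι →₀ ℂ) :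
    pair c (nablaVec C.frob C.conn a C.e u)
      = -dirFun (C.frob.sharp u a) C.f u * L.tr u (L.lamp u * C.sec u c)
        - C.f u * (L.tr u ((L.point u).d (C.sec u c) * L.sharp u (C.sec u a))
          + L.tr u ((L.point u).d (L.sharp u (C.sec u a)) * C.sec u c)) := by
  have ha := C.sec_rep u hu a
  have hc := C.sec_rep u hu c
  have e : ∀ w ∈ L.dom, ∀ (c : ι →₀ ℂ) g, L.Represents w c g →
      pair c (C.e w) = L.tr w g - C.f w * L.tr w (L.lamp w * g) := by
    intro w hw c g h
    have e' : (1 - C.f w • L.lamp w) * g = g - C.f w • (L.lamp w * g) := by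
      rw [smul_eq_C_mul, smul_eq_C_mul]; ring
    rw [h, C.dlam_e w hw, e', tr_sub, tr_smul]
  have h0 := C.hd_sec hu c (C.frob.sharp u a)
  have h1 := C.hd_tr hu h0
  have h2 := C.hd_tr hu ((C.hd_lamp hu (C.frob.sharp u a)).mul h0)
  have h3 := C.reg_f.hasLineDerivAt C.dom_open hu (C.frob.sharp u a)
  have h4 := HasDerivAt.fun_sub h1 (HasDerivAt.fun_mul h3 h2)
  have h5 : dirFun (C.frob.sharp u a) (fun w => pair c (C.e w)) u = _ :=
    (dirFun_congr C.dom_open (fun w hw => e w hw c _ (C.sec_rep w hw c)) hu _).trans h4.deriv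
  rw [pair_nablaVec C.dom_open _ _ C.reg_e hu, h5, e u hu _ _ (C.rep_conn' hu ha c), mul_add]
  simp only [tr_add, C.tr_star_D, C.tr_lamp_mul_star_D, C.dlam_frob_sharp hu ha, zero_smul,
    add_zero]
  ring

/-- With f constant only the two trace terms remain. For s = 0 the trace is the residue and they
cancel by integration by parts; for f = 0 they are absent. -/
theorem nablaVec_e_eq_zero {f₀ : ℂ} (hf : ∀ u ∈ L.dom, C.f u = f₀) (h : f₀ = 0 ∨ L.s = 0)
    {u : ι → ℂ} (hu : u ∈ L.dom) (a : ι →₀ ℂ) : nablaVec C.frob C.conn a C.e u = 0 := by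
  refine vec_ext fun c => ?_
  rw [C.pair_nablaVec_e hu, dirFun_congr C.dom_open hf hu, dirFun_const, hf u hu]
  have h0 : pair c 0 = 0 := by
    rw [pair_eq_sum c _ subset_rfl]; simp
  rw [h0]
  rcases h with h | h
  · rw [h]; ring
  · have h1 := (L.point u).res_d_mul (C.sec u c) (L.sharp u (C.sec u a))
    have h2 : ∀ g, L.tr u g = (L.point u).res g := by
      intro g
      rw [LaurentSpace.tr, MarkedPoint.tr_eq, h, pow_zero, inv_one, one_mul]
    rw [h2 ((L.point u).d _ * _), h2 ((L.point u).d _ * _), h1, mul_comm (C.sec u c)]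
    ring

/-! ### The Frobenius manifold -/

theorem isFrobeniusWith (hM : FinitelyOpen L.generic) :
    IsFrobeniusWith C.frob C.conn L.generic := by
  have hsub : L.generic ⊆ L.dom := fun u hu => hu.1
  have hform : ∀ β, RegForm L.dom β → RegForm L.generic β := fun β h =>
    ⟨⟨h.1.choose, fun u hu => h.1.choose_spec u (hsub hu)⟩, fun k => (h.2 k).mono hsub⟩
  exact
  { finitelyOpen := hM
    reg_sharp := fun a k => (C.reg_sharp a k).mono hsub
    reg_mul := fun a b => hform _ (C.reg_mul a b)
    reg_conn := fun a b => hform _ (C.reg_conn a b)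
    reg_e := fun k => (C.reg_e k).mono hsub
    reg_E := fun k => (C.reg_E k).mono hsub
    eta_symm := fun u hu a b => by
      rw [C.eta_eq hu.1 (C.sec_rep u hu.1 a) (C.sec_rep u hu.1 b),
        C.eta_eq hu.1 (C.sec_rep u hu.1 b) (C.sec_rep u hu.1 a), met_comm]
    eta_nondeg := fun u hu => by
      rw [injective_iff_map_eq_zero]
      intro a h
      have h1 := C.dlam_frob_sharp hu.1 (C.sec_rep u hu.1 a)
      rw [h, C.dlam_zero] at h1
      exact covec_ext fun X => by
        rw [C.sec_rep u hu.1 a X, hu.2 _ h1.symm X, pair_zero_left]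
    mul_comm := fun u hu a b => by
      rw [frob_mul, frob_mul, circ_comm]
    mul_assoc := fun u hu a b c => by
      have ha := C.sec_rep u hu.1 a
      have hb := C.sec_rep u hu.1 b
      have hc := C.sec_rep u hu.1 c
      refine rep_unique (C.rep_mul hu.1 (C.rep_mul hu.1 ha hb) hc) ?_
      have h := C.rep_mul hu.1 ha (C.rep_mul hu.1 hb hc)
      rwa [circ_eq, circ_eq, ← MarkedPoint.circW_assoc _ C.hs, ← circ_eq, ← circ_eq] at h
    invariant := fun u hu a b c => by
      have ha := C.sec_rep u hu.1 a
      have hb := C.sec_rep u hu.1 b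
      have hc := C.sec_rep u hu.1 c
      rw [C.eta_eq hu.1 (C.rep_mul hu.1 ha hb) hc, C.eta_eq hu.1 ha (C.rep_mul hu.1 hb hc),
        met_circ C.hs]
    unit := fun u hu => C.unit hu.1
    torsionless := fun u hu => C.torsionless hu.1
    metric := fun u hu => C.metric hu.1
    flat := fun u hu => C.flat hu.1
    nablaC_symm := fun u hu => C.nablaC_symm hu.1
    euler_affine := fun u hu => C.euler_affine hu.1
    lie_mul := fun u hu => C.lie_mul hu.1
    lie_eta := fun u hu => C.lie_eta hu.1 }

theorem realizes {e E : (ι → ℂ) → Laurent} {d : ℂ} (he : ∀ u ∈ L.dom, 1 - C.f u • L.lamp u = e u)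
    (hE : ∀ u ∈ L.dom, L.lam u - C.c • ((L.point u).p * L.lamp u) = E u)
    (hd : 1 + (L.s - 1) * (2 * C.c) = d) : L.Realizes e E d C.frob where
  exists_rep u hu a := ⟨_, C.sec_rep u hu a⟩
  exists_covec u _ α := ⟨_, C.rep_cov u α⟩
  metric u hu a b α β ha hb := by rw [C.eta_eq hu ha hb, tr_circ]
  sharp u hu a α ha := C.dlam_frob_sharp hu ha
  mul u hu a b α β ha hb := C.rep_mul hu ha hb
  unit u hu := (C.dlam_e u hu).trans (he u hu)
  euler u hu := (C.dlam_E u hu).trans (hE u hu)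
  weight := hd

theorem isFrobeniusManifold (hM : FinitelyOpen L.generic) {f₀ : ℂ}
    (hf : ∀ u ∈ L.dom, C.f u = f₀) (h : f₀ = 0 ∨ L.s = 0) :
    IsFrobeniusManifold C.frob L.generic :=
  ⟨C.conn, C.isFrobeniusWith hM, fun _ hu a => C.nablaVec_e_eq_zero hf h hu.1 a⟩

/-- A criterion for the existence of the unit one-form. -/
theorem hasUnitForm {B : (ι → ℂ) → Laurent} (hB : RegL L.dom B)
    (h₁ : ∀ u ∈ L.dom, L.sharp u (B u) = 1 - C.f u • L.lamp u)
    (h₂ : ∀ u ∈ L.dom, ∀ β, L.circ u (B u) β - β ∈ C.I) : HasUnitForm C.frob L.generic := by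
  have hform := C.regForm_of_rep (β := fun w => C.cov w (B w)) hB fun w _ => C.rep_cov w _
  refine ⟨fun u => C.cov u (B u), ⟨⟨hform.1.choose, fun u hu => hform.1.choose_spec u hu.1⟩,
    fun k => (hform.2 k).mono fun u hu => hu.1⟩, fun u hu => ⟨?_, fun b => ?_⟩⟩
  · refine C.dlam_injective hu.1 ?_
    rw [C.dlam_frob_sharp hu.1 (C.rep_cov u _), h₁ u hu.1]
    exact (C.dlam_e u hu.1).symm
  · have hb := C.sec_rep u hu.1 b
    exact rep_unique (C.rep_mul hu.1 (C.rep_cov u _) hb)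
      (C.rep_of_sub_mem hu.1 hb (h₂ u hu.1 _))

end LaurentChart
end FrobLaurent

namespace FrobLaurent

/-! ## Generic points -/

lemma series_coeff (N : ℤ) (u : ℕ → ℂ) (i : ℤ) :
    (series N u).coeff i = if N ≤ i then u (i - N).toNat else 0 := by
  rw [series, HahnSeries.coeff_single_mul, one_mul]
  split_ifs with hi
  · have := HahnSeries.ofPowerSeries_apply_coeff (Γ := ℤ) (PowerSeries.mk u) (i - N).toNat
    rw [PowerSeries.coeff_mk, Int.toNat_of_nonneg (by omega)] at this
    exact this
  · rw [HahnSeries.ofPowerSeries_apply]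
    refine HahnSeries.embDomain_of_notMem_range ?_
    rintro ⟨n, hn⟩
    have : (n : ℤ) = i - N := hn
    omega

lemma series_coeff_add (N : ℤ) (u : ℕ → ℂ) (k : ℕ) : (series N u).coeff (N + k) = u k := by
  rw [series_coeff, if_pos (by omega), add_sub_cancel_left, Int.toNat_natCast]

lemma series_mem_ordGe (N : ℤ) (u : ℕ → ℂ) : series N u ∈ ordGe N := fun i hi => by
  rw [series_coeff, if_neg (by omega)]

lemma eq_series {N : ℤ} {f : Laurent} (hf : f ∈ ordGe N) :
    f = series N fun k => f.coeff (N + k) := by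
  ext i
  rw [series_coeff]
  split_ifs with h
  · rw [Int.toNat_of_nonneg (by omega), add_sub_cancel]
  · exact hf i (by omega)

/-- `series` as a linear map. -/
def seriesL (N : ℤ) : (ℕ → ℂ) →ₗ[ℂ] Laurent where
  toFun := series N
  map_add' u v := by
    ext i
    rw [HahnSeries.coeff_add, series_coeff, series_coeff, series_coeff]
    split_ifs <;> simp
  map_smul' c u := by
    ext i
    rw [RingHom.id_apply, HahnSeries.coeff_smul, series_coeff, series_coeff]
    split_ifs <;> simp

lemma seriesL_apply (N : ℤ) (u : ℕ → ℂ) : seriesL N u = series N u := rfl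

/-- Laurent polynomials. -/
def laurentPoly : Submodule ℂ Laurent where
  carrier := {f | f.support.Finite}
  add_mem' {f g} hf hg := (hf.union hg).subset (HahnSeries.support_add_subset f g)
  zero_mem' := by simp
  smul_mem' c f hf := hf.subset fun i hi h => hi (by
    rw [HahnSeries.coeff_smul, h, smul_zero])

lemma mul_mem_laurentPoly {f g : Laurent} (hf : f ∈ laurentPoly) (hg : g ∈ laurentPoly) :
    f * g ∈ laurentPoly :=
  (Set.Finite.add hf hg).subset HahnSeries.support_mul_subset

/-- Quotients of Laurent polynomials. -/
def rationalSeries : Submodule ℂ Laurent where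
  carrier := {f | ∃ a ∈ laurentPoly, a ≠ 0 ∧ a * f ∈ laurentPoly}
  add_mem' := by
    rintro f g ⟨a, ha, ha0, haf⟩ ⟨b, hb, hb0, hbg⟩
    refine ⟨a * b, mul_mem_laurentPoly ha hb, mul_ne_zero ha0 hb0, ?_⟩
    have e : a * b * (f + g) = b * (a * f) + a * (b * g) := by ring
    rw [e]
    exact laurentPoly.add_mem (mul_mem_laurentPoly hb haf) (mul_mem_laurentPoly ha hbg)
  zero_mem' := ⟨1, by
    refine (Set.finite_singleton (0 : ℤ)).subset fun i hi => ?_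
    by_contra h
    exact hi (HahnSeries.coeff_single_of_ne h), one_ne_zero, by
      rw [mul_zero]; exact laurentPoly.zero_mem⟩
  smul_mem' := by
    rintro c f ⟨a, ha, ha0, haf⟩
    refine ⟨a, ha, ha0, ?_⟩
    rw [mul_smul_comm]
    exact laurentPoly.smul_mem c haf

/-- Series with long gaps are not rational. -/
lemma notMem_rationalSeries {g : Laurent} (h : ∀ G : ℕ, ∃ i : ℤ, G ≤ i ∧ g.coeff i ≠ 0 ∧
    ∀ k, i - G ≤ k → k < i → g.coeff k = 0) : g ∉ rationalSeries := by
  rintro ⟨a, ha, ha0, hag⟩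
  obtain ⟨A, hA⟩ := Set.Finite.bddAbove ha
  obtain ⟨B, hB⟩ := Set.Finite.bddAbove hag
  obtain ⟨N, hN⟩ := exists_ordGe g
  have haord : a ∈ ordGe a.order := fun i hi => HahnSeries.coeff_eq_zero_of_lt_order hi
  obtain ⟨i, hGi, hi0, hgap⟩ := h ((A - a.order).toNat + (B - a.order).toNat + 1)
  push_cast at hGi hgap
  have hmax := Int.self_le_toNat (A - a.order)
  have hmax' := Int.self_le_toNat (B - a.order)
  -- Every other term of `a` meets the gap before position i, so the product inherits a nonzero
  -- coefficient arbitrarily far out and cannot be a Laurent polynomial.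
  have hc : (a * g).coeff (i + a.order) = a.coeff a.order * g.coeff i := by
    rw [coeff_mul_eq_sum haord hN, Finset.sum_eq_single a.order]
    · rw [add_sub_cancel_right]
    · intro j hj hne
      rw [Finset.mem_Icc] at hj
      by_cases hjA : j ≤ A
      · rw [hgap _ (by omega) (by omega), mul_zero]
      · have : a.coeff j = 0 := by
          by_contra hne'
          exact hjA (hA hne')
        rw [this, zero_mul]
    · intro hnot
      rw [Finset.mem_Icc] at hnot
      exact absurd (hN i (by omega)) hi0
  have h1 : i + a.order ≤ B := hB (by
    rw [HahnSeries.mem_support, hc]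
    exact mul_ne_zero (HahnSeries.coeff_order_eq_zero.not.mpr ha0) hi0)
  omega

/-- The indicator function of the powers of `2` which are at least `N`. -/
def lacunary (N k : ℕ) : ℂ := by
  classical
  exact if N ≤ k ∧ ∃ j, k = 2 ^ j then 1 else 0

lemma d_series_lacunary (ν : MarkedPoint) (N₀ : ℤ) (N : ℕ) :
    ν.d (series N₀ (lacunary N)) ∉ rationalSeries := by
  have key : ∀ G : ℕ, ∃ l : ℕ, (G : ℤ) ≤ N₀ + l - 1 ∧ lacunary N l = 1 ∧ N₀ + l ≠ 0 ∧
      ∀ k : ℤ, N₀ + l - G ≤ k → k < N₀ + l → (series N₀ (lacunary N)).coeff k = 0 := by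
    intro G
    -- The power 2^(M+1) is preceded by 2^M, so the gap has length 2^M > M > G. The other summands
    -- make the position large and keep the exponent away from 0, where differentiation would kill
    -- the coefficient.
    set M := G + N₀.natAbs + N + 2 with hM
    have h2 : M < 2 ^ M := Nat.lt_two_pow_self
    have h3 : 2 ^ (M + 1) = 2 * 2 ^ M := by rw [pow_succ]; ring
    refine ⟨2 ^ (M + 1), by omega, ?_, by omega, ?_⟩
    · rw [lacunary, if_pos ⟨by omega, _, rfl⟩]
    · intro k h4 h5
      rw [series_coeff, if_pos (by omega), lacunary, if_neg]
      rintro ⟨-, j, hj⟩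
      have h6 : 2 ^ M < 2 ^ j := by omega
      have h7 : 2 ^ j < 2 ^ (M + 1) := by omega
      rw [Nat.pow_lt_pow_iff_right (by norm_num)] at h6 h7
      omega
  refine notMem_rationalSeries fun G => ?_
  obtain ⟨l, h1, h2, h3, h4⟩ := key (G + 2)
  have h5 : ((N₀ : ℂ) + l) ≠ 0 := by exact_mod_cast h3
  have h6 : (series N₀ (lacunary N)).coeff (N₀ + l) = 1 := by rw [series_coeff_add, h2]
  cases ν with
  | infinity =>
    refine ⟨N₀ + l + 1, by omega, ?_, fun k hk hk' => ?_⟩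
    · rw [MarkedPoint.d_infinity_coeff, add_sub_cancel_right, h6]
      push_cast
      rw [add_sub_cancel_right, mul_one, neg_ne_zero]
      exact h5
    · rw [MarkedPoint.d_infinity_coeff, h4 _ (by omega) (by omega), mul_zero, neg_zero]
  | finite v =>
    refine ⟨N₀ + l - 1, by omega, ?_, fun k hk hk' => ?_⟩
    · rw [MarkedPoint.d_finite_coeff, sub_add_cancel, h6]
      push_cast
      rw [sub_add_cancel, mul_one]
      exact h5
    · rw [MarkedPoint.d_finite_coeff, h4 _ (by omega) (by omega), mul_zero]

variable {ι : Type}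

/-- The least exponent of the series without polar part. -/
def MarkedPoint.start : MarkedPoint → ℤ
  | .infinity => 1
  | .finite _ => 0

namespace LaurentChart

variable [DecidableEq ι] {L : LaurentSpace ι} (C : LaurentChart L)

/-- The kernel equation is P(λ_p α) = λ_p P(α). At infinity both projections are Laurent
polynomials, so an irrational λ_p forces P(α) = 0; at a finite point the same holds with Q. Then
neither α nor λ_p α has a polar part, and `h` puts α in the annihilator. Conversely a denominator of
a rational λ_p, shifted far enough, solves the equation outside the annihilator. -/
theorem mem_generic_iff {u : ι → ℂ} (hu : u ∈ L.dom) {N : ℤ} (hI : C.I = ordGe N)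
    (h : ∀ α ∈ ordGe C.ν.start, L.lamp u * α ∈ ordGe C.ν.start → α ∈ C.I) :
    u ∈ L.generic ↔ L.lamp u ∉ rationalSeries := by
  have hsharp : ∀ α, L.sharp u α = 0 ↔ C.ν.P (L.lamp u * α) = L.lamp u * C.ν.P α := by
    intro α
    rw [LaurentSpace.sharp_eq, MarkedPoint.sharpW, C.P_eq, mul_eq_zero,
      or_iff_right ((L.point u).pow_ne _), sub_eq_zero]
  constructor
  · rintro ⟨-, hgen⟩ ⟨a, ha, ha0, haw⟩
    obtain ⟨A, hA⟩ := Set.Finite.bddAbove ha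
    obtain ⟨B, hB⟩ := Set.Finite.bddAbove haw
    have hA' : ∀ i, A < i → a.coeff i = 0 := fun i hi => by
      by_contra hne
      exact absurd (hA hne) (by omega)
    have hB' : ∀ i, B < i → (a * L.lamp u).coeff i = 0 := fun i hi => by
      by_contra hne
      exact absurd (hB hne) (by omega)
    -- The shift by M makes all exponents of the denominator and of its product with λ_p negative in
    -- the local parameter, and puts the order below N, outside the annihilator.
    obtain ⟨M, hM⟩ : ∃ M : ℤ, A < M ∧ B < M ∧ a.order < N + M :=
      ⟨max (max A B) (a.order - N) + 1, by omega, by omega, by omega⟩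
    have hs : ∀ (f : Laurent) (i : ℤ), (HahnSeries.single (-M) (1 : ℂ) * f).coeff i
        = f.coeff (i + M) := by
      intro f i
      rw [HahnSeries.coeff_single_mul, one_mul, sub_neg_eq_add]
    set α := HahnSeries.single (-M) (1 : ℂ) * a with hα
    have hwα : L.lamp u * α = HahnSeries.single (-M) (1 : ℂ) * (a * L.lamp u) := by rw [hα]; ring
    have hα0 : ∀ i, 0 ≤ i → α.coeff i = 0 := fun i hi => by rw [hα, hs, hA' _ (by omega)]
    have hw0 : ∀ i, 0 ≤ i → (L.lamp u * α).coeff i = 0 := fun i hi => by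
      rw [hwα, hs, hB' _ (by omega)]
    have hP : C.ν.P (L.lamp u * α) = L.lamp u * C.ν.P α := by
      cases hν : C.ν with
      | infinity =>
        have e : ∀ f : Laurent, (∀ i, 0 ≤ i → f.coeff i = 0) → MarkedPoint.infinity.P f = f := by
          intro f hf
          ext i
          rw [MarkedPoint.P_infinity_coeff]
          split_ifs with hi
          · rfl
          · exact (hf i (by omega)).symm
        rw [e _ hα0, e _ hw0]
      | finite v =>
        have e : ∀ f : Laurent, (∀ i, 0 ≤ i → f.coeff i = 0) → (MarkedPoint.finite v).P f = 0 := by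
          intro f hf
          ext i
          rw [MarkedPoint.P_finite_coeff, HahnSeries.coeff_zero]
          split_ifs with hi
          · exact hf i hi
          · rfl
        rw [e _ hα0, e _ hw0, mul_zero]
    have hmem := (C.perp u hu α).mp (hgen α ((hsharp α).mpr hP))
    rw [hI] at hmem
    have h0 := hmem (a.order - M) (by omega)
    rw [hα, hs, sub_add_cancel] at h0
    exact ha0 (HahnSeries.coeff_order_eq_zero.mp h0)
  · intro hw
    refine ⟨hu, fun α hα => (C.perp u hu α).mpr ?_⟩
    rw [hsharp] at hα
    have hbd : ∀ f : Laurent, (∃ B, ∀ i, B < i → f.coeff i = 0) → f ∈ laurentPoly := by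
      rintro f ⟨B, hB⟩
      obtain ⟨M, hM⟩ := exists_ordGe f
      refine (Set.finite_Icc M B).subset fun i hi => ⟨?_, ?_⟩
      · by_contra hlt
        exact hi (hM i (not_le.mp hlt))
      · by_contra hlt
        exact hi (hB i (not_le.mp hlt))
    have hzero : ∀ f, f ∈ laurentPoly → f * L.lamp u ∈ laurentPoly → f = 0 := by
      intro f h1 h2
      by_contra h0
      exact hw ⟨f, h1, h0, h2⟩
    cases hν : C.ν with
    | infinity =>
      rw [hν] at hα h
      have hP : ∀ f, MarkedPoint.infinity.P f ∈ laurentPoly := fun f => hbd _ ⟨0, fun i hi => by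
        rw [MarkedPoint.P_infinity_coeff, if_neg (by omega)]⟩
      have hord : ∀ f, MarkedPoint.infinity.P f = 0 → f ∈ ordGe 1 := by
        intro f hf i hi
        have := congrArg (fun g : Laurent => g.coeff i) hf
        simpa only [MarkedPoint.P_infinity_coeff, if_pos (show i ≤ 0 by omega),
          HahnSeries.coeff_zero] using this
      have h1 : MarkedPoint.infinity.P α = 0 := hzero _ (hP _) (by
        rw [mul_comm, ← hα]; exact hP _)
      rw [h1, mul_zero] at hα
      exact h α (hord _ h1) (hord _ hα)
    | finite v =>
      rw [hν] at hα h
      have hQ : ∀ f, (MarkedPoint.finite v).Q f ∈ laurentPoly := fun f => hbd _ ⟨0, fun i hi => by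
        rw [MarkedPoint.Q_finite_coeff, if_pos (by omega)]⟩
      have hord : ∀ f, (MarkedPoint.finite v).Q f = 0 → f ∈ ordGe 0 := by
        intro f hf i hi
        have := congrArg (fun g : Laurent => g.coeff i) hf
        simpa only [MarkedPoint.Q_finite_coeff, if_neg (not_le.mpr hi), HahnSeries.coeff_zero] using this
      have hα' : (MarkedPoint.finite v).Q (L.lamp u * α)
          = L.lamp u * (MarkedPoint.finite v).Q α := by
        rw [MarkedPoint.Q_apply, hα, MarkedPoint.Q_apply]; ring
      have h1 : (MarkedPoint.finite v).Q α = 0 := hzero _ (hQ _) (by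
        rw [mul_comm, ← hα']; exact hQ _)
      rw [h1, mul_zero] at hα'
      exact h α (hord _ h1) (hord _ hα')

end LaurentChart

namespace LaurentSpace

variable {L : LaurentSpace ι}

/-- λ_p is affine in the coordinates and the rational series form a linear subspace. So in a
finite-dimensional slice they cut out a translate of a linear subspace, or nothing, which is closed
in either case. -/
theorem finitelyOpen_generic (hd : FinitelyOpen L.dom) (Λ : (ι → ℂ) →ₗ[ℂ] Laurent) (l : Laurent)
    (hΛ : ∀ u, L.lamp u = l + Λ u)
    (h : ∀ u ∈ L.dom, u ∈ L.generic ↔ L.lamp u ∉ rationalSeries) : FinitelyOpen L.generic := by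
  intro u k X
  let T : (Fin k → ℂ) →ₗ[ℂ] (ι → ℂ) := ∑ i, (LinearMap.proj i : (Fin k → ℂ) →ₗ[ℂ] ℂ).smulRight (X i)
  have hT : ∀ t, T t = ∑ i, t i • X i := fun t => by
    simp only [T, LinearMap.sum_apply, LinearMap.smulRight_apply, LinearMap.proj_apply]
  have e : {t : Fin k → ℂ | u + ∑ i, t i • X i ∈ L.generic}
      = {t | u + ∑ i, t i • X i ∈ L.dom} ∩ {t | L.lamp (u + T t) ∈ rationalSeries}ᶜ := by
    ext t
    rw [Set.mem_inter_iff, Set.mem_compl_iff, Set.mem_ofPred_eq, Set.mem_ofPred_eq, Set.mem_ofPred_eq,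
      hT]
    exact ⟨fun ht => ⟨ht.1, (h _ ht.1).mp ht⟩, fun ht => (h _ ht.1).mpr ht.2⟩
  rw [e]
  refine (hd u k X).inter (IsClosed.isOpen_compl (self := ?_))
  by_cases hne : ∃ t₀, L.lamp (u + T t₀) ∈ rationalSeries
  · obtain ⟨t₀, ht₀⟩ := hne
    let W : Submodule ℂ (Fin k → ℂ) := rationalSeries.comap (Λ ∘ₗ T)
    have e2 : {t | L.lamp (u + T t) ∈ rationalSeries} = (fun t => t - t₀) ⁻¹' W := by
      ext t
      have e3 : (Λ ∘ₗ T) (t - t₀) = L.lamp (u + T t) - L.lamp (u + T t₀) := by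
        rw [hΛ, hΛ, LinearMap.comp_apply, map_sub, map_sub, map_add, map_add]
        abel
      rw [Set.mem_preimage, SetLike.mem_coe, Submodule.mem_comap, e3, Set.mem_ofPred_eq]
      exact (Submodule.sub_mem_iff_left _ ht₀).symm
    rw [e2]
    exact (Submodule.closed_of_finiteDimensional W).preimage (by fun_prop)
  · have e2 : {t | L.lamp (u + T t) ∈ rationalSeries} = ∅ := by
      ext t
      exact ⟨fun ht => hne ⟨t, ht⟩, fun ht => ht.elim⟩
    rw [e2]
    exact isClosed_empty

/-- A rational point is perturbed in coordinates beyond any given finite set; in the product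
topology such perturbations converge to it. The set S₀ contains the coordinates that decide
membership in the domain. -/
theorem dom_subset_closure_generic (Λ : (ι → ℂ) →ₗ[ℂ] Laurent) (l : Laurent)
    (hΛ : ∀ u, L.lamp u = l + Λ u)
    (h : ∀ u ∈ L.dom, u ∈ L.generic ↔ L.lamp u ∉ rationalSeries)
    (S₀ : Finset ι) (hS₀ : ∀ u ∈ L.dom, ∀ w : ι → ℂ, (∀ i ∈ S₀, w i = u i) → w ∈ L.dom)
    (hδ : ∀ S : Finset ι, ∃ δ : ι → ℂ, (∀ i ∈ S, δ i = 0) ∧ Λ δ ∉ rationalSeries) :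
    L.dom ⊆ closure L.generic := by
  classical
  intro u hu
  by_cases hr : L.lamp u ∈ rationalSeries
  · choose δ h0 h1 using hδ
    refine mem_closure_of_tendsto (f := fun S => u + δ S) (b := Filter.atTop) ?_ ?_
    · rw [tendsto_pi_nhds]
      intro i
      refine tendsto_const_nhds.congr' ?_
      filter_upwards [Filter.eventually_ge_atTop {i}] with S hS
      rw [Pi.add_apply, h0 S i (hS (Finset.mem_singleton_self i)), add_zero]
    · filter_upwards [Filter.eventually_ge_atTop S₀] with S hS
      have hd : u + δ S ∈ L.dom := hS₀ u hu _ fun i hi => by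
        rw [Pi.add_apply, h0 S i (hS hi), add_zero]
      refine (h _ hd).mpr fun hmem => h1 S ?_
      have e : Λ (δ S) = L.lamp (u + δ S) - L.lamp u := by
        rw [hΛ, hΛ, map_add]; abel
      rw [e]
      exact rationalSeries.sub_mem hmem hr
  · exact subset_closure ((h u hu).mpr hr)

end LaurentSpace
end FrobLaurent

namespace FrobLaurent

/-! ## Orders of Laurent series -/

lemma coeff_mul_lead {f g : Laurent} {a b : ℤ} (hf : f ∈ ordGe a) (hg : g ∈ ordGe b) :
    (f * g).coeff (a + b) = f.coeff a * g.coeff b := by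
  rw [coeff_mul_eq_sum hf hg, add_sub_cancel_right, Finset.Icc_self, Finset.sum_singleton,
    add_sub_cancel_left]

lemma mem_ordGe_of_mul {f g : Laurent} {a b : ℤ} (hf : f ∈ ordGe a) (h0 : f.coeff a ≠ 0)
    (h : f * g ∈ ordGe (a + b)) : g ∈ ordGe b := by
  by_cases hg : g = 0
  · rw [hg]; exact (ordGe b).zero_mem
  have hg' : g ∈ ordGe g.order := fun i hi => HahnSeries.coeff_eq_zero_of_lt_order hi
  refine ordGe_mono ?_ hg'
  by_contra hlt
  have h1 := coeff_mul_lead hf hg'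
  rw [h _ (by omega)] at h1
  exact mul_ne_zero h0 (HahnSeries.coeff_order_eq_zero.not.mpr hg) h1.symm

lemma mem_ordGe_of_coeff_eq_zero {f : Laurent} {a : ℤ} (hf : f ∈ ordGe a) (h0 : f.coeff a = 0) :
    f ∈ ordGe (a + 1) := by
  intro i hi
  rcases (show i < a ∨ i = a by omega) with h | rfl
  · exact hf i h
  · exact h0

lemma single_mem_ordGe (a : ℤ) (c : ℂ) : (HahnSeries.single a c : Laurent) ∈ ordGe a :=
  fun _ hi => HahnSeries.coeff_single_of_ne hi.ne

lemma one_mem_ordGe : (1 : Laurent) ∈ ordGe 0 := single_mem_ordGe 0 1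

lemma C_mem_ordGe (c : ℂ) : (HahnSeries.C c : Laurent) ∈ ordGe 0 := single_mem_ordGe 0 c

lemma pow_mem_ordGe {f : Laurent} {a : ℤ} (hf : f ∈ ordGe a) (n : ℕ) : f ^ n ∈ ordGe (n * a) := by
  induction n with
  | zero => simpa using one_mem_ordGe
  | succ n ih =>
    have := mul_mem_ordGe ih hf
    rw [pow_succ]
    convert this using 2
    push_cast; ring

/-- The coefficients of a product with `series N X` are finite sums. -/
lemma coeff_series_mul {f : Laurent} {N N' : ℤ} (X : ℕ → ℂ) (hf : f ∈ ordGe N') (i : ℤ) {K : ℕ}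
    (hK : i - N' < N + K) :
    (series N X * f).coeff i = ∑ k ∈ Finset.range K, X k * f.coeff (i - N - k) := by
  rw [coeff_mul_eq_sum (series_mem_ordGe N X) hf]
  refine Finset.sum_bij_ne_zero (fun j _ _ => (j - N).toNat) ?_ ?_ ?_ ?_
  · intro j hj _
    rw [Finset.mem_Icc] at hj
    rw [Finset.mem_range]; omega
  · intro j hj _ j' hj' _ h
    rw [Finset.mem_Icc] at hj hj'
    omega
  · intro k hk h0
    refine ⟨N + k, ?_, ?_, by omega⟩
    · rw [Finset.mem_Icc]
      refine ⟨by omega, ?_⟩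
      by_contra hlt
      exact h0 (by rw [hf _ (by omega), mul_zero])
    · rwa [series_coeff_add, ← sub_sub]
  · intro j hj _
    rw [Finset.mem_Icc] at hj
    rw [series_coeff, if_pos hj.1]
    congr 2
    omega

lemma series_single (N : ℤ) (k : ℕ) : series N (Pi.single k 1) = HahnSeries.single (N + k) 1 := by
  ext i
  rw [series_coeff, HahnSeries.coeff_single]
  by_cases h : i = N + k
  · subst h
    simp
  · rw [if_neg (show ¬ i = N + k from h)]
    split_ifs with h1
    · rw [Pi.single_eq_of_ne]
      omega
    · rfl

lemma coeff_mul_single (f : Laurent) (i j : ℤ) :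
    (f * HahnSeries.single j 1).coeff i = f.coeff (i - j) := by
  rw [mul_comm, HahnSeries.coeff_single_mul, one_mul]

namespace MarkedPoint

variable (ν : MarkedPoint)

/-- `2 * start - 1` equals 1 at infinity and -1 at a finite point, which lets both cases share one
computation with orders. -/
lemma res_eq_coeff (f : Laurent) : ν.res f = f.coeff (2 * ν.start - 1) := by
  cases ν <;> rfl

lemma P_of_mem {v : ℂ} {f : Laurent} (hf : f ∈ ordGe 0) : (finite v).P f = f := by
  ext i
  rw [P_finite_coeff]
  split_ifs with h
  · rfl
  · exact (hf i (by omega)).symm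

lemma Q_of_mem {v : ℂ} {f : Laurent} (hf : f ∈ ordGe 0) : (finite v).Q f = 0 := by
  rw [Q_apply, P_of_mem hf, sub_self]

lemma P_infinity_of_mem {f : Laurent} (hf : f ∈ ordGe 1) : infinity.P f = 0 := by
  ext i
  rw [P_infinity_coeff, HahnSeries.coeff_zero]
  split_ifs with h
  · exact hf i (by omega)
  · rfl

lemma Q_infinity_of_mem {f : Laurent} (hf : f ∈ ordGe 1) : infinity.Q f = f := by
  rw [Q_apply, P_infinity_of_mem hf, sub_zero]

lemma P_finite_mem (v : ℂ) (f : Laurent) : (finite v).P f ∈ ordGe 0 := fun i hi => by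
  rw [P_finite_coeff, if_neg (by omega)]

lemma Q_infinity_mem (f : Laurent) : infinity.Q f ∈ ordGe 1 := fun i hi => by
  rw [Q_apply, HahnSeries.coeff_sub, P_infinity_coeff, if_pos (by omega), sub_self]

lemma star_mem_ordGe {κ : Laurent} {M : ℤ} (hM : ν.start ≤ M) (hκ : κ ∈ ordGe M) (g : Laurent) :
    ν.star κ g ∈ ordGe M := by
  cases ν with
  | infinity =>
    have h := mul_mem_ordGe hκ (Q_infinity_mem g)
    have hκ' : κ ∈ ordGe 1 := ordGe_mono hM hκ
    rw [star, P_infinity_of_mem hκ', Q_infinity_of_mem hκ', zero_mul, zero_sub]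
    exact (ordGe M).neg_mem (ordGe_mono (by omega) h)
  | finite v =>
    have h := mul_mem_ordGe hκ (P_finite_mem v g)
    have hκ' : κ ∈ ordGe 0 := ordGe_mono hM hκ
    rw [star, P_of_mem hκ', Q_of_mem hκ', zero_mul, sub_zero]
    exact ordGe_mono (by omega) h

/-- If wκ has no polar part, P(wκ) is 0 at infinity and wκ at a finite point. In either case two of
the three terms combine and one product with κ remains. -/
lemma circW_mem_ordGe {s : ℕ} {w κ : Laurent} {M : ℤ} (hq : ν.p ^ s ∈ ordGe (-ν.start))
    (hM : ν.start ≤ M) (hκ : κ ∈ ordGe M) (hw : w * κ ∈ ordGe ν.start) (β : Laurent) :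
    ν.circW s w κ β ∈ ordGe M := by
  cases ν with
  | infinity =>
    have h := mul_mem_ordGe hq (mul_mem_ordGe hκ (Q_infinity_mem (w * β)))
    have e : infinity.circW s w κ β = -(infinity.p ^ s * (κ * infinity.Q (w * β))) := by
      rw [circW, P_infinity_of_mem hw, Q_apply]; ring
    rw [e]
    refine (ordGe M).neg_mem (ordGe_mono ?_ h)
    rw [start]; omega
  | finite v =>
    have h := mul_mem_ordGe hq (mul_mem_ordGe hκ (P_finite_mem v (w * β)))
    have e : (finite v).circW s w κ β = (finite v).p ^ s * (κ * (finite v).P (w * β)) := by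
      rw [circW, P_of_mem hw]; ring
    rw [e]
    refine ordGe_mono ?_ h
    rw [start]; omega

/-- P(wα) - wP(α) equals minus the same expression with Q, so at each kind of point it can be
written with the projection whose image has order at least `start`. -/
lemma sharpW_mem_ordGe {s : ℕ} {w : Laurent} {e N : ℤ} (hq : ν.p ^ s ∈ ordGe e)
    (hN : N ≤ e + ν.start) (hw : w ∈ ordGe (N - e - ν.start)) (α : Laurent) :
    ν.sharpW s w α ∈ ordGe N := by
  have key : ∀ h ∈ ordGe ν.start, ∀ g ∈ ordGe ν.start, ν.p ^ s * (h - w * g) ∈ ordGe N := by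
    intro h hh g hg
    rw [mul_sub]
    refine (ordGe N).sub_mem (ordGe_mono hN (mul_mem_ordGe hq hh)) ?_
    exact ordGe_mono (by omega) (mul_mem_ordGe hq (mul_mem_ordGe hw hg))
  cases ν with
  | infinity =>
    have h1 := key _ ((ordGe 1).neg_mem (Q_infinity_mem (w * α))) _
      ((ordGe 1).neg_mem (Q_infinity_mem α))
    convert h1 using 1
    rw [sharpW, Q_apply, Q_apply]; ring
  | finite v => exact key _ (P_finite_mem v _) _ (P_finite_mem v _)

lemma d_infinity_mem {f : Laurent} {N : ℤ} (hf : f ∈ ordGe N) : infinity.d f ∈ ordGe (N + 1) := by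
  intro i hi
  rw [d_infinity_coeff, hf _ (by omega), mul_zero, neg_zero]

lemma d_finite_mem_zero {v : ℂ} {f : Laurent} (hf : f ∈ ordGe 0) : (finite v).d f ∈ ordGe 0 := by
  have h := (finite v).P_d f
  rw [P_of_mem hf] at h
  rw [← h]
  exact P_finite_mem v _

lemma p_infinity_eq : infinity.p = HahnSeries.single (-1) 1 := rfl

lemma p_infinity_pow_mem (s : ℕ) : infinity.p ^ s ∈ ordGe (-s : ℤ) := by
  have := pow_mem_ordGe (single_mem_ordGe (-1) 1) s
  rwa [mul_neg_one] at this

lemma p_infinity_pow_inv_mem (s : ℕ) : (infinity.p ^ s)⁻¹ ∈ ordGe (s : ℤ) := by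
  have h : infinity.p⁻¹ = HahnSeries.single 1 1 := by
    refine inv_eq_of_mul_eq_one_right ?_
    rw [p_infinity_eq, HahnSeries.single_mul_single]
    simp
  rw [← inv_pow, h]
  have := pow_mem_ordGe (single_mem_ordGe 1 1) s
  rwa [mul_one] at this

lemma p_zero_eq : (finite 0).p = HahnSeries.single 1 1 := by
  simp [p]

end MarkedPoint

end FrobLaurent

namespace FrobLaurent

/-! ## Affine spaces of series at a fixed point -/

variable {ι : Type}

lemma reg_series {M : Set (ι → ℂ)} (N : ℤ) (g : ℕ → ι) : RegL M fun u => series N fun k => u (g k) := by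
  refine ⟨⟨N, fun u _ => series_mem_ordGe N _⟩, fun i => ?_⟩
  simp only [series_coeff]
  split_ifs
  · exact RegFun.coord M _
  · exact RegFun.const M 0

lemma hasLineDerivAt_coord (k : ι) (u X : ι → ℂ) :
    HasLineDerivAt ℂ (fun w : ι → ℂ => w k) (X k) u X := by
  have h : HasDerivAt (fun t : ℂ => u k + t * X k) (1 * X k) 0 :=
    ((hasDerivAt_id (0 : ℂ)).mul_const (X k)).const_add (u k)
  rw [one_mul] at h
  exact h

lemma hasLineDerivAt_series (N : ℤ) (g : ℕ → ι) (u X : ι → ℂ) (i : ℤ) :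
    HasLineDerivAt ℂ (fun w => (series N fun k => w (g k)).coeff i)
      ((series N fun k => X (g k)).coeff i) u X := by
  simp only [series_coeff]
  split_ifs
  · exact hasLineDerivAt_coord _ u X
  · exact hasDerivAt_const _ _

/-- Affine spaces of Laurent series at a fixed point, where `r` is the order of `pˢ`. -/
structure LinearSpace (L : LaurentSpace ℕ) where
  ν : MarkedPoint
  l : Laurent
  N : ℤ
  r : ℤ
  point_eq : ∀ u, L.point u = ν
  lam_eq : ∀ u, L.lam u = l + series N u
  dlam_eq : ∀ u X, L.dlam u X = series N X
  hs : L.s = 0 ∨ L.s = 1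
  dom_open : FinitelyOpen L.dom
  pow_mem : ν.p ^ L.s ∈ ordGe r
  inv_mem : (ν.p ^ L.s)⁻¹ ∈ ordGe (-r)
  -- It makes α♯ tangent, and it also places the annihilator, of order 2 start - N + r, among the
  -- series without polar part.
  le : N ≤ r + ν.start
  neg_le : -ν.start ≤ r
  lamp_mem : ∀ u ∈ L.dom, L.lamp u ∈ ordGe (N - r - ν.start)
  D_mem : ∀ κ ∈ ordGe (2 * ν.start - N + r), ν.D L.s κ ∈ ordGe (2 * ν.start - N + r)
  c : ℂ
  kappa_mem : ∀ κ ∈ ordGe (2 * ν.start - N + r),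
    c • (ν.p * ν.d κ) ∈ ordGe (2 * ν.start - N + r)
  lam_mem : ∀ u ∈ L.dom, L.lam u - c • (ν.p * L.lamp u) ∈ ordGe N
  f : (ℕ → ℂ) → ℂ
  reg_f : RegFun L.dom f
  unit_mem : ∀ u ∈ L.dom, 1 - f u • L.lamp u ∈ ordGe N

namespace LinearSpace

variable {L : LaurentSpace ℕ} (A : LinearSpace L)

include A

lemma lamp_eq (u : ℕ → ℂ) : L.lamp u = A.ν.d (L.lam u) := by rw [← A.point_eq u]; rfl

lemma reg_lam : RegL L.dom L.lam :=
  ((RegL.const _ A.l).add (reg_series A.N id)).congr fun u _ => A.lam_eq u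

lemma reg_lamp : RegL L.dom L.lamp := (A.reg_lam.d A.ν).congr fun u _ => A.lamp_eq u

/-- The coordinates of a tangent vector. -/
def coords : Laurent →ₗ[ℂ] (ℕ → ℂ) where
  toFun f k := f.coeff (A.N + k)
  map_add' f g := by ext k; rw [HahnSeries.coeff_add]; rfl
  map_smul' c f := by ext k; rw [HahnSeries.coeff_smul]; rfl

lemma series_coords {f : Laurent} (hf : f ∈ ordGe A.N) : series A.N (A.coords f) = f :=
  (eq_series hf).symm

lemma reg_coords {y : (ℕ → ℂ) → Laurent} (hy : RegL L.dom y) :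
    RegVec L.dom fun u => A.coords (y u) := fun k => hy.2 (A.N + k)

/-- Representatives of covectors. -/
def sec : (ℕ →₀ ℂ) →ₗ[ℂ] Laurent := Finsupp.linearCombination ℂ fun k : ℕ =>
  -- The exponent is chosen so that the residue against ∑ X_k z^(N+k) picks out X_k; the factor p^s
  -- cancels the one in the trace.
  A.ν.p ^ L.s * HahnSeries.single (2 * A.ν.start - 1 - A.N - k) (1 : ℂ)

lemma tr_eq (u : ℕ → ℂ) (f : Laurent) : L.tr u f = A.ν.tr L.s f := by
  rw [LaurentSpace.tr, A.point_eq]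

lemma rep_sec (u : ℕ → ℂ) (a : ℕ →₀ ℂ) : L.Represents u a (A.sec a) := by
  intro X
  rw [A.dlam_eq, A.tr_eq]
  induction a using Finsupp.induction_linear with
  | zero =>
    rw [map_zero, mul_zero, pair_zero_left, ← MarkedPoint.trL_apply, map_zero]
  | add a b ha hb =>
    rw [pair_add_left, ha, hb, map_add, mul_add]
    simp only [← MarkedPoint.trL_apply, map_add]
  | single k c =>
    have e : (Finsupp.single k c : ℕ →₀ ℂ) = c • Finsupp.single k 1 := by simp
    rw [e, map_smul, pair_smul_left, pair_single_left, mul_smul_comm, ← MarkedPoint.trL_apply,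
      map_smul, smul_eq_mul, MarkedPoint.trL_apply, sec, Finsupp.linearCombination_single, one_smul,
      MarkedPoint.tr_mul', MarkedPoint.res_eq_coeff, coeff_mul_single]
    congr 1
    rw [show 2 * A.ν.start - 1 - (2 * A.ν.start - 1 - A.N - k) = A.N + k by ring,
      series_coeff_add]

lemma mul_inv_mem {α : Laurent} {M : ℤ} :
    (A.ν.p ^ L.s)⁻¹ * α ∈ ordGe (M - A.r) ↔ α ∈ ordGe M := by
  constructor
  · intro h
    have h1 := mul_mem_ordGe A.pow_mem h
    rwa [mul_inv_cancel_left₀ (A.ν.pow_ne _), add_sub_cancel] at h1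
  · intro h
    have h1 := mul_mem_ordGe A.inv_mem h
    rwa [neg_add_eq_sub] at h1

lemma perp (u : ℕ → ℂ) (α : Laurent) :
    (∀ X, L.tr u (L.dlam u X * α) = 0) ↔ α ∈ ordGe (2 * A.ν.start - A.N + A.r) := by
  have e : ∀ X, L.tr u (L.dlam u X * α)
      = (series A.N X * ((A.ν.p ^ L.s)⁻¹ * α)).coeff (2 * A.ν.start - 1) := by
    intro X
    rw [A.tr_eq, A.dlam_eq, MarkedPoint.tr_eq, MarkedPoint.res_eq_coeff]
    congr 1; ring
  rw [← A.mul_inv_mem]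
  simp only [e]
  constructor
  · intro h i hi
    have h1 := h (Pi.single (2 * A.ν.start - 1 - A.N - i).toNat 1)
    rw [series_single, HahnSeries.coeff_single_mul, one_mul] at h1
    rw [← h1]
    congr 1
    omega
  · intro h X
    exact mul_mem_ordGe (series_mem_ordGe A.N X) h _ (by omega)

/-- The chart of an affine space of Laurent series. -/
def chart : LaurentChart L where
  ν := A.ν
  j := none
  kind w := by rw [A.point_eq]; exact ⟨rfl, rfl, rfl⟩
  hs := A.hs
  dom_open := A.dom_open
  reg_p := by
    simp only [A.point_eq]
    exact RegL.const _ _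
  hasD_p u _ X := by
    simp only [A.point_eq]
    have h : HasD A.ν 0 (fun _ : ℕ → ℂ => A.ν.p) _ u X := HasD.const A.ν.p
    rwa [laurent_zero_smul, neg_zero] at h
  reg_inv := by
    simp only [A.point_eq]
    exact RegL.const _ _
  reg_lam := A.reg_lam
  hasD_lam u hu X := by
    obtain ⟨N', hN'⟩ := A.reg_lam.1
    refine ⟨⟨N', (A.dom_open.eventually hu X).mono fun t ht => hN' _ ht⟩, fun i => ?_⟩
    have h0 : vel (none : Option ℕ) X = 0 := rfl
    rw [h0, laurent_zero_smul, add_zero, A.dlam_eq]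
    simp only [A.lam_eq, HahnSeries.coeff_add]
    exact HasDerivAt.const_add _ (hasLineDerivAt_series A.N id u X i)
  dlam_add u X Y := by
    simp only [A.dlam_eq, ← seriesL_apply, map_add]
  fin N' := by
    refine ⟨Finset.range (2 * A.ν.start - 1 - N' - A.N + 1).toNat, fun u f hf X => ?_⟩
    simp only [A.dlam_eq, MarkedPoint.res_eq_coeff, series_single, HahnSeries.coeff_single_mul,
      one_mul]
    rw [coeff_series_mul X hf _ (K := (2 * A.ν.start - 1 - N' - A.N + 1).toNat) (by omega)]
    exact Finset.sum_congr rfl fun k _ => by rw [sub_sub _ A.N]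
  sec _ := A.sec
  reg_sec _ := RegL.const _ _
  sec_rep u _ := A.rep_sec u
  vec _ := A.coords
  reg_vec _ hy := A.reg_coords hy
  dlam_sharp u hu α := by
    rw [A.dlam_eq, A.series_coords]
    rw [LaurentSpace.sharp_eq, A.point_eq]
    exact MarkedPoint.sharpW_mem_ordGe _ A.pow_mem A.le (A.lamp_mem u hu) α
  I := ordGe (2 * A.ν.start - A.N + A.r)
  perp u _ := A.perp u
  star_mem u _ κ hκ g := by
    have := A.le
    rw [A.point_eq]
    exact MarkedPoint.star_mem_ordGe _ (by omega) hκ _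
  conn_mem u _ κ hκ α := by
    have := A.le
    have h0 : ∀ Y, vel (none : Option ℕ) Y = 0 := fun _ => rfl
    rw [A.point_eq, h0, laurent_zero_smul, sub_zero, MarkedPoint.star_comm]
    exact MarkedPoint.star_mem_ordGe _ (by omega) (A.D_mem κ hκ) _
  circ_mem u hu κ hκ β := by
    have := A.le
    rw [LaurentSpace.circ_eq, A.point_eq]
    refine MarkedPoint.circW_mem_ordGe _ (ordGe_mono A.neg_le A.pow_mem) (by omega) hκ ?_ β
    exact ordGe_mono (by omega) (mul_mem_ordGe (A.lamp_mem u hu) hκ)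
  c := A.c
  E u := A.coords (L.lam u - A.c • (A.ν.p * L.lamp u))
  reg_E := A.reg_coords (A.reg_lam.sub (RegL.smul (RegFun.const _ A.c)
    ((RegL.const _ A.ν.p).mul A.reg_lamp)))
  dlam_E u hu := by
    rw [A.dlam_eq, A.series_coords (A.lam_mem u hu), A.point_eq]
  kappa_mem u _ κ hκ := by
    have h0 : ∀ Y, vel (none : Option ℕ) Y = 0 := fun _ => rfl
    rw [A.point_eq, h0, laurent_zero_smul, sub_zero, MarkedPoint.kappa]
    exact Submodule.add_mem _ (Submodule.smul_mem _ _ hκ) (A.kappa_mem κ hκ)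
  e u := A.coords (1 - A.f u • L.lamp u)
  reg_e := A.reg_coords ((RegL.const _ 1).sub (RegL.smul A.reg_f A.reg_lamp))
  f := A.f
  reg_f := A.reg_f
  dlam_e u hu := by rw [A.dlam_eq, A.series_coords (A.unit_mem u hu)]

/-- The linear part of `λ_p`. -/
def lampL : (ℕ → ℂ) →ₗ[ℂ] Laurent := A.ν.d ∘ₗ seriesL A.N

lemma lamp_eq_add (u : ℕ → ℂ) : L.lamp u = A.ν.d A.l + A.lampL u := by
  rw [A.lamp_eq, A.lam_eq, map_add]; rfl

/-- The hypothesis says that `λ_p` has the expected order, unless this does not matter. -/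
theorem mem_generic_iff (h : 2 * A.ν.start - A.N + A.r = A.ν.start ∨
    ∀ u ∈ L.dom, (L.lamp u).coeff (A.N - A.r - A.ν.start) ≠ 0) :
    ∀ u ∈ L.dom, u ∈ L.generic ↔ L.lamp u ∉ rationalSeries := by
  intro u hu
  refine A.chart.mem_generic_iff hu rfl fun α hα hwα => ?_
  change α ∈ ordGe (2 * A.ν.start - A.N + A.r)
  change α ∈ ordGe A.ν.start at hα
  change L.lamp u * α ∈ ordGe A.ν.start at hwα
  rcases h with h | h
  · rwa [h]
  · refine mem_ordGe_of_mul (A.lamp_mem u hu) (h u hu) ?_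
    convert hwα using 1
    ring_nf

theorem finitelyOpen_generic (h : 2 * A.ν.start - A.N + A.r = A.ν.start ∨
    ∀ u ∈ L.dom, (L.lamp u).coeff (A.N - A.r - A.ν.start) ≠ 0) : FinitelyOpen L.generic :=
  LaurentSpace.finitelyOpen_generic A.dom_open A.lampL _ A.lamp_eq_add (A.mem_generic_iff h)

theorem dom_subset_closure_generic (h : 2 * A.ν.start - A.N + A.r = A.ν.start ∨
    ∀ u ∈ L.dom, (L.lamp u).coeff (A.N - A.r - A.ν.start) ≠ 0)
    (S₀ : Finset ℕ) (hS₀ : ∀ u ∈ L.dom, ∀ w : ℕ → ℂ, (∀ i ∈ S₀, w i = u i) → w ∈ L.dom) :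
    L.dom ⊆ closure L.generic := by
  refine LaurentSpace.dom_subset_closure_generic A.lampL _ A.lamp_eq_add (A.mem_generic_iff h)
    S₀ hS₀ fun S => ?_
  refine ⟨lacunary (S.sup id + 1), fun i hi => ?_, d_series_lacunary A.ν A.N _⟩
  have : i ≤ S.sup id := Finset.le_sup (f := id) hi
  rw [lacunary, if_neg (by omega)]

end LinearSpace
end FrobLaurent

namespace FrobLaurent

/-! ## Spaces of series at infinity -/

lemma mem_ordGe_sub_zero_smul {f g : Laurent} {N : ℤ} (hf : f ∈ ordGe N) :
    f - (0 : ℂ) • g ∈ ordGe N := by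
  rwa [laurent_zero_smul, sub_zero]

section Infinity

variable (s n : ℕ)

lemma infinity_lam_mem (hs : s ≤ 1) (u : ℕ → ℂ) : (spaceInfinity s n).lam u ∈ ordGe (-n : ℤ) :=
  (ordGe (-n : ℤ)).add_mem (single_mem_ordGe _ 1)
    (ordGe_mono (by omega) (series_mem_ordGe (2 - n - s) u))

lemma infinity_lam_coeff (u : ℕ → ℂ) {i : ℤ} (hi : i < 2 - n - s) (hi' : i ≠ -n) :
    ((spaceInfinity s n).lam u).coeff i = 0 := by
  change (HahnSeries.single (-(n : ℤ)) 1 + series (2 - n - s) u : Laurent).coeff i = 0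
  rw [HahnSeries.coeff_add, HahnSeries.coeff_single_of_ne hi', series_mem_ordGe _ _ i hi, add_zero]

lemma infinity_lam_coeff_lead (hs : s ≤ 1) (u : ℕ → ℂ) :
    ((spaceInfinity s n).lam u).coeff (-n) = 1 := by
  change (HahnSeries.single (-(n : ℤ)) 1 + series (2 - n - s) u : Laurent).coeff (-n) = 1
  rw [HahnSeries.coeff_add, HahnSeries.coeff_single_same, series_mem_ordGe _ _ _ (by omega),
    add_zero]

lemma infinity_lamp_coeff (u : ℕ → ℂ) (i : ℤ) : ((spaceInfinity s n).lamp u).coeff i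
    = -((i - 1) * ((spaceInfinity s n).lam u).coeff (i - 1)) :=
  MarkedPoint.d_infinity_coeff _ i

lemma infinity_lamp_mem (hs : s ≤ 1) (u : ℕ → ℂ) :
    (spaceInfinity s n).lamp u ∈ ordGe (1 - n : ℤ) := by
  have h := MarkedPoint.d_infinity_mem (infinity_lam_mem s n hs u)
  rwa [neg_add_eq_sub] at h

lemma infinity_lamp_coeff_lead (hs : s ≤ 1) (u : ℕ → ℂ) :
    ((spaceInfinity s n).lamp u).coeff (1 - n) = n := by
  rw [infinity_lamp_coeff, show (1 - n - 1 : ℤ) = -n by ring, infinity_lam_coeff_lead s n hs]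
  push_cast; ring

/-- The spaces of series at infinity. -/
def linearInfinity (hs : s = 0 ∨ s = 1) (hn : 1 ≤ n) : LinearSpace (spaceInfinity s n) where
  ν := .infinity
  l := HahnSeries.single (-(n : ℤ)) 1
  N := 2 - n - s
  r := -s
  point_eq _ := rfl
  lam_eq _ := rfl
  dlam_eq _ _ := rfl
  hs := hs
  dom_open _ _ _ := isOpen_univ
  pow_mem := MarkedPoint.p_infinity_pow_mem s
  inv_mem := by
    rw [neg_neg]
    exact MarkedPoint.p_infinity_pow_inv_mem s
  le := by rw [MarkedPoint.start]; omega
  neg_le := by rw [MarkedPoint.start]; omega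
  lamp_mem u _ := ordGe_mono (by rw [MarkedPoint.start]; omega)
    (infinity_lamp_mem s n (by omega) u)
  D_mem κ hκ := by
    have h := mul_mem_ordGe (MarkedPoint.p_infinity_pow_mem s) (MarkedPoint.d_infinity_mem hκ)
    exact ordGe_mono (by omega) h
  c := 1 / n
  kappa_mem κ hκ := by
    have h := mul_mem_ordGe (single_mem_ordGe (-1) 1) (MarkedPoint.d_infinity_mem hκ)
    exact (ordGe _).smul_mem _ (ordGe_mono (by omega) h)
  lam_mem u _ i hi := by
    rw [HahnSeries.coeff_sub, HahnSeries.coeff_smul, MarkedPoint.p_infinity_mul_coeff,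
      infinity_lamp_coeff, add_sub_cancel_right]
    by_cases h : i = -n
    -- The leading term of λ has weight n under p ∂/∂p, so c = 1/n removes it from λ - c p λ_p.
    · subst h
      have : (n : ℂ) ≠ 0 := by exact_mod_cast (show n ≠ 0 by omega)
      push_cast
      rw [smul_eq_mul]
      field_simp
      ring
    · rw [infinity_lam_coeff s n u hi h, mul_zero, neg_zero, smul_zero, sub_zero]
  -- Only for s = 0, n = 1 do tangent series start at p^{-1}, so that the constant 1 is not tangent.
  -- Then λ_p has leading coefficient 1 and subtracting it repairs this.
  f _ := if s = 0 ∧ n = 1 then 1 else 0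
  reg_f := RegFun.const _ _
  unit_mem u _ := by
    split_ifs with h
    · obtain ⟨rfl, rfl⟩ := h
      rw [one_smul]
      have h1 := infinity_lamp_mem 0 1 (by omega) u
      have h2 := infinity_lamp_coeff_lead 0 1 (by omega) u
      have h3 := mem_ordGe_of_coeff_eq_zero (a := 0)
        ((ordGe 0).sub_mem one_mem_ordGe (by simpa using h1)) (by
          rw [HahnSeries.coeff_sub, HahnSeries.coeff_one]
          simpa [sub_eq_zero] using h2.symm)
      simpa using h3
    · exact mem_ordGe_sub_zero_smul (ordGe_mono (by omega) one_mem_ordGe)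

lemma infinity_order (hs : s = 0 ∨ s = 1) (hn : 1 ≤ n) :
    ∀ u ∈ (spaceInfinity s n).dom, ((spaceInfinity s n).lamp u).coeff
      ((linearInfinity s n hs hn).N - (linearInfinity s n hs hn).r
        - (linearInfinity s n hs hn).ν.start) ≠ 0 := by
  intro u _
  have e : (linearInfinity s n hs hn).N - (linearInfinity s n hs hn).r
      - (linearInfinity s n hs hn).ν.start = 1 - n := by
    change (2 - n - s : ℤ) - (-s) - 1 = 1 - n
    ring
  rw [e, infinity_lamp_coeff_lead s n (by omega)]
  exact_mod_cast (show n ≠ 0 by omega)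

/-- The unit form is p^{1-n}/n: its product with λ_p has nonnegative part exactly 1. The error B ∘ β
- β = -B·Q(λ_p β) has order at least n and lies in the annihilator. -/
lemma infinity_hasUnitForm (hn : 1 ≤ n) : HasUnitForm (linearInfinity 0 n (Or.inl rfl) hn).chart.frob
    (spaceInfinity 0 n).generic := by
  have hn0 : (n : ℂ) ≠ 0 := by exact_mod_cast (show n ≠ 0 by omega)
  set B : Laurent := HahnSeries.single (n - 1 : ℤ) (1 / n : ℂ) with hB
  have hwB : ∀ u, MarkedPoint.infinity.P ((spaceInfinity 0 n).lamp u * B) = 1 := by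
    intro u
    ext i
    rw [MarkedPoint.P_infinity_coeff, mul_comm, hB, HahnSeries.coeff_single_mul,
      HahnSeries.coeff_one]
    split_ifs with h1 h2 h2
    · rw [h2, show (0 - (n - 1) : ℤ) = 1 - n by ring, infinity_lamp_coeff_lead 0 n (by omega)]
      field_simp
    · rw [infinity_lamp_mem 0 n (by omega) u _ (by omega), mul_zero]
    · omega
    · rfl
  refine LaurentChart.hasUnitForm _ (B := fun _ => B) (RegL.const _ B) ?_ ?_
  · intro u _
    rw [LaurentSpace.sharp_eq]
    change MarkedPoint.infinity.sharpW 0 _ B = 1 - (if 0 = 0 ∧ n = 1 then (1 : ℂ) else 0) • _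
    rw [MarkedPoint.sharpW, pow_zero, one_mul, hwB]
    split_ifs with h
    · have : B = 1 := by rw [hB, h.2]; simp
      have h1 : MarkedPoint.infinity.P 1 = 1 := by
        ext i
        rw [MarkedPoint.P_infinity_coeff, HahnSeries.coeff_one]
        split_ifs <;> first | rfl | omega
      rw [this, h1, one_smul, mul_one]
    · rw [MarkedPoint.P_infinity_of_mem (ordGe_mono (by omega) (single_mem_ordGe _ _)), mul_zero,
        laurent_zero_smul]
  · intro u _ β
    rw [LaurentSpace.circ_eq]
    change MarkedPoint.infinity.circW 0 _ B β - β ∈ ordGe (2 * 1 - (2 - n - (0 : ℕ)) + (-(0 : ℕ)))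
    have e : MarkedPoint.infinity.circW 0 ((spaceInfinity 0 n).lamp u) B β - β
        = -(B * MarkedPoint.infinity.Q ((spaceInfinity 0 n).lamp u * β)) := by
      rw [MarkedPoint.circW, hwB, MarkedPoint.Q_apply]; ring
    rw [e]
    have h := mul_mem_ordGe (single_mem_ordGe (n - 1) (1 / n : ℂ))
      (MarkedPoint.Q_infinity_mem ((spaceInfinity 0 n).lamp u * β))
    exact (ordGe _).neg_mem (ordGe_mono (by push_cast; omega) h)

theorem infinity_main (hs : s = 0 ∨ s = 1) (hn : 1 ≤ n) :
    (spaceInfinity s n).dom ⊆ closure (spaceInfinity s n).generic ∧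
      ∃ F : FrobeniusData ℕ,
        (spaceInfinity s n).Realizes
          (fun u => if s = 0 ∧ n = 1 then 1 - (spaceInfinity s n).lamp u else 1)
          (fun u => (spaceInfinity s n).lam u
            - (1 / (n : ℂ)) • (MarkedPoint.infinity.p * (spaceInfinity s n).lamp u))
          (1 + ((s : ℂ) - 1) * (2 / (n : ℂ))) F ∧
        IsFrobeniusManifold F (spaceInfinity s n).generic ∧
        (s = 0 → HasUnitForm F (spaceInfinity s n).generic) := by
  have ho : 2 * (linearInfinity s n hs hn).ν.start - (linearInfinity s n hs hn).N
      + (linearInfinity s n hs hn).r = (linearInfinity s n hs hn).ν.start ∨ _ :=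
    Or.inr (infinity_order s n hs hn)
  refine ⟨(linearInfinity s n hs hn).dom_subset_closure_generic ho ∅ fun _ _ _ _ => Set.mem_univ _,
    (linearInfinity s n hs hn).chart.frob, LaurentChart.realizes _ ?_ (fun _ _ => rfl) ?_,
    LaurentChart.isFrobeniusManifold _ ((linearInfinity s n hs hn).finitelyOpen_generic ho)
      (f₀ := if s = 0 ∧ n = 1 then 1 else 0) (fun _ _ => rfl) ?_, ?_⟩
  · intro u _
    change 1 - (if s = 0 ∧ n = 1 then (1 : ℂ) else 0) • _ = _
    split_ifs
    · rw [one_smul]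
    · rw [laurent_zero_smul, sub_zero]
  · change 1 + ((s : ℂ) - 1) * (2 * (1 / n)) = _
    ring
  · split_ifs with h
    · exact Or.inr h.1
    · exact Or.inl rfl
  · rintro rfl
    exact infinity_hasUnitForm n hn

end Infinity

end FrobLaurent

namespace FrobLaurent

/-! ## Spaces of series at a fixed finite point -/

lemma finitelyOpen_coord_ne {ι : Type} (k : ι) : FinitelyOpen {u : ι → ℂ | u k ≠ 0} := by
  intro u n X
  have e : ∀ t : Fin n → ℂ, (u + ∑ i, t i • X i) k = u k + ∑ i, t i * X i k := by
    intro t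
    simp [Finset.sum_apply]
  simp only [Set.mem_ofPred_eq, e]
  exact isOpen_ne_fun (by fun_prop) continuous_const

lemma p_finite_pow_mem (v : ℂ) (s : ℕ) : (MarkedPoint.finite v).p ^ s ∈ ordGe 0 := by
  have h : (MarkedPoint.finite v).p ∈ ordGe 0 :=
    (ordGe 0).add_mem (C_mem_ordGe v) (ordGe_mono (by omega) (single_mem_ordGe 1 1))
  have := pow_mem_ordGe h s
  rwa [mul_zero] at this

lemma p_finite_pow_inv_mem {v : ℂ} {s : ℕ} (hs : s = 0 ∨ s = 1) (hv : s = 1 → v ≠ 0) :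
    ((MarkedPoint.finite v).p ^ s)⁻¹ ∈ ordGe 0 := by
  refine mem_ordGe_of_mul (p_finite_pow_mem v s) ?_ (b := 0) (by
    rw [mul_inv_cancel₀ ((MarkedPoint.finite v).pow_ne s), add_zero]
    exact one_mem_ordGe)
  rcases hs with rfl | rfl
  · simp
  · rw [pow_one]
    simpa [MarkedPoint.p, HahnSeries.coeff_single_of_ne] using hv rfl

lemma fixed_lam_mem (s : ℕ) (m : ℤ) (v : ℂ) (u : ℕ → ℂ) : (spaceFixed s m v).lam u ∈ ordGe (-m) :=
  series_mem_ordGe _ _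

lemma fixed_lamp_mem (s : ℕ) (m : ℤ) (v : ℂ) (u : ℕ → ℂ) :
    (spaceFixed s m v).lamp u ∈ ordGe (-m - 1) :=
  (MarkedPoint.finite v).d_mem_ordGe (fixed_lam_mem s m v u)

lemma fixed_lamp_coeff (s : ℕ) (m : ℤ) (v : ℂ) (u : ℕ → ℂ) (k : ℕ) :
    ((spaceFixed s m v).lamp u).coeff (-m - 1 + k) = (k - m) * u k := by
  have h : ((spaceFixed s m v).lamp u).coeff (-m - 1 + k)
      = _ := MarkedPoint.d_finite_coeff v (series (-m) u) (-m - 1 + k)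
  rw [h, show (-m - 1 + k + 1 : ℤ) = -m + k by ring, series_coeff_add]
  push_cast; ring

lemma fixed_lamp_coeff_zero (s : ℕ) (m : ℤ) (v : ℂ) (u : ℕ → ℂ) :
    ((spaceFixed s m v).lamp u).coeff (-m - 1) = -m * u 0 := by
  have := fixed_lamp_coeff s m v u 0
  simpa using this

section DegreeZero

variable (s : ℕ) (v : ℂ) (hs : s = 0 ∨ s = 1) (hv : s = 1 → v ≠ 0)

lemma fixed_zero_lamp_mem (u : ℕ → ℂ) : (spaceFixed s 0 v).lamp u ∈ ordGe 0 :=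
  MarkedPoint.d_finite_mem_zero (v := v) (fixed_lam_mem s 0 v u)

/-- Series of degree zero at a point where `pˢ` does not vanish. -/
def linearDegreeZero : LinearSpace (spaceFixed s 0 v) where
  ν := .finite v
  l := 0
  N := 0
  r := 0
  point_eq _ := rfl
  lam_eq u := (zero_add (series 0 u)).symm
  dlam_eq _ _ := rfl
  hs := hs
  dom_open := finitelyOpen_coord_ne 0
  pow_mem := p_finite_pow_mem v s
  inv_mem := p_finite_pow_inv_mem hs hv
  le := le_rfl
  neg_le := le_rfl
  lamp_mem u _ := fixed_zero_lamp_mem s v u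
  D_mem κ hκ := by
    have h := mul_mem_ordGe (p_finite_pow_mem v s) (MarkedPoint.d_finite_mem_zero (v := v) hκ)
    exact h
  c := 0
  kappa_mem κ _ := by
    rw [laurent_zero_smul]; exact Submodule.zero_mem _
  lam_mem u _ := mem_ordGe_sub_zero_smul (fixed_lam_mem s 0 v u)
  f _ := 0
  reg_f := RegFun.const _ _
  unit_mem u _ := mem_ordGe_sub_zero_smul one_mem_ordGe

include hs hv in
theorem degree_zero_main :
    (spaceFixed s 0 v).dom ⊆ closure (spaceFixed s 0 v).generic ∧
      ∃ F : FrobeniusData ℕ,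
        (spaceFixed s 0 v).Realizes (fun _ => 1) (spaceFixed s 0 v).lam 1 F ∧
        IsFrobeniusManifold F (spaceFixed s 0 v).generic := by
  refine ⟨(linearDegreeZero s v hs hv).dom_subset_closure_generic (Or.inl rfl) {0}
    fun u hu w hw => ?_,
    (linearDegreeZero s v hs hv).chart.frob, LaurentChart.realizes _ ?_ ?_ ?_,
    LaurentChart.isFrobeniusManifold _ ((linearDegreeZero s v hs hv).finitelyOpen_generic
      (Or.inl rfl)) (f₀ := 0) (fun _ _ => rfl) (Or.inl rfl)⟩
  · change w 0 ≠ 0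
    rw [hw 0 (Finset.mem_singleton_self 0)]
    exact hu
  · intro u _
    change 1 - (0 : ℂ) • _ = 1
    rw [laurent_zero_smul, sub_zero]
  · intro u _
    change _ - (0 : ℂ) • _ = _
    rw [laurent_zero_smul, sub_zero]
  · change 1 + ((s : ℂ) - 1) * (2 * 0) = 1
    ring

end DegreeZero

section Origin

variable (m : ℤ) (hm : -1 ≤ m) (hm0 : m ≠ 0)

lemma p_zero_pow_mem : (MarkedPoint.finite 0).p ^ 1 ∈ ordGe 1 := by
  rw [pow_one, MarkedPoint.p_zero_eq]
  exact single_mem_ordGe 1 1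

/-- Series at the origin, with respect to `p ∂/∂p`. -/
def linearOrigin : LinearSpace (spaceFixed 1 m 0) where
  ν := .finite 0
  l := 0
  N := -m
  r := 1
  point_eq _ := rfl
  lam_eq u := (zero_add (series (-m) u)).symm
  dlam_eq _ _ := rfl
  hs := Or.inr rfl
  dom_open := finitelyOpen_coord_ne 0
  pow_mem := p_zero_pow_mem
  inv_mem := by
    refine mem_ordGe_of_mul p_zero_pow_mem ?_ (b := -1) ?_
    · rw [pow_one, MarkedPoint.p_zero_eq, HahnSeries.coeff_single_same]
      exact one_ne_zero
    · exact (mul_inv_cancel₀ ((MarkedPoint.finite 0).pow_ne 1)).symm ▸ one_mem_ordGe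
  le := by rw [MarkedPoint.start]; omega
  neg_le := by rw [MarkedPoint.start]; omega
  lamp_mem u _ := ordGe_mono (by rw [MarkedPoint.start]; omega) (fixed_lamp_mem 1 m 0 u)
  D_mem κ hκ := by
    have h := mul_mem_ordGe p_zero_pow_mem ((MarkedPoint.finite 0).d_mem_ordGe hκ)
    exact ordGe_mono (by omega) h
  c := 0
  kappa_mem κ _ := by
    rw [laurent_zero_smul]; exact Submodule.zero_mem _
  lam_mem u _ := mem_ordGe_sub_zero_smul (fixed_lam_mem 1 m 0 u)
  -- For a simple zero the tangent series vanish at the origin, so the constant term of 1 must be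
  -- removed; λ_p has constant term u 0.
  f u := if m = -1 then 1 / u 0 else 0
  reg_f := by
    split_ifs
    · exact ((RegFun.coord _ 0).inv fun _ hu => hu).congr fun _ _ => one_div _
    · exact RegFun.const _ _
  unit_mem u hu := by
    have hu0 : u 0 ≠ 0 := hu
    split_ifs with h
    · subst h
      have h1 := fixed_lamp_mem 1 (-1) 0 u
      have h2 := fixed_lamp_coeff_zero 1 (-1) 0 u
      have h3 := mem_ordGe_of_coeff_eq_zero (a := 0)
        ((ordGe 0).sub_mem one_mem_ordGe ((ordGe 0).smul_mem (1 / u 0) (by simpa using h1))) (by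
          rw [HahnSeries.coeff_sub, HahnSeries.coeff_one, HahnSeries.coeff_smul]
          have h4 : ((spaceFixed 1 (-1) 0).lamp u).coeff 0 = u 0 := by simpa using h2
          rw [h4, smul_eq_mul, one_div_mul_cancel hu0, if_pos rfl, sub_self])
      simpa using h3
    · exact mem_ordGe_sub_zero_smul (ordGe_mono (by omega) one_mem_ordGe)

lemma origin_order : ∀ u ∈ (spaceFixed 1 m 0).dom, ((spaceFixed 1 m 0).lamp u).coeff
    ((linearOrigin m hm hm0).N - (linearOrigin m hm hm0).r
      - (linearOrigin m hm hm0).ν.start) ≠ 0 := by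
  intro u hu
  have hu0 : u 0 ≠ 0 := hu
  have e : (linearOrigin m hm hm0).N - (linearOrigin m hm hm0).r
      - (linearOrigin m hm hm0).ν.start = -m - 1 := sub_zero _
  rw [e, fixed_lamp_coeff_zero]
  exact mul_ne_zero (neg_ne_zero.mpr (by exact_mod_cast hm0)) hu0

/-- The unit form is p^m/(m u 0): the negative part of its product with λ_p is exactly -p^{-1}, and
multiplication by p^s = p turns this into the constant in B♯ and the unit term in B ∘ β. The error
p·B·P(λ_p β) has order at least m + 1. -/
lemma origin_hasUnitForm : HasUnitForm (linearOrigin m hm hm0).chart.frob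
    (spaceFixed 1 m 0).generic := by
  have hmC : (m : ℂ) ≠ 0 := by exact_mod_cast hm0
  set B : (ℕ → ℂ) → Laurent := fun u => (m * u 0)⁻¹ • HahnSeries.single m (1 : ℂ) with hB
  have hBm : ∀ u, B u ∈ ordGe m := fun u => (ordGe m).smul_mem _ (single_mem_ordGe m 1)
  have hreg : RegL (spaceFixed 1 m 0).dom B := by
    refine RegL.smul ((((RegFun.const _ (m : ℂ)).mul (RegFun.coord _ 0))).inv fun u hu => ?_)
      (RegL.const _ _)
    exact mul_ne_zero hmC hu
  have hQ : ∀ u ∈ (spaceFixed 1 m 0).dom,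
      (MarkedPoint.finite 0).Q ((spaceFixed 1 m 0).lamp u * B u) = -HahnSeries.single (-1) 1 := by
    intro u hu
    have hu0 : u 0 ≠ 0 := hu
    have h := mul_mem_ordGe (fixed_lamp_mem 1 m 0 u) (hBm u)
    ext i
    rw [MarkedPoint.Q_finite_coeff, HahnSeries.coeff_neg, HahnSeries.coeff_single]
    by_cases h0 : 0 ≤ i
    · rw [if_pos h0, if_neg (by omega), neg_zero]
    · rw [if_neg h0]
      by_cases h1 : i = -1
      · subst h1
        have h2 := coeff_mul_lead (fixed_lamp_mem 1 m 0 u) (hBm u)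
        rw [show -m - 1 + m = -1 by ring] at h2
        rw [h2, fixed_lamp_coeff_zero, hB, HahnSeries.coeff_smul, HahnSeries.coeff_single_same,
          smul_eq_mul, mul_one, if_pos rfl]
        field_simp
      · rw [if_neg h1, neg_zero]
        exact h i (by omega)
  have hz : (MarkedPoint.finite 0).p ^ 1 * HahnSeries.single (-1) 1 = 1 := by
    rw [pow_one, MarkedPoint.p_zero_eq, HahnSeries.single_mul_single]
    simp
  refine LaurentChart.hasUnitForm _ hreg ?_ ?_
  · intro u hu
    rw [LaurentSpace.sharp_eq]
    change (MarkedPoint.finite 0).sharpW 1 _ (B u)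
      = 1 - (if m = -1 then 1 / u 0 else (0 : ℂ)) • _
    have hP : (MarkedPoint.finite 0).P ((spaceFixed 1 m 0).lamp u * B u)
        = (spaceFixed 1 m 0).lamp u * B u + HahnSeries.single (-1) 1 := by
      have := (MarkedPoint.finite 0).P_add_Q ((spaceFixed 1 m 0).lamp u * B u)
      rw [hQ u hu] at this
      linear_combination this
    rw [MarkedPoint.sharpW, hP]
    split_ifs with h
    · have h1 : (MarkedPoint.finite 0).P (B u) = 0 := by
        ext i
        rw [MarkedPoint.P_finite_coeff, hB, HahnSeries.coeff_smul, HahnSeries.coeff_single,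
          HahnSeries.coeff_zero]
        split_ifs
        · omega
        · rw [smul_zero]
        · rfl
      have h2 : (MarkedPoint.finite 0).p ^ 1 * B u = HahnSeries.C (-(1 / u 0)) := by
        rw [hB, mul_smul_comm, h, hz, smul_eq_C_mul, mul_one]
        congr 1
        push_cast
        rw [neg_one_mul, inv_neg, one_div]
      rw [h1, mul_zero, sub_zero, mul_add, hz, smul_eq_C_mul, mul_left_comm, h2, map_neg]
      ring
    · rw [MarkedPoint.P_of_mem (ordGe_mono (by omega) (hBm u)), add_sub_cancel_left, hz,
        laurent_zero_smul, sub_zero]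
  · intro u hu β
    rw [LaurentSpace.circ_eq]
    change (MarkedPoint.finite 0).circW 1 _ (B u) β - β ∈ ordGe (2 * 0 - -m + 1)
    have h0 := (MarkedPoint.finite 0).P_add_Q ((spaceFixed 1 m 0).lamp u * B u)
    rw [hQ u hu] at h0
    have e : (MarkedPoint.finite 0).circW 1 ((spaceFixed 1 m 0).lamp u) (B u) β - β
        = (MarkedPoint.finite 0).p ^ 1
          * (B u * (MarkedPoint.finite 0).P ((spaceFixed 1 m 0).lamp u * β)) := by
      rw [MarkedPoint.circW]
      linear_combination (MarkedPoint.finite 0).p ^ 1 * β * h0 + β * hz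
    rw [e]
    have h := mul_mem_ordGe p_zero_pow_mem (mul_mem_ordGe (hBm u)
      (MarkedPoint.P_finite_mem 0 ((spaceFixed 1 m 0).lamp u * β)))
    exact ordGe_mono (by omega) h

include hm hm0 in
lemma origin_dom_subset : (spaceFixed 1 m 0).dom ⊆ closure (spaceFixed 1 m 0).generic :=
  (linearOrigin m hm hm0).dom_subset_closure_generic (Or.inr (origin_order m hm hm0)) {0}
    fun u hu w hw => by
      change w 0 ≠ 0
      rw [hw 0 (Finset.mem_singleton_self 0)]
      exact hu

lemma origin_realizes {e : (ℕ → ℂ) → Laurent}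
    (he : ∀ u, 1 - (if m = -1 then 1 / u 0 else (0 : ℂ)) • (spaceFixed 1 m 0).lamp u = e u) :
    (spaceFixed 1 m 0).Realizes e (spaceFixed 1 m 0).lam 1
      (linearOrigin m hm hm0).chart.frob := by
  refine LaurentChart.realizes _ (fun u _ => he u) ?_ ?_
  · intro u _
    change _ - (0 : ℂ) • _ = _
    rw [laurent_zero_smul, sub_zero]
  · change 1 + (((1 : ℕ) : ℂ) - 1) * (2 * 0) = 1
    ring

include hm hm0 in
lemma origin_finitelyOpen : FinitelyOpen (spaceFixed 1 m 0).generic :=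
  (linearOrigin m hm hm0).finitelyOpen_generic (Or.inr (origin_order m hm hm0))

end Origin

theorem origin_main {m : ℤ} (hm : 1 ≤ m) :
    (spaceFixed 1 m 0).dom ⊆ closure (spaceFixed 1 m 0).generic ∧
      ∃ F : FrobeniusData ℕ,
        (spaceFixed 1 m 0).Realizes (fun _ => 1) (spaceFixed 1 m 0).lam 1 F ∧
        IsFrobeniusManifold F (spaceFixed 1 m 0).generic ∧
        HasUnitForm F (spaceFixed 1 m 0).generic := by
  have h1 : -1 ≤ m := by omega
  have h0 : m ≠ 0 := by omega
  refine ⟨origin_dom_subset m h1 h0, (linearOrigin m h1 h0).chart.frob,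
    origin_realizes m h1 h0 fun u => ?_,
    LaurentChart.isFrobeniusManifold _ (origin_finitelyOpen m h1 h0) (f₀ := 0) (fun u _ => ?_)
      (Or.inl rfl), origin_hasUnitForm m h1 h0⟩
  · rw [if_neg (by omega), laurent_zero_smul, sub_zero]
  · exact if_neg (by omega)

/-- For a simple zero at the origin the unit vector field is not flat. -/
lemma not_unitFlat (hm : -1 ≤ (-1 : ℤ)) (hm0 : (-1 : ℤ) ≠ 0) :
    ¬ UnitFlat (linearOrigin (-1) hm hm0).chart.frob (linearOrigin (-1) hm hm0).chart.conn
      (spaceFixed 1 (-1) 0).generic := by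
  intro hflat
  set C := (linearOrigin (-1) hm hm0).chart with hC
  obtain ⟨u, hu⟩ : (spaceFixed 1 (-1) 0).generic.Nonempty := by
    rw [← closure_nonempty_iff]
    exact ⟨fun _ => 1, origin_dom_subset (-1) hm hm0 (one_ne_zero : (1 : ℂ) ≠ 0)⟩
  have hu0 : u 0 ≠ 0 := hu.1
  have hF := C.isFrobeniusWith (origin_finitelyOpen (-1) hm hm0)
  have htr : ∀ g : Laurent, (spaceFixed 1 (-1) 0).tr u g = g.coeff 0 := by
    intro g
    have h1 : (MarkedPoint.finite 0).p ^ 1 * (HahnSeries.single (-1) 1 * g) = g := by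
      rw [pow_one, MarkedPoint.p_zero_eq, ← mul_assoc, HahnSeries.single_mul_single]
      simp
    have h2 : (spaceFixed 1 (-1) 0).tr u g
        = (MarkedPoint.finite 0).tr 1 ((MarkedPoint.finite 0).p ^ 1 * (HahnSeries.single (-1) 1 * g))
        := by rw [h1]; rfl
    rw [h2, MarkedPoint.tr_mul, MarkedPoint.res_finite, HahnSeries.coeff_single_mul, one_mul]
    rfl
  have hsec : C.sec u (Finsupp.single 0 1) = HahnSeries.single (-1) 1 := by
    change (linearOrigin (-1) hm hm0).sec _ = _
    rw [LinearSpace.sec, Finsupp.linearCombination_single, one_smul]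
    change (MarkedPoint.finite 0).p ^ 1 * HahnSeries.single (2 * 0 - 1 - - -1 - (0 : ℕ) : ℤ) 1 = _
    rw [pow_one, MarkedPoint.p_zero_eq, HahnSeries.single_mul_single]
    norm_num
  have hf : ∀ w, C.f w = 1 / w 0 := fun w => by
    change (if (-1 : ℤ) = -1 then 1 / w 0 else (0 : ℂ)) = _
    exact if_pos rfl
  -- Testing ∇e on the differential of the leading coefficient, represented by p^{-1}, would force
  -- this linear relation on every vector a♯.
  have key : ∀ a, u 0 * C.frob.sharp u a 1 = 2 * u 1 * C.frob.sharp u a 0 := by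
    intro a
    set S := (spaceFixed 1 (-1) 0).sharp u (C.sec u a) with hS
    have hX : ∀ k : ℕ, C.frob.sharp u a k = S.coeff (1 + k) := fun k => rfl
    have h1 := C.pair_nablaVec_e hu.1 a (Finsupp.single 0 1)
    have h2 : dirFun (C.frob.sharp u a) C.f u = -(C.frob.sharp u a 0) / u 0 ^ 2 := by
      have h := HasDerivAt.fun_inv (hasLineDerivAt_coord (0 : ℕ) u (C.frob.sharp u a)) (by simpa)
      have h' := h.deriv
      have e : C.f = fun w => (w 0)⁻¹ := by
        funext w
        rw [hf, one_div]
      rw [e]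
      refine h'.trans ?_
      simp
    have h4 : nablaVec C.frob C.conn a C.e u = 0 := hflat u hu a
    rw [h4, hsec, h2, hf, htr, htr, htr, ← hS, pair_single_left, Pi.zero_apply, coeff_mul_single,
      coeff_mul_single] at h1
    have h5 : ((spaceFixed 1 (-1) 0).lamp u).coeff (0 - -1) = 2 * u 1 := by
      have := fixed_lamp_coeff 1 (-1) 0 u 1
      norm_num at this ⊢
      exact this
    have h6 : ((spaceFixed 1 (-1) 0).point u).d S = (MarkedPoint.finite 0).d S := rfl
    have h7 : ((spaceFixed 1 (-1) 0).point u).d (HahnSeries.single (-1) 1)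
        = HahnSeries.single (-2) (-1) := by
      ext i
      change ((MarkedPoint.finite 0).d (HahnSeries.single (-1) 1)).coeff i = _
      rw [MarkedPoint.d_finite_coeff, HahnSeries.coeff_single, HahnSeries.coeff_single]
      by_cases h : i = -2
      · subst h; norm_num
      · rw [if_neg (by omega), if_neg h, mul_zero]
    rw [h5, h6, h7, HahnSeries.coeff_single_mul, MarkedPoint.d_finite_coeff] at h1
    rw [hX, hX] at *
    norm_num at h1 ⊢
    field_simp at h1
    linear_combination h1
  -- By symmetry of the metric the relation says that u₀ du₁ - 2u₁ du₀ (coordinates numbered from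
  -- the leading one) is in the kernel of ♯. This contradicts nondegeneracy since u₀ ≠ 0.
  have h0 : C.frob.sharp u (u 0 • Finsupp.single 1 1 - (2 * u 1) • Finsupp.single 0 1) = 0 := by
    refine vec_ext fun a => ?_
    have h1 := hF.eta_symm u hu a (u 0 • Finsupp.single 1 1 - (2 * u 1) • Finsupp.single 0 1)
    rw [eta, eta] at h1
    rw [← h1, pair_sub_left, pair_smul_left, pair_smul_left, pair_single_left, pair_single_left,
      key, sub_self, pair_eq_sum a _ subset_rfl]
    simp
  have h1 := hF.eta_nondeg u hu (h0.trans (map_zero _).symm)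
  have h2 := congrArg (fun a : ℕ →₀ ℂ => a 1) h1
  simp at h2
  exact hu0 h2

theorem simple_zero_main :
    (spaceFixed 1 (-1) 0).dom ⊆ closure (spaceFixed 1 (-1) 0).generic ∧
      ∃ F : FrobeniusData ℕ,
        (spaceFixed 1 (-1) 0).Realizes
          (fun u => 1 - (1 / u 0) • (spaceFixed 1 (-1) 0).lamp u) (spaceFixed 1 (-1) 0).lam 1 F ∧
        IsFrobeniusManifoldNonflatUnit F (spaceFixed 1 (-1) 0).generic ∧
        HasUnitForm F (spaceFixed 1 (-1) 0).generic := by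
  have hm : -1 ≤ (-1 : ℤ) := le_rfl
  have hm0 : (-1 : ℤ) ≠ 0 := by norm_num
  exact ⟨origin_dom_subset _ hm hm0, (linearOrigin _ hm hm0).chart.frob,
    origin_realizes _ hm hm0 fun u => by rw [if_pos rfl],
    ⟨(linearOrigin _ hm hm0).chart.conn,
      LaurentChart.isFrobeniusWith _ (origin_finitelyOpen _ hm hm0), not_unitFlat hm hm0⟩,
    origin_hasUnitForm _ hm hm0⟩

end FrobLaurent

namespace FrobLaurent

/-! ## Spaces of series at a moving point -/

section Moving

variable {s : ℕ} {m : ℤ}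

lemma moving_lam_mem (u : Option ℕ → ℂ) : (spaceMoving s m).lam u ∈ ordGe (-m) :=
  series_mem_ordGe _ _

lemma moving_lamp_mem (u : Option ℕ → ℂ) : (spaceMoving s m).lamp u ∈ ordGe (-m - 1) :=
  fixed_lamp_mem s m (u none) fun k => u (some k)

lemma moving_lamp_coeff_zero (u : Option ℕ → ℂ) :
    ((spaceMoving s m).lamp u).coeff (-m - 1) = -m * u (some 0) :=
  fixed_lamp_coeff_zero s m (u none) fun k => u (some k)

lemma moving_dlam (u X : Option ℕ → ℂ) : (spaceMoving s m).dlam u X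
    = (series (-m) fun k => X (some k)) - X none • (spaceMoving s m).lamp u := rfl

lemma moving_dlam_coeff (u X : Option ℕ → ℂ) (k : ℕ) : ((spaceMoving s m).dlam u X).coeff (-m + k)
    = X (some k) - X none * ((spaceMoving s m).lamp u).coeff (-m + k) := by
  rw [moving_dlam, HahnSeries.coeff_sub, series_coeff_add, HahnSeries.coeff_smul, smul_eq_mul]

lemma moving_dlam_coeff_lead (u X : Option ℕ → ℂ) :
    ((spaceMoving s m).dlam u X).coeff (-m - 1) = X none * (m * u (some 0)) := by
  rw [moving_dlam, HahnSeries.coeff_sub, series_mem_ordGe _ _ _ (by omega), HahnSeries.coeff_smul,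
    smul_eq_mul, moving_lamp_coeff_zero]
  ring

lemma moving_dlam_mem (u X : Option ℕ → ℂ) : (spaceMoving s m).dlam u X ∈ ordGe (-m - 1) :=
  (ordGe _).sub_mem (ordGe_mono (by omega) (series_mem_ordGe _ _))
    ((ordGe _).smul_mem _ (moving_lamp_mem (s := s) u))

lemma FinitelyOpen.inter {ι : Type} {M N : Set (ι → ℂ)} (hM : FinitelyOpen M)
    (hN : FinitelyOpen N) : FinitelyOpen (M ∩ N) := fun u k X => (hM u k X).inter (hN u k X)

lemma moving_dom_open (s : ℕ) (m : ℤ) : FinitelyOpen (spaceMoving s m).dom := by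
  by_cases hs : s = 1
  · have e : (spaceMoving s m).dom = {u | u (some 0) ≠ 0} ∩ {u | u none ≠ 0} := by
      ext u
      exact ⟨fun h => ⟨h.1, h.2 hs⟩, fun h => ⟨h.1, fun _ => h.2⟩⟩
    rw [e]
    exact (finitelyOpen_coord_ne _).inter (finitelyOpen_coord_ne _)
  · have e : (spaceMoving s m).dom = {u | u (some 0) ≠ 0} := by
      ext u
      exact ⟨fun h => h.1, fun h => ⟨h, fun h' => absurd h' hs⟩⟩
    rw [e]
    exact finitelyOpen_coord_ne _

lemma moving_reg_lam : RegL (spaceMoving s m).dom (spaceMoving s m).lam := reg_series _ _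

lemma moving_reg_lamp : RegL (spaceMoving s m).dom (spaceMoving s m).lamp :=
  moving_reg_lam.d (.finite 0)

lemma moving_reg_p : RegL (spaceMoving s m).dom fun w => ((spaceMoving s m).point w).p := by
  refine RegL.add ⟨⟨0, fun u _ => C_mem_ordGe _⟩, fun i => ?_⟩ (RegL.const _ _)
  simp only [coeff_C']
  split_ifs
  · exact RegFun.coord _ _
  · exact RegFun.const _ _

lemma p_inv_eq {v : ℂ} (hv : v ≠ 0) :
    (MarkedPoint.finite v).p⁻¹ = series 0 fun k => (-1) ^ k * v⁻¹ ^ (k + 1) := by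
  refine inv_eq_of_mul_eq_one_right ?_
  ext i
  rw [MarkedPoint.p_finite_mul_coeff, HahnSeries.coeff_one]
  rcases lt_trichotomy i 0 with h | rfl | h
  · rw [series_mem_ordGe _ _ _ h, series_mem_ordGe _ _ _ (by omega), if_neg h.ne]
    simp
  · rw [series_mem_ordGe _ _ (0 - 1) (by omega), series_coeff]
    simp [hv]
  · obtain ⟨k, rfl⟩ : ∃ k : ℕ, i = k + 1 := ⟨(i - 1).toNat, by omega⟩
    rw [series_coeff, series_coeff, if_pos (by omega), if_pos (by omega), if_neg (by omega)]
    rw [show ((k + 1 : ℤ) - 0).toNat = k + 1 by omega, show ((k + 1 : ℤ) - 1 - 0).toNat = k by omega]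
    linear_combination (-(-1) ^ k * v⁻¹ ^ (k + 1)) * mul_inv_cancel₀ hv

lemma moving_reg_inv (hs : s = 0 ∨ s = 1) :
    RegL (spaceMoving s m).dom fun w => (((spaceMoving s m).point w).p ^ s)⁻¹ := by
  rcases hs with rfl | rfl
  · simp only [pow_zero]
    exact RegL.const _ _
  · have h : RegL (spaceMoving 1 m).dom
        fun w => series 0 fun k => (-1) ^ k * (w none)⁻¹ ^ (k + 1) := by
      refine ⟨⟨0, fun u _ => series_mem_ordGe _ _⟩, fun i => ?_⟩
      simp only [series_coeff]
      split_ifs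
      · have hi : RegFun (spaceMoving 1 m).dom fun u => (u none)⁻¹ :=
          (RegFun.coord _ none).inv fun u hu => hu.2 rfl
        have hpow : ∀ n : ℕ, RegFun (spaceMoving 1 m).dom fun u => (u none)⁻¹ ^ n := by
          intro n
          induction n with
          | zero => simpa only [pow_zero] using RegFun.const _ 1
          | succ n ih => simpa only [pow_succ] using ih.mul hi
        exact (RegFun.const _ _).mul (hpow _)
      · exact RegFun.const _ _
    refine h.congr fun w hw => ?_
    rw [pow_one]
    exact p_inv_eq (hw.2 rfl)

/-- The coordinates of a tangent vector. -/
def movingCoords (m : ℤ) (u : Option ℕ → ℂ) : Laurent →ₗ[ℂ] (Option ℕ → ℂ) where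
  -- The coefficient of (p - v)^(-m-1) comes from the motion of the point alone, through -λ_p with
  -- leading coefficient m u₀. Once this velocity is known, its contribution to the other
  -- coefficients is removed.
  toFun f i := i.elim (f.coeff (-m - 1) * (m * u (some 0))⁻¹) fun k => f.coeff (-m + k)
    + f.coeff (-m - 1) * (m * u (some 0))⁻¹ * ((spaceMoving 0 m).lamp u).coeff (-m + k)
  map_add' f g := by
    ext i
    rw [Pi.add_apply]
    cases i <;> simp only [Option.elim, HahnSeries.coeff_add] <;> ring
  map_smul' c f := by
    ext i
    rw [Pi.smul_apply]
    cases i <;> simp only [Option.elim, HahnSeries.coeff_smul, RingHom.id_apply, smul_eq_mul] <;>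
      ring

lemma movingCoords_none (u : Option ℕ → ℂ) (f : Laurent) :
    movingCoords m u f none = f.coeff (-m - 1) * (m * u (some 0))⁻¹ := rfl

lemma movingCoords_some (u : Option ℕ → ℂ) (f : Laurent) (k : ℕ) :
    movingCoords m u f (some k) = f.coeff (-m + k)
      + f.coeff (-m - 1) * (m * u (some 0))⁻¹ * ((spaceMoving s m).lamp u).coeff (-m + k) := rfl

lemma moving_ne (hm0 : m ≠ 0) {u : Option ℕ → ℂ} (hu : u ∈ (spaceMoving s m).dom) :
    (m : ℂ) * u (some 0) ≠ 0 := mul_ne_zero (by exact_mod_cast hm0) hu.1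

lemma moving_dlam_coords (hm0 : m ≠ 0) {u : Option ℕ → ℂ} (hu : u ∈ (spaceMoving s m).dom)
    {f : Laurent} (hf : f ∈ ordGe (-m - 1)) :
    (spaceMoving s m).dlam u (movingCoords m u f) = f := by
  have h0 := moving_ne hm0 hu
  ext i
  rcases (show i < -m - 1 ∨ i = -m - 1 ∨ -m ≤ i by omega) with h | rfl | h
  · rw [hf i h, moving_dlam_mem _ _ i h]
  · rw [moving_dlam_coeff_lead, movingCoords_none, inv_mul_cancel_right₀ h0]
  · obtain ⟨k, rfl⟩ : ∃ k : ℕ, i = -m + k := ⟨(i + m).toNat, by omega⟩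
    rw [moving_dlam_coeff, movingCoords_none, movingCoords_some (s := s)]
    ring

lemma moving_reg_ne_inv (hm0 : m ≠ 0) :
    RegFun (spaceMoving s m).dom fun u => (m * u (some 0) : ℂ)⁻¹ :=
  ((RegFun.const _ (m : ℂ)).mul (RegFun.coord _ _)).inv fun _ hu => moving_ne hm0 hu

lemma moving_reg_coords (hm0 : m ≠ 0) {y : (Option ℕ → ℂ) → Laurent}
    (hy : RegL (spaceMoving s m).dom y) :
    RegVec (spaceMoving s m).dom fun u => movingCoords m u (y u) := by
  have h := (hy.2 (-m - 1)).mul (moving_reg_ne_inv hm0)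
  intro i
  cases i with
  | none => exact h
  | some k => exact (hy.2 (-m + k)).add (h.mul (moving_reg_lamp.2 (-m + k)))

/-- Representatives of covectors. -/
def movingSec (s : ℕ) (m : ℤ) (u : Option ℕ → ℂ) : (Option ℕ →₀ ℂ) →ₗ[ℂ] Laurent :=
  Finsupp.linearCombination ℂ fun i : Option ℕ => (MarkedPoint.finite (u none)).p ^ s *
    -- The monomial of exponent m detects the leading coefficient, hence the velocity of v. The
    -- other monomials detect a coefficient of the tangent vector, and the multiple of the first
    -- corrects for the part due to the moving point.
    i.elim ((m * u (some 0) : ℂ)⁻¹ • HahnSeries.single m (1 : ℂ)) fun k : ℕ =>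
      HahnSeries.single (m - 1 - k) (1 : ℂ) + (((spaceMoving s m).lamp u).coeff (-m + k)
        * (m * u (some 0) : ℂ)⁻¹) • HahnSeries.single m (1 : ℂ)

lemma moving_reg_sec (hm0 : m ≠ 0) (a : Option ℕ →₀ ℂ) :
    RegL (spaceMoving s m).dom fun u => movingSec s m u a := by
  induction a using Finsupp.induction_linear with
  | zero =>
    simp only [map_zero]
    exact RegL.const _ 0
  | add a b ha hb =>
    simp only [map_add]
    exact ha.add hb
  | single i c =>
    simp only [movingSec, Finsupp.linearCombination_single]
    refine RegL.smul (RegFun.const _ c) ((moving_reg_p.pow s).mul ?_)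
    have h := moving_reg_ne_inv (s := s) hm0
    cases i with
    | none => exact RegL.smul h (RegL.const _ _)
    | some k =>
      exact (RegL.const _ _).add
        (RegL.smul ((moving_reg_lamp.2 (-m + k)).mul h) (RegL.const _ _))

lemma moving_rep_sec (hm0 : m ≠ 0) {u : Option ℕ → ℂ} (hu : u ∈ (spaceMoving s m).dom)
    (a : Option ℕ →₀ ℂ) : (spaceMoving s m).Represents u a (movingSec s m u a) := by
  have h0 := moving_ne hm0 hu
  intro X
  have hsingle : ∀ (j : ℤ) (c : ℂ), (MarkedPoint.finite (u none)).res
      ((spaceMoving s m).dlam u X * c • HahnSeries.single j (1 : ℂ))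
      = c * ((spaceMoving s m).dlam u X).coeff (-1 - j) := by
    intro j c
    rw [mul_smul_comm, map_smul, smul_eq_mul, MarkedPoint.res_finite, coeff_mul_single]
  have hlead : ∀ c : ℂ, (MarkedPoint.finite (u none)).res
      ((spaceMoving s m).dlam u X * (c * (m * u (some 0) : ℂ)⁻¹) • HahnSeries.single m (1 : ℂ))
      = c * X none := by
    intro c
    rw [hsingle, show -1 - m = -m - 1 by ring, moving_dlam_coeff_lead]
    linear_combination c * X none * inv_mul_cancel₀ h0
  induction a using Finsupp.induction_linear with
  | zero =>
    rw [map_zero, mul_zero, pair_zero_left, LaurentSpace.tr_zero]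
  | add a b ha hb =>
    rw [pair_add_left, ha, hb, map_add, mul_add, LaurentSpace.tr_add]
  | single i c =>
    have e : (Finsupp.single i c : Option ℕ →₀ ℂ) = c • Finsupp.single i 1 := by simp
    rw [e, map_smul, pair_smul_left, pair_single_left, mul_smul_comm, LaurentSpace.tr_smul,
      movingSec, Finsupp.linearCombination_single, one_smul]
    congr 1
    change X i = (MarkedPoint.finite (u none)).tr s _
    rw [MarkedPoint.tr_mul']
    cases i with
    | none =>
      have := hlead 1
      rw [one_mul, one_mul] at this
      exact this.symm
    | some k =>
      have h1 := hsingle (m - 1 - k) 1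
      rw [one_smul, one_mul, show -1 - (m - 1 - k) = -m + k by ring, moving_dlam_coeff] at h1
      change _ = (MarkedPoint.finite (u none)).res ((spaceMoving s m).dlam u X *
        (HahnSeries.single (m - 1 - k : ℤ) (1 : ℂ) + _))
      rw [mul_add, map_add, h1, hlead]
      ring

lemma moving_inv_mem (hs : s = 0 ∨ s = 1) {u : Option ℕ → ℂ} (hu : u ∈ (spaceMoving s m).dom)
    {α : Laurent} {M : ℤ} :
    ((MarkedPoint.finite (u none)).p ^ s)⁻¹ * α ∈ ordGe M ↔ α ∈ ordGe M := by
  constructor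
  · intro h
    have h1 := mul_mem_ordGe (p_finite_pow_mem (u none) s) h
    rwa [mul_inv_cancel_left₀ (MarkedPoint.pow_ne _ _), zero_add] at h1
  · intro h
    have h1 := mul_mem_ordGe (p_finite_pow_inv_mem hs hu.2) h
    rwa [zero_add] at h1

/-- Varying the coefficients alone gives order at least m. The motion of the point adds a tangent
vector of order -m - 1, whose leading coefficient is nonzero for m ≠ 0, and this removes one more
coefficient. -/
lemma moving_perp (hs : s = 0 ∨ s = 1) (hm0 : m ≠ 0) {u : Option ℕ → ℂ}
    (hu : u ∈ (spaceMoving s m).dom) (α : Laurent) :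
    (∀ X, (spaceMoving s m).tr u ((spaceMoving s m).dlam u X * α) = 0) ↔ α ∈ ordGe (m + 1) := by
  have e : ∀ X, (spaceMoving s m).tr u ((spaceMoving s m).dlam u X * α)
      = ((spaceMoving s m).dlam u X * (((MarkedPoint.finite (u none)).p ^ s)⁻¹ * α)).coeff (-1) := by
    intro X
    change (MarkedPoint.finite (u none)).tr s _ = _
    rw [MarkedPoint.tr_eq, MarkedPoint.res_finite]
    congr 1; ring
  rw [← moving_inv_mem hs hu]
  simp only [e]
  constructor
  · intro h
    have h1 : ((MarkedPoint.finite (u none)).p ^ s)⁻¹ * α ∈ ordGe m := by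
      intro i hi
      have h2 := h (Pi.single (some (m - 1 - i).toNat) 1)
      have e2 : (fun k => (Pi.single (some (m - 1 - i).toNat) 1 : Option ℕ → ℂ) (some k))
          = Pi.single (m - 1 - i).toNat 1 := by
        funext k
        simp only [Pi.single_apply, Option.some_inj]
      rw [moving_dlam, e2, Pi.single_eq_of_ne (by simp), laurent_zero_smul, sub_zero, series_single,
        HahnSeries.coeff_single_mul, one_mul] at h2
      rw [← h2]
      congr 1
      omega
    refine mem_ordGe_of_coeff_eq_zero h1 ?_
    have h2 := h (Pi.single none 1)
    have h3 := coeff_mul_lead (moving_dlam_mem (s := s) (m := m) u (Pi.single none 1)) h1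
    rw [show -m - 1 + m = -1 by ring, h2, moving_dlam_coeff_lead, Pi.single_eq_same, one_mul] at h3
    exact (mul_eq_zero.mp h3.symm).resolve_left (moving_ne hm0 hu)
  · intro h X
    exact mul_mem_ordGe (moving_dlam_mem u X) h _ (by omega)

/-- For m ≥ 1 both terms have order m, and the coefficient at m must cancel. It does because α♯
moves the point v with velocity v^s times the constant term of the nonnegative part of α. -/
lemma moving_conn_mem (hm : -1 ≤ m) (hm0 : m ≠ 0) {u : Option ℕ → ℂ}
    (hu : u ∈ (spaceMoving s m).dom) {κ : Laurent} (hκ : κ ∈ ordGe (m + 1)) (α : Laurent) :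
    (MarkedPoint.finite (u none)).star α ((MarkedPoint.finite (u none)).D s κ)
      - (((spaceMoving s m).sharp u α).coeff (-m - 1) * (m * u (some 0))⁻¹)
        • (MarkedPoint.finite 0).d κ ∈ ordGe (m + 1) := by
  have h0 := moving_ne hm0 hu
  have hq := p_finite_pow_mem (u none) s
  rw [MarkedPoint.star_comm]
  -- For m = -1 the annihilator consists of all series without polar part, which differentiation
  -- preserves, so no cancellation is needed.
  rcases (show m = -1 ∨ 1 ≤ m by omega) with rfl | hm1
  · have hd : ∀ v, (MarkedPoint.finite v).d κ ∈ ordGe 0 := fun v => MarkedPoint.d_finite_mem_zero hκ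
    have hD : (MarkedPoint.finite (u none)).D s κ ∈ ordGe 0 := mul_mem_ordGe hq (hd _)
    exact (ordGe 0).sub_mem (MarkedPoint.star_mem_ordGe (.finite (u none)) (M := 0)
      le_rfl hD α) ((ordGe 0).smul_mem _ (hd 0))
  · have hd : ∀ v, (MarkedPoint.finite v).d κ ∈ ordGe m := fun v => by
      have := (MarkedPoint.finite v).d_mem_ordGe hκ
      rwa [add_sub_cancel_right] at this
    have hD : (MarkedPoint.finite (u none)).D s κ ∈ ordGe m := by
      have := mul_mem_ordGe hq (hd (u none))
      rwa [zero_add] at this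
    have hD0 : (MarkedPoint.finite (u none)).D s κ ∈ ordGe 0 := ordGe_mono (by omega) hD
    refine mem_ordGe_of_coeff_eq_zero ((ordGe m).sub_mem
      (MarkedPoint.star_mem_ordGe _ (by rw [MarkedPoint.start]; omega) hD α)
      ((ordGe m).smul_mem _ (hd 0))) ?_
    have hP := MarkedPoint.P_finite_mem (u none) α
    have h1 := coeff_mul_lead hD hP
    have h2 := coeff_mul_lead hq (hd (u none))
    have h3 := coeff_mul_lead (moving_lamp_mem (s := s) (m := m) u) hP
    have hP' := MarkedPoint.P_finite_mem (u none) ((spaceMoving s m).lamp u * α)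
    have h4 := coeff_mul_lead hq ((ordGe (-m - 1)).sub_mem (ordGe_mono (by omega) hP')
      (by simpa using mul_mem_ordGe (moving_lamp_mem (s := s) (m := m) u) hP))
    rw [add_zero] at h1 h3
    rw [zero_add] at h2 h4
    have h5 : ((spaceMoving s m).sharp u α).coeff (-m - 1) = _ :=
      (congrArg (fun f : Laurent => f.coeff (-m - 1)) (LaurentSpace.sharp_eq u α)).trans h4
    have h6 : ((MarkedPoint.finite (u none)).D s κ).coeff m = _ := h2
    have h7 : (MarkedPoint.finite (u none)).d κ = (MarkedPoint.finite 0).d κ := rfl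
    rw [HahnSeries.coeff_sub, MarkedPoint.star, MarkedPoint.P_of_mem hD0, MarkedPoint.Q_of_mem hD0,
      zero_mul, sub_zero, h1, HahnSeries.coeff_smul, smul_eq_mul, h5, h6, HahnSeries.coeff_sub, h3,
      hP' _ (by omega), moving_lamp_coeff_zero, h7]
    linear_combination (-((MarkedPoint.finite (u none)).p ^ s).coeff 0
      * ((MarkedPoint.finite 0).d κ).coeff m * ((MarkedPoint.finite (u none)).P α).coeff 0)
      * mul_inv_cancel₀ h0

/-- The chart of a space of series at a moving point. -/
def movingChart (hs : s = 0 ∨ s = 1) (hm : -1 ≤ m) (hm0 : m ≠ 0) :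
    LaurentChart (spaceMoving s m) where
  -- Any finite point would do: the projections, the derivative and the residue are the same at all
  -- of them.
  ν := .finite 0
  j := some none
  kind _ := ⟨rfl, rfl, rfl⟩
  hs := hs
  dom_open := moving_dom_open s m
  reg_p := moving_reg_p
  hasD_p u hu X := by
    obtain ⟨N, hN⟩ := (moving_reg_p (s := s) (m := m)).1
    refine ⟨⟨N, ((moving_dom_open s m).eventually hu X).mono fun t ht => hN _ ht⟩, fun i => ?_⟩
    have h1 : (MarkedPoint.finite 0).d ((spaceMoving s m).point u).p = 1 :=
      (MarkedPoint.finite (u none)).d_p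
    have h2 : vel (some none) X = X none := rfl
    rw [h1, h2, zero_add, HahnSeries.coeff_smul, HahnSeries.coeff_one]
    have h3 : ∀ w : Option ℕ → ℂ, (((spaceMoving s m).point w).p).coeff i
        = (if i = 0 then w none else 0) + (HahnSeries.single 1 1 : Laurent).coeff i := by
      intro w
      change (HahnSeries.C (w none) + HahnSeries.single 1 1 : Laurent).coeff i = _
      rw [HahnSeries.coeff_add, coeff_C']
    simp only [h3]
    refine HasDerivAt.add_const _ ?_
    split_ifs
    · rw [smul_eq_mul, mul_one]
      exact hasLineDerivAt_coord none u X
    · rw [smul_zero]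
      exact hasDerivAt_const _ _
  reg_inv := moving_reg_inv hs
  reg_lam := moving_reg_lam
  hasD_lam u hu X := by
    refine ⟨⟨-m, Filter.Eventually.of_forall fun t => moving_lam_mem _⟩, fun i => ?_⟩
    have h1 : (spaceMoving s m).dlam u X
        + vel (some none) X • (MarkedPoint.finite 0).d ((spaceMoving s m).lam u)
        = series (-m) fun k => X (some k) := sub_add_cancel _ _
    rw [h1]
    exact hasLineDerivAt_series (-m) some u X i
  dlam_add u X Y := by
    have h : (series (-m) fun k => (X + Y) (some k))
        = (series (-m) fun k => X (some k)) + series (-m) fun k => Y (some k) :=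
      map_add (seriesL (-m)) (fun k => X (some k)) fun k => Y (some k)
    rw [moving_dlam, moving_dlam, moving_dlam, h, Pi.add_apply, smul_eq_C_mul, smul_eq_C_mul,
      smul_eq_C_mul, map_add]
    ring
  fin N := by
    set K := (-1 - N + m + 1).toNat with hK
    refine ⟨Finset.insertNone (Finset.range K), fun u f hf X => ?_⟩
    have h1 : ∀ Y : Option ℕ → ℂ, (MarkedPoint.finite 0).res ((spaceMoving s m).dlam u Y * f)
        = ∑ k ∈ Finset.range K, Y (some k) * f.coeff (-1 - -m - k)
          - Y none * ((spaceMoving s m).lamp u * f).coeff (-1) := by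
      intro Y
      rw [MarkedPoint.res_finite, moving_dlam, sub_mul, HahnSeries.coeff_sub,
        coeff_series_mul _ hf _ (K := K) (by omega), smul_mul_assoc, HahnSeries.coeff_smul,
        smul_eq_mul]
    rw [Finset.sum_insertNone, h1 X, h1 (Pi.single none 1)]
    have h2 : ∀ k ∈ Finset.range K, X (some k) * (MarkedPoint.finite 0).res
        ((spaceMoving s m).dlam u (Pi.single (some k) 1) * f)
        = X (some k) * f.coeff (-1 - -m - k) := by
      intro k hk
      rw [h1, Finset.sum_eq_single_of_mem k hk, Pi.single_eq_same, Pi.single_eq_of_ne (by simp)]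
      · ring
      · intro b _ hb
        rw [Pi.single_eq_of_ne (by simpa using hb), zero_mul]
    rw [Finset.sum_congr rfl h2, Pi.single_eq_same]
    have h3 : ∑ k ∈ Finset.range K, (Pi.single none 1 : Option ℕ → ℂ) (some k)
        * f.coeff (-1 - -m - k) = 0 :=
      Finset.sum_eq_zero fun k _ => by rw [Pi.single_eq_of_ne (by simp), zero_mul]
    rw [h3]
    ring
  sec := movingSec s m
  reg_sec := moving_reg_sec hm0
  sec_rep _ hu := moving_rep_sec hm0 hu
  vec := movingCoords m
  reg_vec _ hy := moving_reg_coords hm0 hy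
  dlam_sharp u hu α := by
    refine moving_dlam_coords hm0 hu ?_
    rw [LaurentSpace.sharp_eq]
    exact MarkedPoint.sharpW_mem_ordGe _ (p_finite_pow_mem (u none) s)
      (by change -m - 1 ≤ 0 + 0; omega)
      (ordGe_mono (by change -m - 1 - 0 - 0 ≤ -m - 1; omega) (moving_lamp_mem u)) α
  I := ordGe (m + 1)
  perp _ hu := moving_perp hs hm0 hu
  star_mem _ _ κ hκ g := MarkedPoint.star_mem_ordGe (.finite _) (by change 0 ≤ m + 1; omega) hκ _
  conn_mem _ hu κ hκ α := moving_conn_mem hm hm0 hu hκ α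
  circ_mem u _ κ hκ β := by
    rw [LaurentSpace.circ_eq]
    refine MarkedPoint.circW_mem_ordGe (.finite _) (p_finite_pow_mem (u none) s)
      (by change 0 ≤ m + 1; omega) hκ ?_ β
    have h := mul_mem_ordGe (moving_lamp_mem (s := s) (m := m) u) hκ
    exact ordGe_mono (by change (0 : ℤ) ≤ _; omega) h
  c := 0
  E u i := i.elim 0 fun k => u (some k)
  reg_E i := by
    cases i with
    | none => exact RegFun.const _ 0
    | some k => exact RegFun.coord _ _
  dlam_E u _ := by
    rw [moving_dlam]
    change _ - (0 : ℂ) • _ = _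
    rw [laurent_zero_smul, laurent_zero_smul]
    rfl
  kappa_mem u _ κ hκ := by
    change _ - (0 : ℂ) • _ ∈ _
    rw [laurent_zero_smul, sub_zero, MarkedPoint.kappa, laurent_zero_smul, add_zero]
    exact Submodule.smul_mem _ _ hκ
  e u := movingCoords m u 1
  reg_e := moving_reg_coords hm0 (RegL.const _ 1)
  f _ := 0
  reg_f := RegFun.const _ 0
  dlam_e u hu := by
    rw [laurent_zero_smul, sub_zero]
    exact moving_dlam_coords hm0 hu (ordGe_mono (by omega) one_mem_ordGe)

/-- The linear map `λ ↦ λ_p`. -/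
def movingLampL (m : ℤ) : (Option ℕ → ℂ) →ₗ[ℂ] Laurent :=
  (MarkedPoint.finite 0).d ∘ₗ seriesL (-m) ∘ₗ LinearMap.funLeft ℂ ℂ some

lemma moving_mem_generic_iff (hs : s = 0 ∨ s = 1) (hm : -1 ≤ m) (hm0 : m ≠ 0) :
    ∀ u ∈ (spaceMoving s m).dom,
      u ∈ (spaceMoving s m).generic ↔ (spaceMoving s m).lamp u ∉ rationalSeries := by
  intro u hu
  refine (movingChart hs hm hm0).mem_generic_iff hu rfl fun α _ hwα => ?_
  refine mem_ordGe_of_mul (moving_lamp_mem (s := s) (m := m) u) ?_ (b := m + 1) ?_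
  · rw [moving_lamp_coeff_zero, neg_mul]
    exact neg_ne_zero.mpr (moving_ne hm0 hu)
  · have e : (-m - 1 + (m + 1) : ℤ) = 0 := by ring
    rw [e]
    exact hwα

lemma moving_lamp_eq (u : Option ℕ → ℂ) : (spaceMoving s m).lamp u = 0 + movingLampL m u :=
  (zero_add _).symm

theorem moving_main (hs : s = 0 ∨ s = 1) (hm : -1 ≤ m) (hm0 : m ≠ 0) :
    (spaceMoving s m).dom ⊆ closure (spaceMoving s m).generic ∧
      ∃ F : FrobeniusData (Option ℕ),
        (spaceMoving s m).Realizes (fun _ => 1) (spaceMoving s m).lam 1 F ∧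
        IsFrobeniusManifold F (spaceMoving s m).generic := by
  refine ⟨LaurentSpace.dom_subset_closure_generic (movingLampL m) 0 moving_lamp_eq
      (moving_mem_generic_iff hs hm hm0) {some 0, none} (fun u hu w hw => ⟨?_, ?_⟩) fun S => ?_,
    (movingChart hs hm hm0).frob, LaurentChart.realizes _ ?_ ?_ ?_,
    LaurentChart.isFrobeniusManifold _ (LaurentSpace.finitelyOpen_generic (moving_dom_open s m)
      (movingLampL m) 0 moving_lamp_eq (moving_mem_generic_iff hs hm hm0)) (f₀ := 0)
      (fun _ _ => rfl) (Or.inl rfl)⟩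
  · rw [hw (some 0) (by simp)]
    exact hu.1
  · intro h1
    rw [hw none (by simp)]
    exact hu.2 h1
  · refine ⟨fun i => i.elim 0 (lacunary ((Finset.eraseNone S).sup id + 1)), fun i hi => ?_,
      d_series_lacunary (.finite 0) (-m) _⟩
    cases i with
    | none => rfl
    | some k =>
      have : k ≤ (Finset.eraseNone S).sup id :=
        Finset.le_sup (f := id) (Finset.mem_eraseNone.mpr hi)
      change lacunary _ k = 0
      rw [lacunary, if_neg (by omega)]
  · intro u _
    change 1 - (0 : ℂ) • _ = 1
    rw [laurent_zero_smul, sub_zero]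
  · intro u _
    change _ - (0 : ℂ) • _ = _
    rw [laurent_zero_smul, sub_zero]
  · change 1 + ((s : ℂ) - 1) * (2 * 0) = 1
    ring

end Moving

end FrobLaurent

end

theorem mainTheorem4 (s : ℕ) (hs : s = 0 ∨ s = 1) :
    -- at infinity
    (∀ n : ℕ, 1 ≤ n →
      (FrobLaurent.spaceInfinity s n).dom ⊆ closure (FrobLaurent.spaceInfinity s n).generic ∧
      ∃ F : FrobLaurent.FrobeniusData ℕ,
        (FrobLaurent.spaceInfinity s n).Realizes
          (fun u => if s = 0 ∧ n = 1 then 1 - (FrobLaurent.spaceInfinity s n).lamp u else 1)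
          (fun u => (FrobLaurent.spaceInfinity s n).lam u
            - (1 / (n : ℂ)) • (FrobLaurent.MarkedPoint.infinity.p
                * (FrobLaurent.spaceInfinity s n).lamp u))
          (1 + ((s : ℂ) - 1) * (2 / (n : ℂ))) F ∧
        FrobLaurent.IsFrobeniusManifold F (FrobLaurent.spaceInfinity s n).generic ∧
        (s = 0 → FrobLaurent.HasUnitForm F (FrobLaurent.spaceInfinity s n).generic)) ∧
    -- at the origin
    (∀ m : ℤ, (s = 0 ∧ m = 0) ∨ (s = 1 ∧ 1 ≤ m) →
      (FrobLaurent.spaceFixed s m 0).dom ⊆ closure (FrobLaurent.spaceFixed s m 0).generic ∧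
      ∃ F : FrobLaurent.FrobeniusData ℕ,
        (FrobLaurent.spaceFixed s m 0).Realizes
          (fun _ => 1) (FrobLaurent.spaceFixed s m 0).lam 1 F ∧
        FrobLaurent.IsFrobeniusManifold F (FrobLaurent.spaceFixed s m 0).generic ∧
        (s = 1 → FrobLaurent.HasUnitForm F (FrobLaurent.spaceFixed s m 0).generic)) ∧
    -- at the origin, for a simple zero: the unit is not flat
    (s = 1 →
      (FrobLaurent.spaceFixed s (-1) 0).dom ⊆
        closure (FrobLaurent.spaceFixed s (-1) 0).generic ∧
      ∃ F : FrobLaurent.FrobeniusData ℕ,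
        (FrobLaurent.spaceFixed s (-1) 0).Realizes
          (fun u => 1 - (1 / u 0) • (FrobLaurent.spaceFixed s (-1) 0).lamp u)
          (FrobLaurent.spaceFixed s (-1) 0).lam 1 F ∧
        FrobLaurent.IsFrobeniusManifoldNonflatUnit F
          (FrobLaurent.spaceFixed s (-1) 0).generic ∧
        FrobLaurent.HasUnitForm F (FrobLaurent.spaceFixed s (-1) 0).generic) ∧
    -- at a moving point, nonzero degree: the point is one of the coordinates
    (∀ m : ℤ, -1 ≤ m → m ≠ 0 →
      (FrobLaurent.spaceMoving s m).dom ⊆ closure (FrobLaurent.spaceMoving s m).generic ∧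
      ∃ F : FrobLaurent.FrobeniusData (Option ℕ),
        (FrobLaurent.spaceMoving s m).Realizes
          (fun _ => 1) (FrobLaurent.spaceMoving s m).lam 1 F ∧
        FrobLaurent.IsFrobeniusManifold F (FrobLaurent.spaceMoving s m).generic) ∧
    -- at a moving point, degree zero: the variation of the point is already tangent to the
    -- space of series at this point, so that for every point one has a chart
    (∀ v : ℂ, (s = 1 → v ≠ 0) →
      (FrobLaurent.spaceFixed s 0 v).dom ⊆ closure (FrobLaurent.spaceFixed s 0 v).generic ∧
      ∃ F : FrobLaurent.FrobeniusData ℕ,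
        (FrobLaurent.spaceFixed s 0 v).Realizes
          (fun _ => 1) (FrobLaurent.spaceFixed s 0 v).lam 1 F ∧
        FrobLaurent.IsFrobeniusManifold F (FrobLaurent.spaceFixed s 0 v).generic) := by
  refine ⟨fun n hn => FrobLaurent.infinity_main s n hs hn, ?_, ?_,
    fun m hm hm0 => FrobLaurent.moving_main hs hm hm0,
    fun v hv => FrobLaurent.degree_zero_main s v hs hv⟩
  · rintro m (⟨rfl, rfl⟩ | ⟨rfl, hm⟩)
    · obtain ⟨hd, F, hr, hF⟩ := FrobLaurent.degree_zero_main 0 0 (Or.inl rfl) (by simp)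
      exact ⟨hd, F, hr, hF, fun h => absurd h (by norm_num)⟩
    · obtain ⟨hd, F, hr, hF, hunit⟩ := FrobLaurent.origin_main hm
      exact ⟨hd, F, hr, hF, fun _ => hunit⟩
  · rintro rfl
    exact FrobLaurent.simple_zero_main
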